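/- **Setting.** Fix $\lambda_1,\lambda_2>0$, $d\ge 1$, and put $\Omega_0=(-d,d)^2$, $|\Omega_0|=4d^2$. All functions and sequences are complex valued. *Function spaces.* $L^2_{D_4}(\mathbb{R}^2)$ is the space of $u\in L^2(\mathbb{R}^2)$ with $u(x_1,x_2)=u(-x_1,x_2)=u(x_1,-x_2)=u(x_2,x_1)$ a.e., and $L^2_{D_4}=L^2_{D_4}(\mathbb{R}^2)\times L^2_{D_4}(\mathbb{R}^2)$ with its Hilbert norm. With $\hat u$ the Fourier transform ($\hat u(\xi)=\int u(x)e^{-2\pi i x\cdot\xi}dx$), let $l_{11}(\xi)=-\lambda_1|2\pi\xi|^2-1$, $l_{21}(\xi)=\lambda_1\lambda_2-1$, $l_{22}(\xi)=-|2\pi\xi|^2-\lambda_2$, let $\mathbb{L}_{ij}$ be the operator with symbol $l_{ij}$, and $$\mathbb{L}=\begin{bmatrix}\mathbb{L}_{11}&0\\ \mathbb{L}_{21}&\mathbb{L}_{22}\end{bmatrix},\qquad \mathbb{L}^{-1}=\begin{bmatrix}\mathbb{L}_{11}^{-1}&0\\-\mathbb{L}_{22}^{-1}\mathbb{L}_{21}\mathbb{L}_{11}^{-1}&\mathbb{L}_{22}^{-1}\end{bmatrix}.$$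 $\mathcal{H}_{D_4}$ is the Hilbert space of those $\mathbf u\in L^2_{D_4}$ with $\mathbb{L}\mathbf u\in L^2_{D_4}$, with norm $\|\mathbf u\|_{\mathcal H}=\|\mathbb{L}\mathbf u\|_2$; its elements are bounded functions, and $\mathbb{L}:\mathcal{H}_{D_4}\to L^2_{D_4}$ is an isometric isomorphism. Let $$\mathbb{F}:\mathcal{H}_{D_4}\to L^2_{D_4},\qquad \mathbb{F}(\mathbf u)=\mathbb{L}\mathbf u+\mathbb{G}(\mathbf u),\qquad \mathbb{G}(u_1,u_2)=\big((u_2+1-\lambda_1u_1)u_1^2,\,0\big).$$ *Sequence spaces.* Let $J=\{n\in\mathbb{Z}^2:0\le n_2\le n_1\}$, let $\mathrm{orb}(n)$ be the orbit of $n$ under the sign changes and the swap of coordinates, and $\alpha_n=|\mathrm{orb}(n)|$. $\ell^2(J)$ and $\ell^1(J)$ have the norms $\|U\|_2=(\sum_{n\in J}\alpha_n|u_n|^2)^{1/2}$ and $\|U\|_1=\sum_{n\in J}\alpha_n|u_n|$, and $\ell^2_{D_4}=\ell^2(J)\times\ell^2(J)$ with its Hilbert norm. For $M\in\mathbb{N}$,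 $\pi^M$ keeps the coefficients with $n_1\le M$ and sets the others to $0$, and $\pi_M=I-\pi^M$. With $\tilde n=n/(2d)$ put $$\gamma(u)_n=\frac1{|\Omega_0|}\int_{\Omega_0}u(x)e^{-2\pi i\tilde n\cdot x}dx,\qquad \gamma^\dagger(U)(x)=\mathbb{1}_{\Omega_0}(x)\sum_{n\in J}u_n\sum_{m\in\mathrm{orb}(n)}e^{2\pi i\tilde m\cdot x},$$ $\Gamma^\dagger(K)=\gamma^\dagger K\gamma$ for bounded $K$ on $\ell^2(J)$. Let $\boldsymbol\gamma,\boldsymbol\gamma^\dagger$ be the componentwise maps and $\boldsymbol\Gamma^\dagger(K)=\boldsymbol\gamma^\dagger K\boldsymbol\gamma$ for bounded $K$ on $\ell^2_{D_4}$. $L_{11}^{-1},L_{21},L_{22}^{-1}$ are the diagonal operators on $\ell^2(J)$ with entries $1/l_{11}(\tilde n),\,l_{21}(\tilde n),\,1/l_{22}(\tilde n)$, and $L^{-1}=\begin{bmatrix}L_{11}^{-1}&0\\-L_{22}^{-1}L_{21}L_{11}^{-1}&L_{22}^{-1}\end{bmatrix}$. For a set $S$, $\mathbb{1}_S$ also denotes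 the operator of multiplication by its indicator function (componentwise on pairs). $\|\cdot\|_2$ of an operator is its operator norm on the space of $D_4$-symmetric functions, of pairs of such functions, or of sequences, on which it acts; $\|\cdot\|_{\mathcal H}$ is the operator norm on $\mathcal{H}_{D_4}$. *Data.* Let $N,N_0\in\mathbb{N}$ and let $\mathbf U_0\in\ell^2_{D_4}$ have real entries, with $\mathbf U_0=\pi^{N_0}\mathbf U_0$ and $\mathbf u_0=(u_{0,1},u_{0,2}):=\boldsymbol\gamma^\dagger(\mathbf U_0)\in\mathcal{H}_{D_4}$. Put $$v_1=2u_{0,2}u_{0,1}+2u_{0,1}-3\lambda_1u_{0,1}^2,\quad v_2=u_{0,1}^2,\quad V_i=\gamma(v_i),\quad V_i^N=\pi^{2N}V_i,\quad v_i^N=\gamma^\dagger(V_i^N)\quad(i=1,2),$$ let $\mathbb{v}_i^N$ be the multiplication operator by $v_i^N$ on $L^2_{D_4}(\mathbb{R}^2)$ and $\mathbb{V}_i^N:U\mapsto V_i^N*U=\gamma(\gamma^\dagger(V_i^N)\gamma^\dagger(U))$ the discrete convolution operator on $\ell^2(J)$, and $$DG^N(\mathbf U_0)=\begin{bmatrix}\mathbb{V}_1^N&\mathbb{V}_2^N\\0&0\end{bmatrix},\qquad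 D\mathbb{G}^N(\mathbf u_0)=\boldsymbol\Gamma^\dagger(DG^N(\mathbf U_0)).$$ Let $B_{11}^N,B_{12}^N$ be bounded operators on $\ell^2(J)$ with $B_{1j}^N=\pi^NB_{1j}^N\pi^N$, and $$B=\begin{bmatrix}\pi_N&0\\0&\pi_N\end{bmatrix}+\begin{bmatrix}B_{11}^N&B_{12}^N\\0&\pi^N\end{bmatrix},\qquad \mathbb{B}=\mathbb{1}_{\mathbb{R}^2\setminus\Omega_0}+\boldsymbol\Gamma^\dagger(B),\qquad \mathbb{A}=\mathbb{L}^{-1}\mathbb{B}:L^2_{D_4}\to\mathcal{H}_{D_4}.$$ Finally, $\varphi(x_1,x_2,x_3,x_4)=\min\big\{\max\{x_1,x_4\}+\max\{x_2,x_3\},\,\sqrt{x_1^2+x_2^2+x_3^2+x_4^2}\big\}$. **Lemma.** Let $\mathcal{Z}_{u,k,j}$ ($k\in\{1,2\}$, $j\in\{1,2,3\}$) be real numbers with $$\begin{aligned} \mathcal{Z}_{u,1,1}&\ge\|\mathbb{1}_{\mathbb{R}^2\setminus\Omega_0}\mathbb{L}_{11}^{-1}\mathbb{v}_1^N\|_2,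 & \mathcal{Z}_{u,2,1}&\ge\|\mathbb{1}_{\Omega_0}(\mathbb{L}_{11}^{-1}-\Gamma^\dagger(L_{11}^{-1}))\mathbb{v}_1^N\|_2,\\ \mathcal{Z}_{u,1,2}&\ge\|\mathbb{1}_{\mathbb{R}^2\setminus\Omega_0}\mathbb{L}_{22}^{-1}\mathbb{v}_2^N\|_2, & \mathcal{Z}_{u,2,2}&\ge\|\mathbb{1}_{\Omega_0}(\mathbb{L}_{22}^{-1}-\Gamma^\dagger(L_{22}^{-1}))\mathbb{v}_2^N\|_2,\\ \mathcal{Z}_{u,1,3}&\ge\|\mathbb{1}_{\mathbb{R}^2\setminus\Omega_0}\mathbb{L}_{22}^{-1}\mathbb{L}_{21}\mathbb{L}_{11}^{-1}\mathbb{v}_2^N\|_2, & \mathcal{Z}_{u,2,3}&\ge\|\mathbb{1}_{\Omega_0}(\mathbb{L}_{22}^{-1}\mathbb{L}_{21}\mathbb{L}_{11}^{-1}-\Gamma^\dagger(L_{22}^{-1}L_{21}L_{11}^{-1}))\mathbb{v}_2^N\|_2, \end{aligned}$$ and set $\mathcal{Z}_{u,k}=\sqrt{(\mathcal{Z}_{u,k,1}+\mathcal{Z}_{u,k,3})^2+\mathcal{Z}_{u,k,2}^2}$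 for $k=1,2$. Then $$\|D\mathbb{G}^N(\mathbf u_0)\,\mathbb{L}^{-1}\,\mathbb{1}_{\mathbb{R}^2\setminus\Omega_0}\|_2\le\mathcal{Z}_{u,1},\qquad \|D\mathbb{G}^N(\mathbf u_0)\,(\boldsymbol\Gamma^\dagger(L^{-1})-\mathbb{L}^{-1})\,\mathbb{1}_{\Omega_0}\|_2\le\mathcal{Z}_{u,2}.$$ Furthermore, let $Z_1\ge0$ satisfy $Z_1\ge\|I-B(I+DG^N(\mathbf U_0)L^{-1})\|_2$, let $\mathcal{Z}_u=\sqrt{\mathcal{Z}_{u,1}^2+\mathcal{Z}_{u,2}^2}$ and $$\mathcal{Z}_1=Z_1+\max\{1,\|B_{11}^N\|_2\}\left(\mathcal{Z}_u+\varphi\Big(1,0,\frac{|\lambda_1\lambda_2-1|}{\lambda_2},\frac1{\lambda_2}\Big)\sqrt{\|V_1^N-V_1\|_1^2+\|V_2^N-V_2\|_1^2}\right).$$ Then, with $D\mathbb{F}(\mathbf u_0)$ the Fréchet derivative of $\mathbb{F}$ at $\mathbf u_0$, $$\|I-\mathbb{A}\,D\mathbb{F}(\mathbf u_0)\|_{\mathcal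 H}\le\mathcal{Z}_1.$$ -/

import Mathlib

open MeasureTheory FourierTransform
open scoped ENNReal NNReal

noncomputable section

namespace GrayScott

/-! ### Multiplication operators on `L²` and block operators -/

section Operators

variable {α : Type*} [MeasurableSpace α] {μ : Measure α}

/-- The bounded operator `f ↦ φ f` on `L²(μ)`, for `φ ∈ L^∞(μ)`. -/
def mulOp (φ : α → ℂ) (hφ : MemLp φ ∞ μ) : Lp ℂ 2 μ →L[ℂ] Lp ℂ 2 μ :=
  (ContinuousLinearMap.mul ℂ ℂ).holderL μ ∞ 2 2 (hφ.toLp φ)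

theorem mulOp_coe (φ : α → ℂ) (hφ : MemLp φ ∞ μ) (f : Lp ℂ 2 μ) :
    (mulOp φ hφ f : α → ℂ) =ᵐ[μ] fun x => φ x * f x := by
  have h1 := (ContinuousLinearMap.mul ℂ ℂ).coeFn_holder (r := 2) (hφ.toLp φ) f
  filter_upwards [h1, hφ.coeFn_toLp] with x h1 h2
  have : (mulOp φ hφ f : α → ℂ) x =
      ((ContinuousLinearMap.mul ℂ ℂ).holder 2 (hφ.toLp φ) f : α → ℂ) x := rfl
  rw [this, h1, h2]
  rfl

variable {X Y : Type*} [NormedAddCommGroup X] [InnerProductSpace ℂ X]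
  [NormedAddCommGroup Y] [InnerProductSpace ℂ Y]

/-- The operator `(x₁, x₂) ↦ (A x₁ + B x₂, C x₁ + D x₂)` between the Hilbert sums
`X ⊕ X` and `Y ⊕ Y`. -/
def blockOp (A B C D : X →L[ℂ] Y) : WithLp 2 (X × X) →L[ℂ] WithLp 2 (Y × Y) :=
  (WithLp.prodContinuousLinearEquiv 2 ℂ Y Y).symm.toContinuousLinearMap ∘L
    ((A ∘L .fst ℂ X X + B ∘L .snd ℂ X X).prod (C ∘L .fst ℂ X X + D ∘L .snd ℂ X X)) ∘L
    (WithLp.prodContinuousLinearEquiv 2 ℂ X X).toContinuousLinearMap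

/-- The operator acting on both components by `A`. -/
def diagOp (A : X →L[ℂ] Y) : WithLp 2 (X × X) →L[ℂ] WithLp 2 (Y × Y) := blockOp A 0 0 A

theorem blockOp_fst (A B C D : X →L[ℂ] Y) (x : WithLp 2 (X × X)) :
    (blockOp A B C D x).fst = A x.fst + B x.snd := rfl

theorem blockOp_snd (A B C D : X →L[ℂ] Y) (x : WithLp 2 (X × X)) :
    (blockOp A B C D x).snd = C x.fst + D x.snd := rfl

end Operators

/-! ### `D₄`-symmetric functions on the plane -/

/-- The Euclidean plane. -/
abbrev Plane := EuclideanSpace ℝ (Fin 2)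

/-- `L²(ℝ²)`, complex valued. -/
abbrev L2Plane := Lp ℂ 2 (volume : Measure Plane)

/-- The generators `(x₁, x₂) ↦ (-x₁, x₂), (x₁, -x₂), (x₂, x₁)` of the dihedral group `D₄`. -/
def d4Gen : Fin 3 → (Plane ≃ₗᵢ[ℝ] Plane) :=
  ![LinearIsometryEquiv.piLpCongrRight 2 ![LinearIsometryEquiv.neg ℝ, LinearIsometryEquiv.refl ℝ ℝ],
    LinearIsometryEquiv.piLpCongrRight 2 ![LinearIsometryEquiv.refl ℝ ℝ, LinearIsometryEquiv.neg ℝ],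
    LinearIsometryEquiv.piLpCongrLeft 2 ℝ ℝ (Equiv.swap 0 1)]

theorem d4Gen_zero (x : Plane) : d4Gen 0 x = !₂[-x 0, x 1] := by
  ext i; fin_cases i <;> simp [d4Gen]

theorem d4Gen_one (x : Plane) : d4Gen 1 x = !₂[x 0, -x 1] := by
  ext i; fin_cases i <;> simp [d4Gen]

theorem d4Gen_two (x : Plane) : d4Gen 2 x = !₂[x 1, x 0] := by
  ext i; fin_cases i <;> simp [d4Gen, LinearIsometryEquiv.piLpCongrLeft_apply]

theorem d4Gen_mp (i : Fin 3) : MeasurePreserving (d4Gen i) (volume : Measure Plane) volume :=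
  (d4Gen i).measurePreserving

theorem d4Gen_invol (i : Fin 3) (x : Plane) : d4Gen i (d4Gen i x) = x := by
  fin_cases i
  · simp only [Fin.zero_eta, d4Gen_zero]; ext j; fin_cases j <;> simp
  · simp only [Fin.mk_one, d4Gen_one]; ext j; fin_cases j <;> simp
  · simp only [Fin.reduceFinMk, d4Gen_two]; ext j; fin_cases j <;> simp

/-- `L²_{D₄}(ℝ²)`: the functions `u` with
`u(x₁, x₂) = u(-x₁, x₂) = u(x₁, -x₂) = u(x₂, x₁)` almost everywhere. -/
def L2D4 : Submodule ℂ L2Plane where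
  carrier := {u | ∀ i, (fun x => u (d4Gen i x)) =ᵐ[volume] u}
  add_mem' {u v} hu hv i := by
    filter_upwards [hu i, hv i, Lp.coeFn_add u v,
      (d4Gen_mp i).quasiMeasurePreserving.ae (Lp.coeFn_add u v)] with x h1 h2 h3 h4
    simp_all
  zero_mem' i := by
    filter_upwards [Lp.coeFn_zero ℂ 2 (volume : Measure Plane),
      (d4Gen_mp i).quasiMeasurePreserving.ae (Lp.coeFn_zero ℂ 2 (volume : Measure Plane))]
      with x h1 h2
    simp_all
  smul_mem' c u hu i := by
    filter_upwards [hu i, Lp.coeFn_smul c u,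
      (d4Gen_mp i).quasiMeasurePreserving.ae (Lp.coeFn_smul c u)] with x h1 h3 h4
    simp_all

/-- Composition with a generator of `D₄`, as an isometry of `L²(ℝ²)`. -/
def compGen (i : Fin 3) : L2Plane →ₗᵢ[ℂ] L2Plane :=
  Lp.compMeasurePreservingₗᵢ ℂ (d4Gen i) (d4Gen_mp i)

theorem compGen_coe (i : Fin 3) (u : L2Plane) :
    (compGen i u : Plane → ℂ) =ᵐ[volume] fun x => u (d4Gen i x) :=
  Lp.coeFn_compMeasurePreserving u (d4Gen_mp i)

theorem mem_L2D4_iff (u : L2Plane) : u ∈ L2D4 ↔ ∀ i, compGen i u = u := by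
  refine forall_congr' fun i => ⟨fun h => Lp.ext ((compGen_coe i u).trans h), fun h => ?_⟩
  have := compGen_coe i u
  rw [h] at this
  exact this.symm

theorem isClosed_L2D4 : IsClosed (L2D4 : Set L2Plane) := by
  have : (L2D4 : Set L2Plane) = ⋂ i, {u | compGen i u = u} := by
    ext u; simp [mem_L2D4_iff]
  rw [this]
  exact isClosed_iInter fun i => isClosed_eq (compGen i).continuous continuous_id

/-- The restriction to `L²_{D₄}(ℝ²)` of an operator on `L²(ℝ²)` which preserves it. -/
def restrictD4 (T : L2Plane →L[ℂ] L2Plane) (hT : ∀ u ∈ L2D4, T u ∈ L2D4) : L2D4 →L[ℂ] L2D4 :=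
  (T ∘L L2D4.subtypeL).codRestrict L2D4 fun u => hT u u.2

theorem mulOp_mem_L2D4 (φ : Plane → ℂ) (hφ : MemLp φ ∞ volume)
    (hs : ∀ i, (fun x => φ (d4Gen i x)) =ᵐ[volume] φ) (u : L2Plane) (hu : u ∈ L2D4) :
    mulOp φ hφ u ∈ L2D4 := fun i => by
  filter_upwards [hu i, hs i, mulOp_coe φ hφ u,
    (d4Gen_mp i).quasiMeasurePreserving.ae (mulOp_coe φ hφ u)] with x h1 h2 h3 h4
  simp_all

/-- Multiplication by a `D₄`-symmetric bounded function, as an operator on `L²_{D₄}(ℝ²)`. -/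
def mulD4 (φ : Plane → ℂ) (hφ : MemLp φ ∞ volume)
    (hs : ∀ i, (fun x => φ (d4Gen i x)) =ᵐ[volume] φ) : L2D4 →L[ℂ] L2D4 :=
  restrictD4 (mulOp φ hφ) (mulOp_mem_L2D4 φ hφ hs)

/-! ### Fourier multipliers -/

theorem fourier_compGen (i : Fin 3) (u : L2Plane) : 𝓕 (compGen i u) = compGen i (𝓕 u) := by
  refine DenseRange.induction_on (p := fun u : L2Plane => 𝓕 (compGen i u) = compGen i (𝓕 u))
    (SchwartzMap.denseRange_toLpCLM (E := Plane) (F := ℂ) (p := 2) ENNReal.ofNat_ne_top) u ?_ ?_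
  · exact isClosed_eq ((Lp.fourierTransformₗᵢ Plane ℂ).continuous.comp (compGen i).continuous)
      ((compGen i).continuous.comp (Lp.fourierTransformₗᵢ Plane ℂ).continuous)
  intro f
  have key : ∀ g : SchwartzMap Plane ℂ, compGen i (g.toLp 2) =
      (SchwartzMap.compCLMOfContinuousLinearEquiv ℂ (d4Gen i).toContinuousLinearEquiv g).toLp 2 := by
    intro g
    refine Lp.ext ?_
    filter_upwards [compGen_coe i (g.toLp 2), SchwartzMap.coeFn_toLp
      (SchwartzMap.compCLMOfContinuousLinearEquiv ℂ (d4Gen i).toContinuousLinearEquiv g) 2 volume,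
      (d4Gen_mp i).quasiMeasurePreserving.ae (SchwartzMap.coeFn_toLp g 2 volume)] with x h1 h2 h3
    rw [h1, h2, h3]
    rfl
  simp only [SchwartzMap.toLpCLM_apply]
  rw [key, SchwartzMap.toLp_fourier_eq, SchwartzMap.toLp_fourier_eq, key]
  congr 1
  ext ξ
  have := Real.fourier_comp_linearIsometry (d4Gen i) (f : Plane → ℂ) ξ
  simpa [SchwartzMap.fourier_coe] using this

theorem fourier_mem_L2D4 {u : L2Plane} (hu : u ∈ L2D4) : 𝓕 u ∈ L2D4 := by
  rw [mem_L2D4_iff] at hu ⊢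
  intro i
  rw [← fourier_compGen, hu i]

theorem fourierInv_mem_L2D4 {u : L2Plane} (hu : u ∈ L2D4) : 𝓕⁻ u ∈ L2D4 := by
  rw [mem_L2D4_iff] at hu ⊢
  intro i
  have h := fourier_compGen i (𝓕⁻ u)
  rw [fourier_fourierInv_eq, hu i] at h
  have e : 𝓕⁻ (𝓕 (compGen i (𝓕⁻ u)) : L2Plane) = compGen i (𝓕⁻ u) := fourierInv_fourier_eq _
  rw [h] at e
  exact e.symm

/-- The Fourier multiplier operator `u ↦ 𝓕⁻¹ (m 𝓕 u)` on `L²_{D₄}(ℝ²)`, for a bounded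
`D₄`-symmetric symbol `m`. -/
def fourierMultD4 (m : Plane → ℂ) (hm : MemLp m ∞ volume)
    (hs : ∀ i, (fun x => m (d4Gen i x)) =ᵐ[volume] m) : L2D4 →L[ℂ] L2D4 :=
  restrictD4
    ((Lp.fourierTransformₗᵢ Plane ℂ).symm.toContinuousLinearEquiv.toContinuousLinearMap ∘L
      mulOp m hm ∘L (Lp.fourierTransformₗᵢ Plane ℂ).toContinuousLinearEquiv.toContinuousLinearMap)
    fun _ hu => fourierInv_mem_L2D4 (mulOp_mem_L2D4 m hm hs _ (fourier_mem_L2D4 hu))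


/-! ### Parameters of the problem and the square `Ω₀` -/

/-- The parameters `λ₁, λ₂ > 0` of the equation and the half-width `d ≥ 1` of `Ω₀ = (-d, d)²`. -/
structure Params where
  lam1 : ℝ
  lam2 : ℝ
  d : ℝ
  lam1_pos : 0 < lam1
  lam2_pos : 0 < lam2
  one_le_d : 1 ≤ d

/-- The square `Ω₀ = (-d, d)²`. -/
def Omega (P : Params) : Set Plane := {x | ∀ i, x i ∈ Set.Ioo (-P.d) P.d}

theorem Omega_eq (P : Params) :
    Omega P = (WithLp.ofLp : Plane → Fin 2 → ℝ) ⁻¹' Set.univ.pi fun _ => Set.Ioo (-P.d) P.d := by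
  ext x; simp [Omega]

theorem measurableSet_Omega (P : Params) : MeasurableSet (Omega P) := by
  rw [Omega_eq]
  exact (PiLp.volume_preserving_ofLp (Fin 2)).measurable
    (MeasurableSet.univ_pi fun _ => measurableSet_Ioo)

theorem volume_Omega (P : Params) : volume (Omega P) = ENNReal.ofReal (2 * P.d) ^ 2 := by
  rw [Omega_eq, (PiLp.volume_preserving_ofLp (Fin 2)).measure_preimage
    (MeasurableSet.univ_pi fun _ => measurableSet_Ioo).nullMeasurableSet, volume_pi_pi]
  simp [Real.volume_Ioo, two_mul]

theorem volume_Omega_ne_top (P : Params) : volume (Omega P) ≠ ∞ := by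
  rw [volume_Omega]; finiteness

/-- The area `|Ω₀|`. -/
def area (P : Params) : ℝ := volume.real (Omega P)

theorem area_pos (P : Params) : 0 < area P := by
  have := P.one_le_d
  rw [area, Measure.real, volume_Omega, ENNReal.toReal_pow, ENNReal.toReal_ofReal (by linarith)]
  positivity

theorem d4Gen_mem_Omega (P : Params) (i : Fin 3) (x : Plane) :
    d4Gen i x ∈ Omega P ↔ x ∈ Omega P := by
  fin_cases i
  · simp only [Fin.zero_eta, d4Gen_zero, Omega, Set.mem_ofPred_eq, Fin.forall_fin_two, Set.mem_Ioo]
    simp; grind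
  · simp only [Fin.mk_one, d4Gen_one, Omega, Set.mem_ofPred_eq, Fin.forall_fin_two, Set.mem_Ioo]
    simp; grind
  · simp only [Fin.reduceFinMk, d4Gen_two, Omega, Set.mem_ofPred_eq, Fin.forall_fin_two]
    simpa using and_comm

open Classical in
/-- The operator `𝟙_S` of multiplication by the indicator function of a measurable
`D₄`-symmetric set. -/
def indD4 (S : Set Plane) (hS : MeasurableSet S) (hs : ∀ i x, d4Gen i x ∈ S ↔ x ∈ S) :
    L2D4 →L[ℂ] L2D4 :=
  mulD4 (S.indicator fun _ => 1)
    ((memLp_top_const (1 : ℂ)).indicator hS)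
    fun i => Filter.Eventually.of_forall fun x => by simp [Set.indicator_apply, hs]

/-- The operator `𝟙_{Ω₀}`. -/
def indIn (P : Params) : L2D4 →L[ℂ] L2D4 :=
  indD4 (Omega P) (measurableSet_Omega P) (d4Gen_mem_Omega P)

/-- The operator `𝟙_{ℝ² \ Ω₀}`. -/
def indOut (P : Params) : L2D4 →L[ℂ] L2D4 :=
  indD4 (Omega P)ᶜ (measurableSet_Omega P).compl fun i x => (d4Gen_mem_Omega P i x).not

/-! ### Sequence spaces -/

/-- The reduced index set `J_red(D₄) = {n ∈ ℤ² : 0 ≤ n₂ ≤ n₁}`. -/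
abbrev Jred := {n : ℤ × ℤ // 0 ≤ n.2 ∧ n.2 ≤ n.1}

/-- The orbit of `n` under the action of `D₄` on `ℤ²`. -/
def orb (n : ℤ × ℤ) : Finset (ℤ × ℤ) :=
  {(n.1, n.2), (-n.1, n.2), (n.1, -n.2), (-n.1, -n.2),
    (n.2, n.1), (-n.2, n.1), (n.2, -n.1), (-n.2, -n.1)}

/-- The size `α_n` of the orbit of `n ∈ J_red(D₄)`. -/
def alpha (n : Jred) : ℕ := (orb n).card

theorem alpha_eq (n : Jred) : alpha n =
    if n.1.1 = 0 ∧ n.1.2 = 0 then 1 else if n.1.1 = n.1.2 ∨ n.1.2 = 0 then 4 else 8 := by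
  obtain ⟨⟨a, b⟩, h1, h2⟩ := n
  simp only at h1 h2
  simp only [alpha, orb]
  split_ifs with h3 h4
  · obtain ⟨rfl, rfl⟩ := h3; rfl
  · rcases h4 with h4 | h4
    · subst h4
      rw [show ({(a, a), (-a, a), (a, -a), (-a, -a), (a, a), (-a, a), (a, -a), (-a, -a)} :
        Finset (ℤ × ℤ)) = {(a, a), (-a, a), (a, -a), (-a, -a)} by ext; simp]
      repeat rw [Finset.card_insert_of_notMem (by simp; omega)]
      simp
    · subst h4
      rw [show ({(a, 0), (-a, 0), (a, -0), (-a, -0), (0, a), (-0, a), (0, -a), (-0, -a)} :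
        Finset (ℤ × ℤ)) = {(a, 0), (-a, 0), (0, a), (0, -a)} by ext; simp]
      repeat rw [Finset.card_insert_of_notMem (by simp; omega)]
      simp
  · repeat rw [Finset.card_insert_of_notMem (by simp; omega)]
    simp

theorem alpha_pos (n : Jred) : 0 < alpha n := Finset.card_pos.2 ⟨n, by simp [orb]⟩

theorem alpha_le (n : Jred) : alpha n ≤ 8 := by
  rw [alpha_eq]; split_ifs <;> norm_num

/-- The measure `∑_n α_n δ_n` on `J_red(D₄)`. -/
def weight : Measure Jred := Measure.sum fun n => (alpha n : ℝ≥0∞) • Measure.dirac n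

theorem lintegral_weight (f : Jred → ℝ≥0∞) : ∫⁻ n, f n ∂weight = ∑' n, (alpha n : ℝ≥0∞) * f n := by
  simp [weight, lintegral_sum_measure]

theorem ae_weight_iff {p : Jred → Prop} : (∀ᵐ n ∂weight, p n) ↔ ∀ n, p n := by
  refine ⟨fun h n => ?_, fun h => Filter.Eventually.of_forall h⟩
  rw [weight, Measure.ae_sum_iff] at h
  have := h n
  rw [Measure.ae_ennreal_smul_measure_eq (by have := alpha_pos n; positivity)] at this
  simpa using this

theorem weight_ext {U V : Jred → ℂ} (h : U =ᵐ[weight] V) (n : Jred) : U n = V n :=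
  ae_weight_iff.1 h n

/-- `ℓ²(J_red(D₄))`, with norm `‖U‖₂ = (∑_n α_n |u_n|²)^{1/2}`. -/
abbrev Ell2 := Lp ℂ 2 weight

theorem memLp_weight_iff (U : Jred → ℂ) :
    MemLp U 2 weight ↔ Summable fun n => (alpha n : ℝ) * ‖U n‖ ^ 2 := by
  have h : ∀ n, (alpha n : ℝ≥0∞) * ‖U n‖ₑ ^ (2 : ℝ) =
      ENNReal.ofReal ((alpha n : ℝ) * ‖U n‖ ^ 2) := fun n => by
    rw [ENNReal.ofReal_mul (by positivity), ENNReal.ofReal_natCast,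
      ENNReal.ofReal_pow (norm_nonneg _), ofReal_norm]
    norm_cast
  rw [MemLp, and_iff_right (by fun_prop), eLpNorm_lt_top_iff_lintegral_rpow_enorm_lt_top
    (by norm_num) (by norm_num), lintegral_weight]
  simp only [ENNReal.toReal_ofNat, h]
  constructor
  · intro hs
    simpa [ENNReal.toReal_ofReal, mul_nonneg] using ENNReal.summable_toReal hs.ne
  · intro hs
    rw [← ENNReal.ofReal_tsum_of_nonneg (fun n => by positivity) hs]
    exact ENNReal.ofReal_lt_top

theorem Ell2.norm_sq (U : Ell2) : ‖U‖ ^ 2 = ∑' n, (alpha n : ℝ) * ‖U n‖ ^ 2 := by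
  have h : ∀ n, (alpha n : ℝ≥0∞) * ‖U n‖ₑ ^ (2 : ℝ) =
      ENNReal.ofReal ((alpha n : ℝ) * ‖U n‖ ^ 2) := fun n => by
    rw [ENNReal.ofReal_mul (by positivity), ENNReal.ofReal_natCast,
      ENNReal.ofReal_pow (norm_nonneg _), ofReal_norm]
    norm_cast
  rw [Lp.norm_def, eLpNorm_eq_lintegral_rpow_enorm_toReal (by norm_num) (by norm_num),
    lintegral_weight]
  simp only [ENNReal.toReal_ofNat, h]
  rw [← ENNReal.ofReal_tsum_of_nonneg (fun n => by positivity)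
    ((memLp_weight_iff U).1 (Lp.memLp U)), ← ENNReal.toReal_rpow,
    ENNReal.toReal_ofReal (tsum_nonneg fun n => by positivity), ← Real.sqrt_eq_rpow,
    Real.sq_sqrt (tsum_nonneg fun n => by positivity)]

/-- The norm `‖U‖₁ = ∑_n α_n |u_n|` of `ℓ¹(J_red(D₄))`. -/
def ell1Norm (U : Jred → ℂ) : ℝ := ∑' n, (alpha n : ℝ) * ‖U n‖

/-- The bounded diagonal operator `(u_n) ↦ (m_n u_n)` on `ℓ²(J_red(D₄))`. -/
def diagSeq (m : Jred → ℂ) (hm : ∃ C, ∀ n, ‖m n‖ ≤ C) : Ell2 →L[ℂ] Ell2 :=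
  mulOp m (memLp_top_of_bound (by fun_prop) hm.choose (Filter.Eventually.of_forall hm.choose_spec))

open Classical in
/-- The projection `π^M` of sequences: it keeps the coefficients with index in
`I^M = {n ∈ J_red(D₄) : n₁ ≤ M}` and sets the others to zero. -/
def truncSeq (M : ℕ) (U : Jred → ℂ) : Jred → ℂ := fun n => if n.1.1 ≤ M then U n else 0

open Classical in
/-- The projection `π^M` on `ℓ²(J_red(D₄))`. -/
def piUp (M : ℕ) : Ell2 →L[ℂ] Ell2 :=
  diagSeq (truncSeq M 1) ⟨1, fun n => by simp only [truncSeq]; split_ifs <;> simp⟩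

/-- The complementary projection `π_M = I - π^M`. -/
def piDown (M : ℕ) : Ell2 →L[ℂ] Ell2 := 1 - piUp M

/-! ### Fourier coefficients on `Ω₀` -/

/-- The frequency `ñ = n / (2d)`. -/
def freq (P : Params) (n : ℤ × ℤ) : Plane := !₂[n.1 / (2 * P.d), n.2 / (2 * P.d)]

/-- The function `x ↦ e^{2π i ñ·x}`. -/
def expo (P : Params) (n : ℤ × ℤ) (x : Plane) : ℂ :=
  Complex.exp (2 * Real.pi * Complex.I * (inner ℝ (freq P n) x : ℝ))

theorem inner_freq (P : Params) (n : ℤ × ℤ) (x : Plane) :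
    inner ℝ (freq P n) x = (n.1 * x 0 + n.2 * x 1) / (2 * P.d) := by
  simp [freq, PiLp.inner_apply, Fin.sum_univ_two]; ring

theorem norm_expo (P : Params) (n : ℤ × ℤ) (x : Plane) : ‖expo P n x‖ = 1 := by
  rw [expo, show (2 * Real.pi * Complex.I * (inner ℝ (freq P n) x : ℝ) : ℂ) =
    ((2 * Real.pi * inner ℝ (freq P n) x : ℝ) : ℂ) * Complex.I by push_cast; ring]
  exact Complex.norm_exp_ofReal_mul_I _

theorem continuous_expo (P : Params) (n : ℤ × ℤ) : Continuous (expo P n) := by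
  unfold expo; fun_prop

theorem conj_expo_mul (P : Params) (m n : ℤ × ℤ) (x : Plane) :
    (starRingEnd ℂ) (expo P m x) * expo P n x = expo P (n - m) x := by
  rw [expo, expo, expo, ← Complex.exp_conj, ← Complex.exp_add]
  congr 1
  simp only [inner_freq, map_mul, Complex.conj_ofReal, Complex.conj_I, map_ofNat, Prod.fst_sub,
    Prod.snd_sub]
  push_cast; ring

theorem integral_expo_one (d : ℝ) (hd : 0 < d) (k : ℤ) (hk : k ≠ 0) :
    ∫ t in Set.Ioo (-d) d, Complex.exp (Real.pi * Complex.I * k / d * t) = 0 := by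
  have hc : (Real.pi * Complex.I * k / d : ℂ) ≠ 0 := by
    simp [Real.pi_ne_zero, hk, hd.ne']
  rw [← integral_Ioc_eq_integral_Ioo, ← intervalIntegral.integral_of_le (by linarith),
    integral_exp_mul_complex hc]
  have hd' : (d : ℂ) ≠ 0 := by simpa using hd.ne'
  have h1 : (Real.pi * Complex.I * k / d : ℂ) * d = Real.pi * Complex.I * k := by field_simp
  have h2 : (Real.pi * Complex.I * k / d : ℂ) * (-d : ℝ) =
      Real.pi * Complex.I * k + ((-k : ℤ) : ℂ) * (2 * Real.pi * Complex.I) := by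
    push_cast; field_simp; ring
  rw [h1, h2, Complex.exp_add, Complex.exp_int_mul_two_pi_mul_I]
  simp

theorem integral_expo (P : Params) (n : ℤ × ℤ) :
    ∫ x in Omega P, expo P n x = if n = 0 then (area P : ℂ) else 0 := by
  split_ifs with hn
  · subst hn
    simp [expo, inner_freq, area]
  · have hd : 0 < P.d := lt_of_lt_of_le one_pos P.one_le_d
    have hd' : (P.d : ℂ) ≠ 0 := by simpa using hd.ne'
    set g : Fin 2 → ℝ → ℂ := fun i => (Set.Ioo (-P.d) P.d).indicator
      fun t => Complex.exp (Real.pi * Complex.I * ((![n.1, n.2] i : ℤ) : ℂ) / P.d * t)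
    have h1 : (∫ x in Omega P, expo P n x) = ∫ y : Fin 2 → ℝ, ∏ i, g i (y i) := by
      rw [← integral_indicator (measurableSet_Omega P),
        ← (PiLp.volume_preserving_ofLp (Fin 2)).integral_comp
          (MeasurableEquiv.toLp 2 (Fin 2 → ℝ)).symm.measurableEmbedding]
      refine integral_congr_ae (Filter.Eventually.of_forall fun x => ?_)
      simp only [Fin.prod_univ_two, g, Set.indicator_apply, Omega, Set.mem_ofPred_eq,
        Fin.forall_fin_two]
      by_cases h0 : x 0 ∈ Set.Ioo (-P.d) P.d <;> by_cases h1 : x 1 ∈ Set.Ioo (-P.d) P.d <;>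
        simp only [h0, h1, and_self, and_true, and_false, if_true, if_false, mul_zero, zero_mul]
      rw [expo, ← Complex.exp_add]
      congr 1
      simp only [inner_freq, Matrix.cons_val_zero, Matrix.cons_val_one]
      push_cast; field_simp
    rw [h1, integral_fintype_prod_volume_eq_prod, Fin.prod_univ_two]
    have h2 : ∀ i, (∫ t, g i t) = ∫ t in Set.Ioo (-P.d) P.d,
        Complex.exp (Real.pi * Complex.I * ((![n.1, n.2] i : ℤ) : ℂ) / P.d * t) := fun i =>
      integral_indicator measurableSet_Ioo
    rw [h2, h2]
    by_cases h3 : n.1 = 0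
    · have h4 : n.2 ≠ 0 := fun h => hn (Prod.ext h3 h)
      rw [mul_eq_zero]; right
      exact integral_expo_one P.d hd _ h4
    · rw [mul_eq_zero]; left
      exact integral_expo_one P.d hd _ h3

theorem memLp_expo (P : Params) (n : ℤ × ℤ) (p : ℝ≥0∞) :
    MemLp ((Omega P).indicator (expo P n)) p volume := by
  rw [memLp_indicator_iff_restrict (measurableSet_Omega P)]
  have : IsFiniteMeasure (volume.restrict (Omega P)) :=
    isFiniteMeasure_restrict.2 (volume_Omega_ne_top P)
  exact MemLp.of_bound (continuous_expo P n).aestronglyMeasurable 1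
    (Filter.Eventually.of_forall fun x => (norm_expo P n x).le)

/-- The function `𝟙_{Ω₀} e^{2π i ñ·x}` as an element of `L²(ℝ²)`. -/
def expoL2 (P : Params) (n : ℤ × ℤ) : L2Plane := (memLp_expo P n 2).toLp _

theorem inner_expoL2 (P : Params) (n : ℤ × ℤ) (u : L2Plane) :
    inner ℂ (expoL2 P n) u = ∫ x in Omega P, u x * expo P (-n) x := by
  rw [L2.inner_def, ← integral_indicator (measurableSet_Omega P)]
  refine integral_congr_ae ?_
  filter_upwards [(memLp_expo P n 2).coeFn_toLp] with x hx
  rw [expoL2, hx, RCLike.inner_apply]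
  by_cases h : x ∈ Omega P
  · have := conj_expo_mul P n 0 x
    simp only [expo, inner_freq] at this
    simp only [h, Set.indicator_of_mem]
    congr 1
    simpa [expo, inner_freq] using this
  · simp [h]

theorem inner_expoL2_expoL2 (P : Params) (m n : ℤ × ℤ) :
    inner ℂ (expoL2 P m) (expoL2 P n) = if m = n then (area P : ℂ) else 0 := by
  rw [L2.inner_def]
  have : (∫ x, inner ℂ ((expoL2 P m : Plane → ℂ) x) ((expoL2 P n : Plane → ℂ) x)) =
      ∫ x in Omega P, expo P (n - m) x := by
    rw [← integral_indicator (measurableSet_Omega P)]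
    refine integral_congr_ae ?_
    filter_upwards [(memLp_expo P n 2).coeFn_toLp, (memLp_expo P m 2).coeFn_toLp] with x h1 h2
    rw [expoL2, expoL2, h1, h2, RCLike.inner_apply]
    by_cases h : x ∈ Omega P
    · simp [h, ← conj_expo_mul, mul_comm]
    · simp [h]
  rw [this, integral_expo]
  simp only [sub_eq_zero, eq_comm]

/-- The Fourier coefficients `(1 / |Ω₀|) ∫_{Ω₀} u(x) e^{-2π i ñ·x} dx`. -/
def coeff (P : Params) (u : Plane → ℂ) (n : Jred) : ℂ :=
  (area P : ℂ)⁻¹ * ∫ x in Omega P, u x * expo P (-n) x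

theorem sqrt_area_sq (P : Params) : (((Real.sqrt (area P) : ℝ) : ℂ)) ^ 2 = area P := by
  norm_cast; exact Real.sq_sqrt (area_pos P).le

theorem sqrt_area_ne (P : Params) : (((Real.sqrt (area P) : ℝ) : ℂ)) ≠ 0 := by
  simpa using (Real.sqrt_pos.2 (area_pos P)).ne'

theorem orthonormal_expoL2 (P : Params) :
    Orthonormal ℂ fun n : Jred => ((Real.sqrt (area P))⁻¹ : ℂ) • expoL2 P n := by
  rw [orthonormal_iff_ite]
  intro m n
  have h := sqrt_area_sq P
  have h' := sqrt_area_ne P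
  rw [inner_smul_left, inner_smul_right, inner_expoL2_expoL2]
  simp only [Subtype.ext_iff]
  split_ifs
  · rw [← h]; simp; field_simp
  · simp

theorem norm_inner_expoL2 (P : Params) (u : L2Plane) (n : Jred) :
    ‖inner ℂ (expoL2 P n) u‖ ^ 2 =
      area P * ‖inner ℂ (((Real.sqrt (area P))⁻¹ : ℂ) • expoL2 P n) u‖ ^ 2 := by
  rw [inner_smul_left, norm_mul, mul_pow]
  have h1 : ‖(starRingEnd ℂ) ((Real.sqrt (area P) : ℝ) : ℂ)⁻¹‖ ^ 2 = (area P)⁻¹ := by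
    rw [RCLike.norm_conj, norm_inv, Complex.norm_real, inv_pow, Real.norm_eq_abs, sq_abs,
      Real.sq_sqrt (area_pos P).le]
  rw [h1, ← mul_assoc, mul_inv_cancel₀ (area_pos P).ne', one_mul]

theorem summable_inner_expoL2 (P : Params) (u : L2Plane) :
    Summable fun n : Jred => ‖inner ℂ (expoL2 P n) u‖ ^ 2 := by
  simp_rw [norm_inner_expoL2]
  exact ((orthonormal_expoL2 P).inner_products_summable u).mul_left _

theorem tsum_inner_expoL2_le (P : Params) (u : L2Plane) :
    ∑' n : Jred, ‖inner ℂ (expoL2 P n) u‖ ^ 2 ≤ area P * ‖u‖ ^ 2 := by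
  simp_rw [norm_inner_expoL2]
  rw [tsum_mul_left]
  exact mul_le_mul_of_nonneg_left ((orthonormal_expoL2 P).tsum_inner_products_le u)
    (area_pos P).le

theorem coeff_eq_inner (P : Params) (u : L2Plane) (n : Jred) :
    coeff P u n = (area P : ℂ)⁻¹ * inner ℂ (expoL2 P n) u := by
  rw [coeff, inner_expoL2]

theorem coeff_term_le (P : Params) (u : L2Plane) (n : Jred) :
    (alpha n : ℝ) * ‖coeff P u n‖ ^ 2 ≤
      8 * (area P)⁻¹ ^ 2 * ‖inner ℂ (expoL2 P n) u‖ ^ 2 := by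
  have h : (alpha n : ℝ) ≤ 8 := by exact_mod_cast alpha_le n
  rw [coeff_eq_inner, norm_mul, mul_pow, norm_inv, Complex.norm_real, Real.norm_eq_abs,
    abs_of_pos (area_pos P), ← mul_assoc]
  gcongr

theorem memLp_coeff (P : Params) (u : L2Plane) : MemLp (coeff P u) 2 weight := by
  rw [memLp_weight_iff]
  exact Summable.of_nonneg_of_le (fun n => by positivity) (coeff_term_le P u)
    ((summable_inner_expoL2 P u).mul_left _)

theorem norm_toLp_coeff_le (P : Params) (u : L2Plane) :
    ‖(memLp_coeff P u).toLp‖ ≤ Real.sqrt (8 * (area P)⁻¹) * ‖u‖ := by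
  have hp := area_pos P
  refine le_of_sq_le_sq ?_ (by positivity)
  rw [mul_pow, Real.sq_sqrt (by positivity), Ell2.norm_sq]
  have h : ∀ n, ((memLp_coeff P u).toLp : Jred → ℂ) n = coeff P u n :=
    weight_ext (memLp_coeff P u).coeFn_toLp
  simp only [h]
  refine (Summable.tsum_le_tsum (coeff_term_le P u) ((memLp_weight_iff _).1 (memLp_coeff P u))
    ((summable_inner_expoL2 P u).mul_left _)).trans ?_
  rw [tsum_mul_left]
  calc _ ≤ 8 * (area P)⁻¹ ^ 2 * (area P * ‖u‖ ^ 2) := by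
        gcongr; exact tsum_inner_expoL2_le P u
    _ = 8 * (area P)⁻¹ * ‖u‖ ^ 2 := by field_simp

/-- The Fourier coefficients on `Ω₀` as a linear map on `L²(ℝ²)`. -/
def coeffLin (P : Params) : L2Plane →ₗ[ℂ] Ell2 where
  toFun u := (memLp_coeff P u).toLp
  map_add' u v := by
    rw [← MemLp.toLp_add]
    refine MemLp.toLp_congr _ _ (Filter.Eventually.of_forall fun n => ?_)
    rw [coeff_eq_inner, Pi.add_apply, coeff_eq_inner, coeff_eq_inner, inner_add_right, mul_add]
  map_smul' c u := by
    rw [RingHom.id_apply, ← MemLp.toLp_const_smul]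
    refine MemLp.toLp_congr _ _ (Filter.Eventually.of_forall fun n => ?_)
    rw [coeff_eq_inner, Pi.smul_apply, coeff_eq_inner, inner_smul_right, smul_eq_mul,
      mul_left_comm]

/-- The map `γ : L²_{D₄}(ℝ²) → ℓ²(J_red(D₄))` of Fourier coefficients on `Ω₀`. -/
def gam (P : Params) : L2D4 →L[ℂ] Ell2 :=
  (coeffLin P).mkContinuous (Real.sqrt (8 * (area P)⁻¹)) (norm_toLp_coeff_le P) ∘L L2D4.subtypeL

theorem gam_apply (P : Params) (u : L2D4) (n : Jred) : gam P u n = coeff P u n :=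
  weight_ext (memLp_coeff P u).coeFn_toLp n

/-- The function `𝟙_{Ω₀} ∑_{m ∈ orb(n)} e^{2π i m̃·x}` as an element of `L²(ℝ²)`. -/
def orbL2 (P : Params) (n : Jred) : L2Plane := ∑ m ∈ orb n, expoL2 P m

theorem mem_orb_rep {n : Jred} {m : ℤ × ℤ} (h : m ∈ orb n) :
    max |m.1| |m.2| = n.1.1 ∧ min |m.1| |m.2| = n.1.2 := by
  obtain ⟨⟨a, b⟩, h1, h2⟩ := n
  obtain ⟨c, e⟩ := m
  simp only [orb, Finset.mem_insert, Finset.mem_singleton, Prod.mk.injEq] at h h1 h2 ⊢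
  have ha : |a| = a := abs_of_nonneg (h1.trans h2)
  have hb : |b| = b := abs_of_nonneg h1
  rcases h with ⟨rfl, rfl⟩ | ⟨rfl, rfl⟩ | ⟨rfl, rfl⟩ | ⟨rfl, rfl⟩ | ⟨rfl, rfl⟩ | ⟨rfl, rfl⟩ |
    ⟨rfl, rfl⟩ | ⟨rfl, rfl⟩ <;> simp [abs_neg, ha, hb, h2]

theorem inner_orbL2 (P : Params) (m n : Jred) :
    inner ℂ (orbL2 P m) (orbL2 P n) = if m = n then (area P : ℂ) * alpha n else 0 := by
  simp only [orbL2, sum_inner, inner_sum, inner_expoL2_expoL2]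
  split_ifs with h
  · subst h
    simp [alpha, mul_comm]
  · refine Finset.sum_eq_zero fun a ha => Finset.sum_eq_zero fun b hb => if_neg ?_
    rintro rfl
    have h1 := mem_orb_rep hb
    have h2 := mem_orb_rep ha
    exact h (Subtype.ext (Prod.ext (h1.1.symm.trans h2.1) (h1.2.symm.trans h2.2)))

/-- The normalisation `√(|Ω₀| α_n)` of `orbL2`. -/
def orbScale (P : Params) (n : Jred) : ℝ := Real.sqrt (area P * alpha n)

theorem orbScale_pos (P : Params) (n : Jred) : 0 < orbScale P n :=
  Real.sqrt_pos.2 (mul_pos (area_pos P) (by exact_mod_cast alpha_pos n))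

theorem orbScale_sq (P : Params) (n : Jred) : orbScale P n ^ 2 = area P * alpha n :=
  Real.sq_sqrt (mul_pos (area_pos P) (by exact_mod_cast alpha_pos n)).le

theorem orthonormal_orbL2 (P : Params) :
    Orthonormal ℂ fun n : Jred => ((orbScale P n)⁻¹ : ℂ) • orbL2 P n := by
  rw [orthonormal_iff_ite]
  intro m n
  rw [inner_smul_left, inner_smul_right, inner_orbL2]
  split_ifs with h
  · subst h
    have h1 : ((orbScale P m : ℝ) : ℂ) ^ 2 = area P * alpha m := by
      exact_mod_cast orbScale_sq P m
    have h2 : ((orbScale P m : ℝ) : ℂ) ≠ 0 := by exact_mod_cast (orbScale_pos P m).ne'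
    rw [← h1]; simp; field_simp
  · simp

/-- The rescaled sequence `√(|Ω₀| α_n) u_n` as an element of the unweighted `ℓ²`. -/
def toUnweighted (P : Params) (U : Ell2) : lp (fun _ : Jred => ℂ) 2 :=
  ⟨fun n => orbScale P n * U n, by
    refine (memℓp_gen_iff (by norm_num)).2 ?_
    have := ((memLp_weight_iff U).1 (Lp.memLp U)).mul_left (area P)
    refine this.congr fun n => ?_
    have h := orbScale_sq P n
    simp only [ENNReal.toReal_ofNat, Real.rpow_ofNat, norm_mul, mul_pow, Complex.norm_real,
      Real.norm_eq_abs, sq_abs, h]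
    ring⟩

theorem norm_toUnweighted (P : Params) (U : Ell2) :
    ‖toUnweighted P U‖ ^ 2 = area P * ‖U‖ ^ 2 := by
  have := lp.norm_rpow_eq_tsum (p := 2) (by norm_num) (toUnweighted P U)
  simp only [ENNReal.toReal_ofNat, Real.rpow_ofNat] at this
  rw [this, Ell2.norm_sq, ← tsum_mul_left]
  refine tsum_congr fun n => ?_
  have h := orbScale_sq P n
  simp only [toUnweighted, norm_mul, mul_pow, Complex.norm_real, Real.norm_eq_abs, sq_abs, h]
  ring

theorem hasSum_orbL2 (P : Params) (U : Ell2) :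
    HasSum (fun n => U n • orbL2 P n)
      ((orthonormal_orbL2 P).orthogonalFamily.linearIsometry (toUnweighted P U)) := by
  refine ((orthonormal_orbL2 P).orthogonalFamily.hasSum_linearIsometry (toUnweighted P U)).congr_fun
    fun n => ?_
  have h2 : ((orbScale P n : ℝ) : ℂ) ≠ 0 := by exact_mod_cast (orbScale_pos P n).ne'
  simp only [LinearIsometry.toSpanSingleton_apply, toUnweighted, smul_smul]
  congr 1
  field_simp

/-- The action of the generators of `D₄` on `ℤ²`. -/
def idxGen : Fin 3 → (ℤ × ℤ) → (ℤ × ℤ) :=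
  ![fun m => (-m.1, m.2), fun m => (m.1, -m.2), fun m => (m.2, m.1)]

theorem idxGen_invol (i : Fin 3) (m : ℤ × ℤ) : idxGen i (idxGen i m) = m := by
  fin_cases i <;> simp [idxGen]

theorem idxGen_mem_orb (i : Fin 3) (n m : ℤ × ℤ) (h : m ∈ orb n) : idxGen i m ∈ orb n := by
  obtain ⟨a, b⟩ := n
  obtain ⟨c, e⟩ := m
  simp only [orb, Finset.mem_insert, Finset.mem_singleton, Prod.mk.injEq] at h ⊢
  fin_cases i <;> simp [idxGen] <;> grind

theorem expo_d4Gen (P : Params) (i : Fin 3) (n : ℤ × ℤ) (x : Plane) :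
    expo P n (d4Gen i x) = expo P (idxGen i n) x := by
  unfold expo
  congr 3
  rw [inner_freq, inner_freq]
  fin_cases i
  · simp [d4Gen_zero, idxGen]
  · simp [d4Gen_one, idxGen]
  · simp [d4Gen_two, idxGen]; ring

theorem compGen_expoL2 (P : Params) (i : Fin 3) (n : ℤ × ℤ) :
    compGen i (expoL2 P n) = expoL2 P (idxGen i n) := by
  refine Lp.ext ?_
  filter_upwards [compGen_coe i (expoL2 P n), (memLp_expo P (idxGen i n) 2).coeFn_toLp,
    (d4Gen_mp i).quasiMeasurePreserving.ae (memLp_expo P n 2).coeFn_toLp] with x h1 h2 h3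
  rw [h1, expoL2, h3, expoL2, h2]
  by_cases hx : x ∈ Omega P
  · simp [hx, d4Gen_mem_Omega, expo_d4Gen]
  · simp [hx, d4Gen_mem_Omega]

theorem orbL2_mem (P : Params) (n : Jred) : orbL2 P n ∈ L2D4 := by
  rw [mem_L2D4_iff]
  intro i
  simp only [orbL2, map_sum, compGen_expoL2]
  exact Finset.sum_nbij' (idxGen i) (idxGen i) (fun m => idxGen_mem_orb i n m)
    (fun m => idxGen_mem_orb i n m) (fun m _ => idxGen_invol i m) (fun m _ => idxGen_invol i m)
    fun _ _ => rfl

/-- The map `γ† : ℓ²(J_red(D₄)) → L²_{D₄}(ℝ²)`, given by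
`γ†(U) = 𝟙_{Ω₀} ∑_{n ∈ J_red(D₄)} u_n ∑_{m ∈ orb(n)} e^{2π i m̃·x}`, with convergence in `L²`. -/
def gamDag (P : Params) : Ell2 →L[ℂ] L2D4 :=
  LinearMap.mkContinuous
    { toFun := fun U => ⟨∑' n, U n • orbL2 P n, by
        rw [(hasSum_orbL2 P U).tsum_eq]
        exact isClosed_L2D4.mem_of_tendsto (hasSum_orbL2 P U) (Filter.Eventually.of_forall fun s =>
          Submodule.sum_mem _ fun n _ => L2D4.smul_mem _ (orbL2_mem P n))⟩
      map_add' := fun U V => by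
        refine Subtype.ext ?_
        simp only [Submodule.coe_add]
        rw [← (hasSum_orbL2 P U).summable.tsum_add (hasSum_orbL2 P V).summable]
        refine tsum_congr fun n => ?_
        rw [weight_ext (Lp.coeFn_add U V) n, Pi.add_apply, add_smul]
      map_smul' := fun c U => by
        refine Subtype.ext ?_
        simp only [RingHom.id_apply, Submodule.coe_smul]
        rw [← (hasSum_orbL2 P U).summable.tsum_const_smul]
        refine tsum_congr fun n => ?_
        rw [weight_ext (Lp.coeFn_smul c U) n, Pi.smul_apply, smul_assoc] }
    (Real.sqrt (area P)) fun U => by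
      have hp := area_pos P
      simp only [LinearMap.coe_mk, AddHom.coe_mk, Submodule.coe_norm, (hasSum_orbL2 P U).tsum_eq]
      refine le_of_sq_le_sq ?_ (by positivity)
      rw [mul_pow, Real.sq_sqrt hp.le, LinearIsometry.norm_map, norm_toUnweighted]

theorem gamDag_coe (P : Params) (U : Ell2) :
    (gamDag P U : L2Plane) = ∑' n, U n • orbL2 P n := rfl

/-! ### The symbol `l` and the operators with symbols built from it -/

/-- `l₁₁(ξ) = -λ₁ |2πξ|² - 1`. -/
def l11 (P : Params) (ξ : Plane) : ℝ := -P.lam1 * ‖(2 * Real.pi) • ξ‖ ^ 2 - 1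

/-- `l₂₁(ξ) = λ₂ λ₁ - 1`. -/
def l21 (P : Params) (_ξ : Plane) : ℝ := P.lam2 * P.lam1 - 1

/-- `l₂₂(ξ) = -|2πξ|² - λ₂`. -/
def l22 (P : Params) (ξ : Plane) : ℝ := -‖(2 * Real.pi) • ξ‖ ^ 2 - P.lam2

/-- `1 / l₁₁`. -/
def symb11 (P : Params) (ξ : Plane) : ℂ := 1 / (l11 P ξ : ℂ)

/-- `1 / l₂₂`. -/
def symb22 (P : Params) (ξ : Plane) : ℂ := 1 / (l22 P ξ : ℂ)

/-- `l₂₁ / (l₁₁ l₂₂)`. -/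
def symb3 (P : Params) (ξ : Plane) : ℂ := (l21 P ξ : ℂ) / ((l11 P ξ : ℂ) * (l22 P ξ : ℂ))

theorem l11_le (P : Params) (ξ : Plane) : l11 P ξ ≤ -1 := by
  have := P.lam1_pos
  have : 0 ≤ P.lam1 * ‖(2 * Real.pi) • ξ‖ ^ 2 := by positivity
  unfold l11; linarith

theorem l22_le (P : Params) (ξ : Plane) : l22 P ξ ≤ -P.lam2 := by
  have : 0 ≤ ‖(2 * Real.pi) • ξ‖ ^ 2 := by positivity
  unfold l22; linarith

theorem l11_ne (P : Params) (ξ : Plane) : (l11 P ξ : ℂ) ≠ 0 := by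
  have := l11_le P ξ
  exact_mod_cast (by linarith : l11 P ξ < 0).ne

theorem l22_ne (P : Params) (ξ : Plane) : (l22 P ξ : ℂ) ≠ 0 := by
  have := l22_le P ξ
  have := P.lam2_pos
  exact_mod_cast (by linarith : l22 P ξ < 0).ne

theorem norm_symb11_le (P : Params) (ξ : Plane) : ‖symb11 P ξ‖ ≤ 1 := by
  have := l11_le P ξ
  rw [symb11, norm_div, norm_one, Complex.norm_real, Real.norm_eq_abs, abs_of_neg (by linarith)]
  exact div_le_one_of_le₀ (by linarith) (by linarith)

theorem norm_symb22_le (P : Params) (ξ : Plane) : ‖symb22 P ξ‖ ≤ 1 / P.lam2 := by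
  have := l22_le P ξ
  have := P.lam2_pos
  rw [symb22, norm_div, norm_one, Complex.norm_real, Real.norm_eq_abs, abs_of_neg (by linarith)]
  exact one_div_le_one_div_of_le P.lam2_pos (by linarith)

theorem norm_symb3_le (P : Params) (ξ : Plane) :
    ‖symb3 P ξ‖ ≤ |P.lam2 * P.lam1 - 1| * (1 / P.lam2) := by
  have h : symb3 P ξ = (l21 P ξ : ℂ) * (symb11 P ξ * symb22 P ξ) := by
    rw [symb3, symb11, symb22]; ring
  rw [h, norm_mul, norm_mul, Complex.norm_real, Real.norm_eq_abs, l21]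
  refine mul_le_mul_of_nonneg_left ?_ (abs_nonneg _)
  calc _ ≤ 1 * (1 / P.lam2) := mul_le_mul (norm_symb11_le P ξ) (norm_symb22_le P ξ)
        (norm_nonneg _) zero_le_one
    _ = _ := one_mul _

theorem continuous_l11 (P : Params) : Continuous (l11 P) := by unfold l11; fun_prop
theorem continuous_l21 (P : Params) : Continuous (l21 P) := by unfold l21; fun_prop
theorem continuous_l22 (P : Params) : Continuous (l22 P) := by unfold l22; fun_prop

theorem continuous_symb11 (P : Params) : Continuous (symb11 P) :=
  continuous_const.div (Complex.continuous_ofReal.comp (continuous_l11 P)) (l11_ne P)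

theorem continuous_symb22 (P : Params) : Continuous (symb22 P) :=
  continuous_const.div (Complex.continuous_ofReal.comp (continuous_l22 P)) (l22_ne P)

theorem continuous_symb3 (P : Params) : Continuous (symb3 P) :=
  (Complex.continuous_ofReal.comp (continuous_l21 P)).div
    ((Complex.continuous_ofReal.comp (continuous_l11 P)).mul
      (Complex.continuous_ofReal.comp (continuous_l22 P)))
    fun ξ => mul_ne_zero (l11_ne P ξ) (l22_ne P ξ)

theorem l_d4Gen (P : Params) (i : Fin 3) (ξ : Plane) :
    l11 P (d4Gen i ξ) = l11 P ξ ∧ l21 P (d4Gen i ξ) = l21 P ξ ∧ l22 P (d4Gen i ξ) = l22 P ξ := by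
  simp [l11, l21, l22, norm_smul]

/-- `𝕃₁₁⁻¹` on `L²_{D₄}(ℝ²)`. -/
def L11inv (P : Params) : L2D4 →L[ℂ] L2D4 :=
  fourierMultD4 (symb11 P)
    (memLp_top_of_bound (continuous_symb11 P).aestronglyMeasurable 1
      (Filter.Eventually.of_forall (norm_symb11_le P)))
    fun i => Filter.Eventually.of_forall fun ξ => by simp [symb11, l_d4Gen]

/-- `𝕃₂₂⁻¹` on `L²_{D₄}(ℝ²)`. -/
def L22inv (P : Params) : L2D4 →L[ℂ] L2D4 :=
  fourierMultD4 (symb22 P)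
    (memLp_top_of_bound (continuous_symb22 P).aestronglyMeasurable _
      (Filter.Eventually.of_forall (norm_symb22_le P)))
    fun i => Filter.Eventually.of_forall fun ξ => by simp [symb22, l_d4Gen]

/-- `𝕃₂₁`, the multiplication by the number `λ₂ λ₁ - 1`. -/
def L21 (P : Params) : L2D4 →L[ℂ] L2D4 := ((P.lam2 * P.lam1 - 1 : ℝ) : ℂ) • 1

/-- `𝕃₂₂⁻¹ 𝕃₂₁ 𝕃₁₁⁻¹` on `L²_{D₄}(ℝ²)`. -/
def L3 (P : Params) : L2D4 →L[ℂ] L2D4 := L22inv P ∘L L21 P ∘L L11inv P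

/-- `L²_{D₄}`: pairs of `D₄`-symmetric functions. -/
abbrev L2Pair := WithLp 2 (L2D4 × L2D4)

/-- `ℓ²_{D₄}`: pairs of sequences in `ℓ²(J_red(D₄))`. -/
abbrev Ell2Pair := WithLp 2 (Ell2 × Ell2)

/-- `𝕃⁻¹` as an operator on `L²_{D₄}`. -/
def LinvL2 (P : Params) : L2Pair →L[ℂ] L2Pair := blockOp (L11inv P) 0 (-L3 P) (L22inv P)

/-- `L₁₁⁻¹` on `ℓ²(J_red(D₄))`. -/
def seqL11inv (P : Params) : Ell2 →L[ℂ] Ell2 :=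
  diagSeq (fun n => symb11 P (freq P n)) ⟨_, fun _ => norm_symb11_le P _⟩

/-- `L₂₂⁻¹` on `ℓ²(J_red(D₄))`. -/
def seqL22inv (P : Params) : Ell2 →L[ℂ] Ell2 :=
  diagSeq (fun n => symb22 P (freq P n)) ⟨_, fun _ => norm_symb22_le P _⟩

/-- `L₂₁` on `ℓ²(J_red(D₄))`. -/
def seqL21 (P : Params) : Ell2 →L[ℂ] Ell2 :=
  diagSeq (fun n => l21 P (freq P n)) ⟨‖((P.lam2 * P.lam1 - 1 : ℝ) : ℂ)‖, fun _ => le_rfl⟩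

/-- `L₂₂⁻¹ L₂₁ L₁₁⁻¹` on `ℓ²(J_red(D₄))`. -/
def seqL3 (P : Params) : Ell2 →L[ℂ] Ell2 := seqL22inv P ∘L seqL21 P ∘L seqL11inv P

/-- `L⁻¹` on `ℓ²_{D₄}`. -/
def seqLinv (P : Params) : Ell2Pair →L[ℂ] Ell2Pair :=
  blockOp (seqL11inv P) 0 (-seqL3 P) (seqL22inv P)

/-! ### The Hilbert space `ℋ_{D₄}` and the isometric isomorphism `𝕃` -/

/-- The first component of `l û`. -/
def lhat1 (P : Params) (u : L2Pair) (ξ : Plane) : ℂ :=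
  l11 P ξ * (𝓕 (u.fst : L2Plane) : L2Plane) ξ

/-- The second component of `l û`. -/
def lhat2 (P : Params) (u : L2Pair) (ξ : Plane) : ℂ :=
  l21 P ξ * (𝓕 (u.fst : L2Plane) : L2Plane) ξ + l22 P ξ * (𝓕 (u.snd : L2Plane) : L2Plane) ξ

theorem fourier_add_coe (u v : L2Plane) :
    ((𝓕 (u + v) : L2Plane) : Plane → ℂ) =ᵐ[volume]
      fun ξ => (𝓕 u : L2Plane) ξ + (𝓕 v : L2Plane) ξ := by
  have : (𝓕 (u + v) : L2Plane) = 𝓕 u + 𝓕 v := map_add (Lp.fourierTransformₗᵢ Plane ℂ) u v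
  rw [this]
  exact Lp.coeFn_add _ _

theorem fourier_smul_coe (c : ℂ) (u : L2Plane) :
    ((𝓕 (c • u) : L2Plane) : Plane → ℂ) =ᵐ[volume] fun ξ => c * (𝓕 u : L2Plane) ξ := by
  have : (𝓕 (c • u) : L2Plane) = c • 𝓕 u := map_smul (Lp.fourierTransformₗᵢ Plane ℂ) c u
  rw [this]
  exact Lp.coeFn_smul _ _

theorem lhat1_add (P : Params) (u v : L2Pair) :
    lhat1 P (u + v) =ᵐ[volume] lhat1 P u + lhat1 P v := by
  filter_upwards [fourier_add_coe (u.fst : L2Plane) v.fst] with ξ h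
  simp only [lhat1, WithLp.add_fst, Submodule.coe_add, Pi.add_apply, h]; ring

theorem lhat2_add (P : Params) (u v : L2Pair) :
    lhat2 P (u + v) =ᵐ[volume] lhat2 P u + lhat2 P v := by
  filter_upwards [fourier_add_coe (u.fst : L2Plane) v.fst,
    fourier_add_coe (u.snd : L2Plane) v.snd] with ξ h h'
  simp only [lhat2, WithLp.add_fst, WithLp.add_snd, Submodule.coe_add, Pi.add_apply, h, h']; ring

theorem lhat1_smul (P : Params) (c : ℂ) (u : L2Pair) :
    lhat1 P (c • u) =ᵐ[volume] c • lhat1 P u := by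
  filter_upwards [fourier_smul_coe c (u.fst : L2Plane)] with ξ h
  simp only [lhat1, WithLp.smul_fst, Submodule.coe_smul, Pi.smul_apply, h, smul_eq_mul]; ring

theorem lhat2_smul (P : Params) (c : ℂ) (u : L2Pair) :
    lhat2 P (c • u) =ᵐ[volume] c • lhat2 P u := by
  filter_upwards [fourier_smul_coe c (u.fst : L2Plane),
    fourier_smul_coe c (u.snd : L2Plane)] with ξ h h'
  simp only [lhat2, WithLp.smul_fst, WithLp.smul_snd, Submodule.coe_smul, Pi.smul_apply, h, h',
    smul_eq_mul]
  ring

/-- The pairs `u ∈ L²_{D₄}` with `l û ∈ L²`, that is with `𝕃u ∈ L²`. -/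
def HD4 (P : Params) : Submodule ℂ L2Pair where
  carrier := {u | MemLp (lhat1 P u) 2 volume ∧ MemLp (lhat2 P u) 2 volume}
  add_mem' {u v} hu hv := ⟨(memLp_congr_ae (lhat1_add P u v)).2 (hu.1.add hv.1),
    (memLp_congr_ae (lhat2_add P u v)).2 (hu.2.add hv.2)⟩
  zero_mem' := by
    have h1 := lhat1_smul P 0 0
    have h2 := lhat2_smul P 0 0
    rw [zero_smul, zero_smul] at h1 h2
    exact ⟨(memLp_congr_ae h1).2 MemLp.zero', (memLp_congr_ae h2).2 MemLp.zero'⟩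
  smul_mem' c u hu := ⟨(memLp_congr_ae (lhat1_smul P c u)).2 (hu.1.const_smul c),
    (memLp_congr_ae (lhat2_smul P c u)).2 (hu.2.const_smul c)⟩

theorem lhat_d4 (P : Params) (u : L2Pair) (i : Fin 3) :
    ((fun ξ => lhat1 P u (d4Gen i ξ)) =ᵐ[volume] lhat1 P u) ∧
    ((fun ξ => lhat2 P u (d4Gen i ξ)) =ᵐ[volume] lhat2 P u) := by
  have h1 := fourier_mem_L2D4 u.fst.2 i
  have h2 := fourier_mem_L2D4 u.snd.2 i
  constructor
  · filter_upwards [h1] with ξ h1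
    simp only [lhat1, l_d4Gen, h1]
  · filter_upwards [h1, h2] with ξ h1 h2
    simp only [lhat2, l_d4Gen, h1, h2]

theorem toLp_mem_L2D4 {f : Plane → ℂ} (hf : MemLp f 2 volume)
    (hs : ∀ i, (fun x => f (d4Gen i x)) =ᵐ[volume] f) : hf.toLp f ∈ L2D4 := fun i => by
  filter_upwards [hs i, hf.coeFn_toLp,
    (d4Gen_mp i).quasiMeasurePreserving.ae hf.coeFn_toLp] with x h1 h2 h3
  rw [h3, h1, h2]

/-- The inverse Fourier transform of a `D₄`-symmetric square-integrable function. -/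
def fourierInvD4 (f : Plane → ℂ) (hf : MemLp f 2 volume)
    (hs : ∀ i, (fun x => f (d4Gen i x)) =ᵐ[volume] f) : L2D4 :=
  ⟨𝓕⁻ (hf.toLp f), fourierInv_mem_L2D4 (toLp_mem_L2D4 hf hs)⟩

theorem fourierInvD4_eq_iff {f : Plane → ℂ} {hf : MemLp f 2 volume}
    {hs : ∀ i, (fun x => f (d4Gen i x)) =ᵐ[volume] f} {u : L2D4} :
    fourierInvD4 f hf hs = u ↔ f =ᵐ[volume] (𝓕 (u : L2Plane) : L2Plane) := by
  have e : 𝓕⁻ (hf.toLp f) = (u : L2Plane) ↔ hf.toLp f = 𝓕 (u : L2Plane) := by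
    constructor
    · intro h; rw [← h]; exact (fourier_fourierInv_eq _).symm
    · intro h; rw [h]; exact fourierInv_fourier_eq _
  rw [fourierInvD4, Subtype.ext_iff, e]
  constructor
  · intro h; rw [← h]; exact hf.coeFn_toLp.symm
  · intro h; exact Lp.ext (hf.coeFn_toLp.trans h)

/-- The linear map `𝕃`, given by `𝕃u = 𝓕⁻¹(l û)`. -/
def Llin (P : Params) : HD4 P →ₗ[ℂ] L2Pair where
  toFun u := WithLp.toLp 2
    (fourierInvD4 (lhat1 P u) u.2.1 fun i => (lhat_d4 P u i).1,
     fourierInvD4 (lhat2 P u) u.2.2 fun i => (lhat_d4 P u i).2)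
  map_add' u v := by
    have key : ∀ (f g h : Plane → ℂ) (hf hg hh hsf hsg hsh), h =ᵐ[volume] f + g →
        fourierInvD4 h hh hsh = fourierInvD4 f hf hsf + fourierInvD4 g hg hsg := by
      intro f g h hf hg hh hsf hsg hsh e
      refine fourierInvD4_eq_iff.2 (e.trans ?_)
      filter_upwards [fourier_add_coe (fourierInvD4 f hf hsf : L2Plane) (fourierInvD4 g hg hsg),
        fourierInvD4_eq_iff.1 (rfl : fourierInvD4 f hf hsf = _),
        fourierInvD4_eq_iff.1 (rfl : fourierInvD4 g hg hsg = _)] with ξ h1 h2 h3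
      rw [Submodule.coe_add, h1, Pi.add_apply, h2, h3]
    refine WithLp.ofLp_injective 2 (Prod.ext ?_ ?_)
    · exact key _ _ _ _ _ _ (fun i => (lhat_d4 P u i).1) (fun i => (lhat_d4 P v i).1)
        (fun i => (lhat_d4 P _ i).1) (lhat1_add P u v)
    · exact key _ _ _ _ _ _ (fun i => (lhat_d4 P u i).2) (fun i => (lhat_d4 P v i).2)
        (fun i => (lhat_d4 P _ i).2) (lhat2_add P u v)
  map_smul' c u := by
    have key : ∀ (f h : Plane → ℂ) (hf hh hsf hsh), h =ᵐ[volume] c • f →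
        fourierInvD4 h hh hsh = c • fourierInvD4 f hf hsf := by
      intro f h hf hh hsf hsh e
      refine fourierInvD4_eq_iff.2 (e.trans ?_)
      filter_upwards [fourier_smul_coe c (fourierInvD4 f hf hsf : L2Plane),
        fourierInvD4_eq_iff.1 (rfl : fourierInvD4 f hf hsf = _)] with ξ h1 h2
      rw [Submodule.coe_smul, h1, Pi.smul_apply, h2, smul_eq_mul]
    refine WithLp.ofLp_injective 2 (Prod.ext ?_ ?_)
    · exact key _ _ _ _ (fun i => (lhat_d4 P u i).1) (fun i => (lhat_d4 P _ i).1)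
        (lhat1_smul P c u)
    · exact key _ _ _ _ (fun i => (lhat_d4 P u i).2) (fun i => (lhat_d4 P _ i).2)
        (lhat2_smul P c u)

theorem Llin_eq_iff (P : Params) (u : HD4 P) (f : L2Pair) : Llin P u = f ↔
    lhat1 P u =ᵐ[volume] (𝓕 (f.fst : L2Plane) : L2Plane) ∧
    lhat2 P u =ᵐ[volume] (𝓕 (f.snd : L2Plane) : L2Plane) := by
  rw [← fourierInvD4_eq_iff (hf := u.2.1) (hs := fun i => (lhat_d4 P u i).1),
    ← fourierInvD4_eq_iff (hf := u.2.2) (hs := fun i => (lhat_d4 P u i).2)]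
  constructor
  · rintro rfl; exact ⟨rfl, rfl⟩
  · rintro ⟨h1, h2⟩; exact WithLp.ofLp_injective 2 (Prod.ext h1 h2)

theorem fourier_fourierMultD4 (m : Plane → ℂ) (hm : MemLp m ∞ volume)
    (hs : ∀ i, (fun x => m (d4Gen i x)) =ᵐ[volume] m) (u : L2D4) :
    ((𝓕 (fourierMultD4 m hm hs u : L2Plane) : L2Plane) : Plane → ℂ) =ᵐ[volume]
      fun ξ => m ξ * (𝓕 (u : L2Plane) : L2Plane) ξ := by
  have : (𝓕 (fourierMultD4 m hm hs u : L2Plane) : L2Plane) = mulOp m hm (𝓕 (u : L2Plane)) :=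
    (Lp.fourierTransformₗᵢ Plane ℂ).apply_symm_apply _
  rw [this]
  exact mulOp_coe m hm _

theorem fourier_L11inv (P : Params) (u : L2D4) :
    ((𝓕 (L11inv P u : L2Plane) : L2Plane) : Plane → ℂ) =ᵐ[volume]
      fun ξ => symb11 P ξ * (𝓕 (u : L2Plane) : L2Plane) ξ :=
  fourier_fourierMultD4 (symb11 P) _ _ u

theorem fourier_L22inv (P : Params) (u : L2D4) :
    ((𝓕 (L22inv P u : L2Plane) : L2Plane) : Plane → ℂ) =ᵐ[volume]
      fun ξ => symb22 P ξ * (𝓕 (u : L2Plane) : L2Plane) ξ :=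
  fourier_fourierMultD4 (symb22 P) _ _ u

theorem fourier_comb_coe (c : ℂ) (u v : L2D4) :
    ((𝓕 ((c • u + v : L2D4) : L2Plane) : L2Plane) : Plane → ℂ) =ᵐ[volume]
      fun ξ => c * (𝓕 (u : L2Plane) : L2Plane) ξ + (𝓕 (v : L2Plane) : L2Plane) ξ := by
  have e : ((c • u + v : L2D4) : L2Plane) = c • (u : L2Plane) + (v : L2Plane) := rfl
  rw [e]
  filter_upwards [fourier_add_coe (c • (u : L2Plane)) v, fourier_smul_coe c (u : L2Plane)]
    with ξ h1 h2
  exact h1.trans (congrArg (fun z => z + (𝓕 (v : L2Plane) : L2Plane) ξ) h2)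

theorem LinvL2_snd (P : Params) (f : L2Pair) : (LinvL2 P f).snd =
    (-((P.lam2 * P.lam1 - 1 : ℝ) : ℂ)) • L22inv P (L11inv P f.fst) + L22inv P f.snd := by
  rw [LinvL2, blockOp_snd]
  simp only [L3, L21, neg_apply, ContinuousLinearMap.comp_apply,
    smul_apply, one_apply_eq_self, map_smul, neg_smul]

theorem lhat_LinvL2 (P : Params) (f : L2Pair) :
    lhat1 P (LinvL2 P f) =ᵐ[volume] (𝓕 (f.fst : L2Plane) : L2Plane) ∧
    lhat2 P (LinvL2 P f) =ᵐ[volume] (𝓕 (f.snd : L2Plane) : L2Plane) := by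
  have e1 : (LinvL2 P f).fst = L11inv P f.fst := by simp [LinvL2, blockOp_fst]
  have h1 := fourier_L11inv P f.fst
  have h2 := fourier_L22inv P f.snd
  have h3 := fourier_L22inv P (L11inv P f.fst)
  have h4 := fourier_comb_coe (-((P.lam2 * P.lam1 - 1 : ℝ) : ℂ)) (L22inv P (L11inv P f.fst))
    (L22inv P f.snd)
  rw [← LinvL2_snd] at h4
  rw [← e1] at h1 h3 h4
  constructor
  · filter_upwards [h1] with ξ h1
    rw [lhat1, h1, symb11]
    have := l11_ne P ξ
    field_simp
  · filter_upwards [h1, h2, h3, h4] with ξ h1 h2 h3 h4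
    have n1 := l11_ne P ξ
    have n2 := l22_ne P ξ
    rw [lhat2, h4, h2, h3, h1, symb11, symb22, l21]
    field_simp
    ring

theorem mem_HD4_iff (P : Params) (u : L2Pair) :
    u ∈ HD4 P ↔ MemLp (lhat1 P u) 2 volume ∧ MemLp (lhat2 P u) 2 volume := Iff.rfl

theorem LinvL2_mem (P : Params) (f : L2Pair) : LinvL2 P f ∈ HD4 P := by
  have key : ∀ (g : Plane → ℂ) (w : L2Plane), g =ᵐ[volume] (w : Plane → ℂ) → MemLp g 2 volume :=
    fun g w h => (memLp_congr_ae h).2 (Lp.memLp w)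
  rw [mem_HD4_iff]
  constructor
  · exact key _ _ (lhat_LinvL2 P f).1
  · exact key _ _ (lhat_LinvL2 P f).2

theorem Llin_injective (P : Params) : Function.Injective (Llin P) := by
  refine (injective_iff_map_eq_zero _).2 fun u hu => ?_
  obtain ⟨h1, h2⟩ := (Llin_eq_iff P u 0).1 hu
  have z : (𝓕 (0 : L2Plane) : L2Plane) = 0 := map_zero (Lp.fourierTransformₗᵢ Plane ℂ)
  have key : ∀ w : L2D4, (((𝓕 (w : L2Plane) : L2Plane) : Plane → ℂ) =ᵐ[volume] 0) → w = 0 := by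
    intro w hw
    refine Subtype.ext ((Lp.fourierTransformₗᵢ Plane ℂ).injective ?_)
    exact (Lp.eq_zero_iff_ae_eq_zero.2 hw).trans z.symm
  have hz : ((𝓕 ((0 : L2D4) : L2Plane) : L2Plane) : Plane → ℂ) =ᵐ[volume] 0 := by
    rw [Submodule.coe_zero, z]; exact Lp.coeFn_zero _ _ _
  have f1 : (((𝓕 ((u : L2Pair).fst : L2Plane) : L2Plane) : Plane → ℂ) =ᵐ[volume] 0) := by
    filter_upwards [h1, hz] with ξ h hz
    have h' := h.trans hz
    simpa [lhat1, l11_ne P ξ] using h'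
  have f2 : (((𝓕 ((u : L2Pair).snd : L2Plane) : L2Plane) : Plane → ℂ) =ᵐ[volume] 0) := by
    filter_upwards [h2, hz, f1] with ξ h hz h1
    have h' := h.trans hz
    simpa [lhat2, l22_ne P ξ, h1] using h'
  exact Subtype.ext (WithLp.ofLp_injective 2 (Prod.ext (key _ f1) (key _ f2)))

/-- The Hilbert space `ℋ_{D₄}`: the space `HD4 P` with the norm `‖u‖_ℋ = ‖𝕃u‖₂`. -/
def HSpace (P : Params) : Type := HD4 P

instance (P : Params) : AddCommGroup (HSpace P) := inferInstanceAs (AddCommGroup (HD4 P))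

instance (P : Params) : Module ℂ (HSpace P) := inferInstanceAs (Module ℂ (HD4 P))

/-- `𝕃 : ℋ_{D₄} → L²_{D₄}` as a linear map. -/
def LlinH (P : Params) : HSpace P →ₗ[ℂ] L2Pair := Llin P

instance (P : Params) : NormedAddCommGroup (HSpace P) :=
  NormedAddCommGroup.induced (HSpace P) L2Pair (LlinH P) (Llin_injective P)

instance (P : Params) : NormedSpace ℂ (HSpace P) :=
  NormedSpace.induced ℂ (HSpace P) L2Pair (LlinH P)

/-- The inclusion of `ℋ_{D₄}` in `L²_{D₄}`. -/
def HSpace.incl (P : Params) : HSpace P →ₗ[ℂ] L2Pair := (HD4 P).subtype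

/-- A pair in `HD4 P` as an element of `ℋ_{D₄}`. -/
def HSpace.mk (P : Params) (u : L2Pair) (hu : u ∈ HD4 P) : HSpace P := (⟨u, hu⟩ : HD4 P)

theorem HSpace.incl_mk (P : Params) (u : L2Pair) (hu : u ∈ HD4 P) :
    HSpace.incl P (HSpace.mk P u hu) = u := rfl

theorem HSpace.incl_mem (P : Params) (u : HSpace P) : HSpace.incl P u ∈ HD4 P :=
  Subtype.property (p := fun v => v ∈ HD4 P) u

theorem LlinH_mk (P : Params) (f : L2Pair) :
    LlinH P (HSpace.mk P (LinvL2 P f) (LinvL2_mem P f)) = f :=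
  (Llin_eq_iff P ⟨LinvL2 P f, LinvL2_mem P f⟩ f).2 (lhat_LinvL2 P f)

/-- The isometric isomorphism `𝕃 : ℋ_{D₄} → L²_{D₄}`. -/
def Liso (P : Params) : HSpace P ≃ₗᵢ[ℂ] L2Pair where
  toLinearEquiv := LinearEquiv.ofBijective (LlinH P) ⟨Llin_injective P, fun f =>
    ⟨HSpace.mk P (LinvL2 P f) (LinvL2_mem P f), LlinH_mk P f⟩⟩
  norm_map' _ := rfl

theorem Liso_apply (P : Params) (u : HSpace P) : Liso P u = LlinH P u := rfl

theorem incl_Liso_symm (P : Params) (f : L2Pair) :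
    HSpace.incl P ((Liso P).symm f) = LinvL2 P f := by
  have : (Liso P).symm f = HSpace.mk P (LinvL2 P f) (LinvL2_mem P f) := by
    refine (Liso P).injective ?_
    rw [LinearIsometryEquiv.apply_symm_apply, Liso_apply, LlinH_mk]
  rw [this, HSpace.incl_mk]


/-! ### Bounded functions and the nonlinearity -/

theorem integral_fourierInv_mul (f g : Plane → ℂ) (hf : Integrable f) (hg : Integrable g) :
    ∫ x, 𝓕⁻ f x • g x = ∫ x, f x • 𝓕⁻ g x := by
  have h := VectorFourier.integral_fourierIntegral_smul_eq_flip (μ := volume) (ν := volume)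
    (L := -innerₗ Plane) (f := f) (g := g) Real.continuous_fourierChar
    (by exact continuous_inner.neg) hf hg
  have e : (-innerₗ Plane).flip = -innerₗ Plane := by
    ext x y; simp [real_inner_comm]
  rw [e] at h
  exact h

theorem memLp_top_of_fourier (w : L2Plane) (h : Integrable (𝓕 w : L2Plane) volume) :
    MemLp w ∞ volume := by
  set F : L2Plane := 𝓕 w with hF
  have hw : 𝓕⁻ F = w := fourierInv_fourier_eq w
  set g : Plane → ℂ := 𝓕⁻ (F : Plane → ℂ) with hg
  have hgc : Continuous g := VectorFourier.fourierIntegral_continuous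
    Real.continuous_fourierChar (by exact continuous_inner.neg) h
  have hgb : ∀ x, ‖g x‖ ≤ ∫ ξ, ‖F ξ‖ := fun x =>
    VectorFourier.norm_fourierIntegral_le_integral_norm _ _ _ _ x
  have key : (w : Plane → ℂ) =ᵐ[volume] g := by
    refine ae_eq_of_integral_contDiff_smul_eq ((Lp.memLp w).locallyIntegrable (by norm_num))
      hgc.locallyIntegrable fun φ hφ hc => ?_
    have hg₁ : HasCompactSupport (Complex.ofRealCLM ∘ φ) := hc.comp_left rfl
    have hg₂ : ContDiff ℝ (⊤ : ℕ∞) (Complex.ofRealCLM ∘ φ) := by fun_prop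
    set ψ := hg₁.toSchwartzMap hg₂ with hψ
    have e1 := congrArg (fun T => T ψ) (Lp.fourierInv_toTemperedDistribution_eq F)
    simp only [TemperedDistribution.fourierInv_apply, Lp.toTemperedDistribution_apply, hw] at e1
    have e2 := integral_fourierInv_mul (ψ : Plane → ℂ) F ψ.integrable h
    rw [SchwartzMap.fourierInv_coe] at e1
    have e3 := e1.symm.trans e2
    simpa [hψ, hg] using e3
  exact (memLp_congr_ae key).2 (memLp_top_of_bound hgc.aestronglyMeasurable _
    (Filter.Eventually.of_forall hgb))

theorem memLp_symb (c : ℝ) (hc : 0 < c) :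
    MemLp (fun ξ : Plane => (((c * (1 + ‖ξ‖ ^ 2) : ℝ) : ℂ))⁻¹) 2 volume := by
  have hcont : Continuous (fun ξ : Plane => (((c * (1 + ‖ξ‖ ^ 2) : ℝ) : ℂ))⁻¹) := by
    refine Continuous.inv₀ (by fun_prop) fun ξ => ?_
    have : 0 < c * (1 + ‖ξ‖ ^ 2) := by positivity
    exact_mod_cast this.ne'
  rw [memLp_two_iff_integrable_sq_norm hcont.aestronglyMeasurable]
  have h := integrable_rpow_neg_one_add_norm_sq (E := Plane) (μ := volume) (r := 4)
    (by simp; norm_num)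
  refine (h.const_mul (c⁻¹ ^ 2)).congr (Filter.Eventually.of_forall fun ξ => ?_)
  have hp : 0 < 1 + ‖ξ‖ ^ 2 := by positivity
  simp only
  rw [norm_inv, Complex.norm_real, Real.norm_eq_abs, abs_of_pos (by positivity), mul_inv, mul_pow,
    show (-4 / 2 : ℝ) = -(2 : ℕ) by norm_num, Real.rpow_neg hp.le, Real.rpow_natCast, inv_pow,
    inv_pow]

/-- The Sobolev embedding `H²(ℝ²) ⊂ L^∞(ℝ²)`, in the form needed here. -/
theorem memLp_top_of_symbol (w : L2Plane) (m : Plane → ℂ) (c : ℝ) (hc : 0 < c)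
    (hm : ∀ ξ, c * (1 + ‖ξ‖ ^ 2) ≤ ‖m ξ‖)
    (h : MemLp (fun ξ => m ξ * (𝓕 w : L2Plane) ξ) 2 volume) : MemLp w ∞ volume := by
  refine memLp_top_of_fourier w ?_
  have hi := h.integrable_mul (memLp_symb c hc)
  refine hi.mono (Lp.aestronglyMeasurable _) (Filter.Eventually.of_forall fun ξ => ?_)
  have hp : 0 < c * (1 + ‖ξ‖ ^ 2) := by positivity
  simp only [Pi.mul_apply]
  rw [norm_mul, norm_mul, norm_inv, Complex.norm_real, Real.norm_eq_abs, abs_of_pos hp,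
    ← div_eq_mul_inv, le_div_iff₀ hp, mul_comm]
  exact mul_le_mul_of_nonneg_right (hm ξ) (norm_nonneg _)

theorem l11_coercive (P : Params) : ∃ c > 0, ∀ ξ, c * (1 + ‖ξ‖ ^ 2) ≤ ‖(l11 P ξ : ℂ)‖ := by
  have := P.lam1_pos
  refine ⟨min 1 (P.lam1 * (2 * Real.pi) ^ 2), by positivity, fun ξ => ?_⟩
  have h := l11_le P ξ
  rw [Complex.norm_real, Real.norm_eq_abs, abs_of_neg (by linarith), l11, norm_smul,
    Real.norm_eq_abs, abs_of_pos (by positivity), mul_pow _ ‖ξ‖]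
  have h1 := min_le_left 1 (P.lam1 * (2 * Real.pi) ^ 2)
  have h2 := mul_le_mul_of_nonneg_right (min_le_right 1 (P.lam1 * (2 * Real.pi) ^ 2))
    (sq_nonneg ‖ξ‖)
  nlinarith

theorem l22_coercive (P : Params) : ∃ c > 0, ∀ ξ, c * (1 + ‖ξ‖ ^ 2) ≤ ‖(l22 P ξ : ℂ)‖ := by
  have := P.lam2_pos
  refine ⟨min P.lam2 ((2 * Real.pi) ^ 2), by positivity, fun ξ => ?_⟩
  have h := l22_le P ξ
  rw [Complex.norm_real, Real.norm_eq_abs, abs_of_neg (by linarith), l22, norm_smul,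
    Real.norm_eq_abs, abs_of_pos (by positivity), mul_pow _ ‖ξ‖]
  have h1 := min_le_left P.lam2 ((2 * Real.pi) ^ 2)
  have h2 := mul_le_mul_of_nonneg_right (min_le_right P.lam2 ((2 * Real.pi) ^ 2))
    (sq_nonneg ‖ξ‖)
  nlinarith

theorem memLp_top_fst (P : Params) (u : L2Pair) (hu : u ∈ HD4 P) :
    MemLp (u.fst : L2Plane) ∞ volume := by
  obtain ⟨c, hc, h⟩ := l11_coercive P
  exact memLp_top_of_symbol u.fst (fun ξ => l11 P ξ) c hc h ((mem_HD4_iff P u).1 hu).1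

theorem memLp_top_snd (P : Params) (u : L2Pair) (hu : u ∈ HD4 P) :
    MemLp (u.snd : L2Plane) ∞ volume := by
  obtain ⟨c, hc, h⟩ := l22_coercive P
  refine memLp_top_of_symbol u.snd (fun ξ => l22 P ξ) c hc h ?_
  have h2 := ((mem_HD4_iff P u).1 hu).2
  have h1 : MemLp (fun ξ => ((P.lam2 * P.lam1 - 1 : ℝ) : ℂ) *
      (𝓕 (u.fst : L2Plane) : L2Plane) ξ) 2 volume :=
    (Lp.memLp (𝓕 (u.fst : L2Plane) : L2Plane)).const_mul _
  refine (memLp_congr_ae (Filter.Eventually.of_forall fun ξ => ?_)).1 (h2.sub h1)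
  simp only [Pi.sub_apply, lhat2, l21]
  ring

/-- The function `(u₂ + 1 - λ₁ u₁) u₁²`. -/
def gFun (P : Params) (u : L2Pair) (x : Plane) : ℂ :=
  ((u.snd : L2Plane) x + 1 - P.lam1 * (u.fst : L2Plane) x) * (u.fst : L2Plane) x ^ 2

theorem memLp_gFun (P : Params) (u : L2Pair) (hu : u ∈ HD4 P) : MemLp (gFun P u) 2 volume := by
  have h1 := memLp_top_fst P u hu
  have h2 := memLp_top_snd P u hu
  have h3 : MemLp (fun x => ((u.snd : L2Plane) x + 1 - P.lam1 * (u.fst : L2Plane) x) *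
      (u.fst : L2Plane) x) ∞ volume :=
    MemLp.mul (p := ∞) (q := ∞) h1 ((h2.add (memLp_top_const 1)).sub (h1.const_mul _))
  have h4 := MemLp.mul (p := ∞) (q := 2) (r := 2) (Lp.memLp (u.fst : L2Plane)) h3
  refine (memLp_congr_ae (Filter.Eventually.of_forall fun x => ?_)).1 h4
  simp only [gFun, Pi.mul_apply]
  ring

theorem gFun_d4 (P : Params) (u : L2Pair) (i : Fin 3) :
    (fun x => gFun P u (d4Gen i x)) =ᵐ[volume] gFun P u := by
  filter_upwards [u.fst.2 i, u.snd.2 i] with x h1 h2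
  simp only [gFun, h1, h2]

/-- The nonlinear term `𝔾(u) = ((u₂ + 1 - λ₁ u₁) u₁², 0)`. -/
def GMap (P : Params) (u : HSpace P) : L2Pair :=
  WithLp.toLp 2
    (⟨(memLp_gFun P (HSpace.incl P u) (HSpace.incl_mem P u)).toLp _,
      toLp_mem_L2D4 _ (gFun_d4 P _)⟩, 0)

/-- The map `𝔽 : ℋ_{D₄} → L²_{D₄}`, `𝔽(u) = 𝕃u + 𝔾(u)`. -/
def FMap (P : Params) (u : HSpace P) : L2Pair := Liso P u + GMap P u

/-! ### The bold maps `γ`, `γ†`, `Γ†` -/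

/-- `Γ†(K) = γ† K γ` for an operator `K` on `ℓ²(J_red(D₄))`. -/
def GamDag (P : Params) (K : Ell2 →L[ℂ] Ell2) : L2D4 →L[ℂ] L2D4 := gamDag P ∘L K ∘L gam P

/-- `γ` acting on both components. -/
def gamPair (P : Params) : L2Pair →L[ℂ] Ell2Pair := diagOp (gam P)

/-- `γ†` acting on both components. -/
def gamDagPair (P : Params) : Ell2Pair →L[ℂ] L2Pair := diagOp (gamDag P)

/-- `Γ†(K) = γ† K γ` for an operator `K` on `ℓ²_{D₄}`. -/
def GamDagPair (P : Params) (K : Ell2Pair →L[ℂ] Ell2Pair) : L2Pair →L[ℂ] L2Pair :=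
  gamDagPair P ∘L K ∘L gamPair P

/-! ### Truncated sequences, their multiplication and discrete convolution operators -/

theorem finite_index (M : ℕ) : {n : Jred | n.1.1 ≤ M}.Finite := by
  refine Set.Finite.of_injOn (f := fun n : Jred => n.1) (t := Set.Icc (0 : ℤ) M ×ˢ Set.Icc (0 : ℤ) M)
    (fun n hn => ?_) Subtype.val_injective.injOn
    ((Set.finite_Icc _ _).prod (Set.finite_Icc _ _))
  obtain ⟨⟨a, b⟩, h1, h2⟩ := n
  simp only [Set.mem_ofPred_eq, Set.mem_prod, Set.mem_Icc] at hn h1 h2 ⊢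
  omega

theorem memLp_truncSeq (M : ℕ) (U : Jred → ℂ) : MemLp (truncSeq M U) 2 weight := by
  rw [memLp_weight_iff]
  refine summable_of_hasFiniteSupport ((finite_index M).subset fun n hn => ?_)
  by_contra h
  exact hn (by simp [truncSeq, show ¬ n.1.1 ≤ M from h])

/-- The truncation `π^M U` of an arbitrary sequence, as an element of `ℓ²(J_red(D₄))`. -/
def truncEll2 (M : ℕ) (U : Jred → ℂ) : Ell2 := (memLp_truncSeq M U).toLp

theorem truncEll2_apply (M : ℕ) (U : Jred → ℂ) (n : Jred) : truncEll2 M U n = truncSeq M U n :=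
  weight_ext (memLp_truncSeq M U).coeFn_toLp n

theorem memLp_top_add {u v : L2Plane} (hu : MemLp u ∞ volume) (hv : MemLp v ∞ volume) :
    MemLp (u + v : L2Plane) ∞ volume :=
  (memLp_congr_ae (Lp.coeFn_add u v)).2 (hu.add hv)

theorem memLp_top_smul (c : ℂ) {u : L2Plane} (hu : MemLp u ∞ volume) :
    MemLp (c • u : L2Plane) ∞ volume :=
  (memLp_congr_ae (Lp.coeFn_smul c u)).2 (hu.const_smul c)

theorem memLp_top_sum {ι : Type*} (s : Finset ι) (f : ι → L2Plane)
    (h : ∀ i, MemLp (f i) ∞ volume) : MemLp (∑ i ∈ s, f i : L2Plane) ∞ volume :=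
  Finset.sum_induction f (fun u : L2Plane => MemLp u ∞ volume) (fun _ _ => memLp_top_add)
    ((memLp_congr_ae (Lp.coeFn_zero ℂ 2 volume)).2 MemLp.zero) fun i _ => h i

theorem memLp_top_orbL2 (P : Params) (n : Jred) : MemLp (orbL2 P n) ∞ volume :=
  memLp_top_sum _ _ fun m =>
    (memLp_congr_ae (memLp_expo P m 2).coeFn_toLp).2 (memLp_expo P m ∞)

theorem memLp_top_gamDag (P : Params) (M : ℕ) (U : Jred → ℂ) :
    MemLp (gamDag P (truncEll2 M U) : L2Plane) ∞ volume := by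
  rw [gamDag_coe, tsum_eq_sum (s := (finite_index M).toFinset) fun n hn => by
    have h : ¬ n.1.1 ≤ M := by simpa using hn
    rw [truncEll2_apply, truncSeq, if_neg h, zero_smul]]
  exact memLp_top_sum _ _ fun n => memLp_top_smul _ (memLp_top_orbL2 P n)

/-- The multiplication operator associated with the function `γ†(π^M U)`. -/
def mulTrunc (P : Params) (M : ℕ) (U : Jred → ℂ) : L2D4 →L[ℂ] L2D4 :=
  mulD4 (gamDag P (truncEll2 M U) : L2Plane) (memLp_top_gamDag P M U)
    (gamDag P (truncEll2 M U)).2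

/-- The discrete convolution operator `W ↦ (π^M U) * W = γ(γ†(π^M U) γ†(W))`. -/
def convTrunc (P : Params) (M : ℕ) (U : Jred → ℂ) : Ell2 →L[ℂ] Ell2 :=
  gam P ∘L mulTrunc P M U ∘L gamDag P

/-! ### The operators of the statement -/

/-- `v₁ = 2 u₂ u₁ + 2 u₁ - 3 λ₁ u₁²`. -/
def v1 (P : Params) (u : L2Pair) (x : Plane) : ℂ :=
  2 * (u.snd : L2Plane) x * (u.fst : L2Plane) x + 2 * (u.fst : L2Plane) x
    - 3 * P.lam1 * (u.fst : L2Plane) x ^ 2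

/-- `v₂ = u₁²`. -/
def v2 (u : L2Pair) (x : Plane) : ℂ := (u.fst : L2Plane) x ^ 2

/-- `V₁ = γ(v₁)`, where `v₁` is built from `u₀ = γ†(U₀)`. -/
def V1 (P : Params) (U₀ : Ell2Pair) : Jred → ℂ := coeff P (v1 P (gamDagPair P U₀))

/-- `V₂ = γ(v₂)`, where `v₂` is built from `u₀ = γ†(U₀)`. -/
def V2 (P : Params) (U₀ : Ell2Pair) : Jred → ℂ := coeff P (v2 (gamDagPair P U₀))

/-- The multiplication operator by `v₁^N = γ†(V₁^N)`, with `V₁^N = π^{2N} V₁`. -/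
def mulV1N (P : Params) (N : ℕ) (U₀ : Ell2Pair) : L2D4 →L[ℂ] L2D4 :=
  mulTrunc P (2 * N) (V1 P U₀)

/-- The multiplication operator by `v₂^N = γ†(V₂^N)`, with `V₂^N = π^{2N} V₂`. -/
def mulV2N (P : Params) (N : ℕ) (U₀ : Ell2Pair) : L2D4 →L[ℂ] L2D4 :=
  mulTrunc P (2 * N) (V2 P U₀)

/-- `DG^N(U₀)`, with rows `(V₁^N *, V₂^N *)` and `(0, 0)`. -/
def DGN (P : Params) (N : ℕ) (U₀ : Ell2Pair) : Ell2Pair →L[ℂ] Ell2Pair :=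
  blockOp (convTrunc P (2 * N) (V1 P U₀)) (convTrunc P (2 * N) (V2 P U₀)) 0 0

/-- `D𝔾^N(u₀) = Γ†(DG^N(U₀))`. -/
def DGNfull (P : Params) (N : ℕ) (U₀ : Ell2Pair) : L2Pair →L[ℂ] L2Pair :=
  GamDagPair P (DGN P N U₀)

/-- `B = π_N + B^N`, where `B^N` has rows `(B₁₁^N, B₁₂^N)` and `(0, π^N)`. -/
def BSeq (N : ℕ) (B11 B12 : Ell2 →L[ℂ] Ell2) : Ell2Pair →L[ℂ] Ell2Pair :=
  diagOp (piDown N) + blockOp B11 B12 0 (piUp N)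

/-- `𝔹 = 𝟙_{ℝ² \ Ω₀} + Γ†(B)`. -/
def BFull (P : Params) (N : ℕ) (B11 B12 : Ell2 →L[ℂ] Ell2) : L2Pair →L[ℂ] L2Pair :=
  diagOp (indOut P) + GamDagPair P (BSeq N B11 B12)

/-- The approximate inverse `𝔸 = 𝕃⁻¹ 𝔹 : L²_{D₄} → ℋ_{D₄}`. -/
def AFull (P : Params) (N : ℕ) (B11 B12 : Ell2 →L[ℂ] Ell2) : L2Pair →L[ℂ] HSpace P :=
  (Liso P).symm.toContinuousLinearEquiv.toContinuousLinearMap ∘L BFull P N B11 B12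

/-- The function `φ`, with
`φ(x₁, x₂, x₃, x₄) = min {max {x₁, x₄} + max {x₂, x₃}, √(x₁² + x₂² + x₃² + x₄²)}`. -/
def phi (x₁ x₂ x₃ x₄ : ℝ) : ℝ :=
  min (max x₁ x₄ + max x₂ x₃) (Real.sqrt (x₁ ^ 2 + x₂ ^ 2 + x₃ ^ 2 + x₄ ^ 2))

/-- `𝒵_u = √(𝒵_{u,1}² + 𝒵_{u,2}²)`. -/
def Zu (Zu1 Zu2 : ℝ) : ℝ := Real.sqrt (Zu1 ^ 2 + Zu2 ^ 2)

/-- The constant `𝒵₁`. -/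
def Zfull1 (P : Params) (N : ℕ) (U₀ : Ell2Pair) (B11 : Ell2 →L[ℂ] Ell2) (Z1 Zu1 Zu2 : ℝ) : ℝ :=
  Z1 + max 1 ‖B11‖ * (Zu Zu1 Zu2 +
    phi 1 0 (|P.lam1 * P.lam2 - 1| / P.lam2) (1 / P.lam2) *
      Real.sqrt (ell1Norm (truncSeq (2 * N) (V1 P U₀) - V1 P U₀) ^ 2 +
        ell1Norm (truncSeq (2 * N) (V2 P U₀) - V2 P U₀) ^ 2))

end GrayScott

end

/-! Since `Liso` is an isometry, conjugating by it turns the claim in ℋ into one in L²: the operator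
to estimate is I − 𝔹(I + D𝔾(u₀)𝕃⁻¹).

Everything rests on the transfer between sequences and functions. The exponentials are complete on
Ω₀, so γγ† = I and γ†γ = 𝟙_{Ω₀} (`gam_gamDag`, `gamDag_gam`), and γ† is √|Ω₀| times an isometry.
Hence Γ†(K) is a copy of K acting inside Ω₀ and vanishing outside; it is multiplicative and does not
increase norms, and discrete convolution by V_i^N becomes honest multiplication by v_i^N
(`GamDag_convTrunc`).

The first two bounds are dual to the hypotheses: there multiplication by v stands on the right, here
on the left. The symbols are real, so the multipliers, their sequence analogues and the cutoffs are
self-adjoint, while the adjoint of multiplication by v is multiplication by its conjugate, which has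
the same modulus (`norm_mulD4_comp_le`). The block structure then combines the three scalar bounds:
the first column carries two terms, the second one.

For the third bound, multiplicativity of Γ† gives the exact identity (`one_sub_parametrix_eq`) I −
𝔹(I + D𝔾𝕃⁻¹) = Γ†(I − B(I + DG^N L⁻¹)) − 𝔹 D𝔾^N (𝕃⁻¹ − Γ†(L⁻¹)) − 𝔹 (D𝔾 − D𝔾^N) 𝕃⁻¹. The first term
costs Z₁. In the other two, 𝔹 meets only pairs (f, 0) with f supported in Ω₀, where it acts through
π_N + B₁₁^N alone; the ranges being orthogonal, the cost is max{1, ‖B₁₁^N‖}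
(`norm_parametrix_apply_le`). Splitting the argument into its inside and outside parts bounds the
middle term by the Euclidean combination of the two first bounds (`norm_apply_le_sqrt`). In the last
term the multipliers v_i − v_i^N are bounded uniformly by ℓ¹ norms of coefficients, and ‖𝕃⁻¹‖ by φ.

Finally D𝔽(u₀) must be identified. 𝔾 is cubic, and ℋ embeds boundedly in L^∞ by the closed graph
theorem, so the Taylor remainder is quadratic in the ℋ norm (`hasFDerivAt_GMap`). -/

noncomputable section

namespace GrayScott

/-! ### Completeness of the exponentials on the square -/

/-- The map `y ↦ 2d y`, from the unit cube `(-1/2, 1/2)²` onto `Ω₀`. -/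
def scaleMap (P : Params) (y : Fin 2 → ℝ) : Plane := (2 * P.d) • WithLp.toLp 2 y

theorem measurable_scaleMap (P : Params) : Measurable (scaleMap P) := by
  have h : Continuous (scaleMap P) := by unfold scaleMap; fun_prop
  exact h.measurable

/-- The factor is the Jacobian of a dilation in dimension two. Being finite and nonzero, it affects
neither membership in L² nor null sets. -/
theorem map_scaleMap (P : Params) : Measure.map (scaleMap P) volume =
    ENNReal.ofReal |((2 * P.d) ^ 2)⁻¹| • (volume : Measure Plane) := by
  have hd : 2 * P.d ≠ 0 := by have := P.one_le_d; positivity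
  have h := Measure.map_addHaar_smul (volume : Measure Plane) hd
  rw [← (PiLp.volume_preserving_toLp (Fin 2)).map_eq, Measure.map_map (by fun_prop)
    (by fun_prop)] at h
  rw [finrank_euclideanSpace_fin] at h
  rw [show scaleMap P = (fun x : Plane => (2 * P.d) • x) ∘ WithLp.toLp 2 from rfl, h,
    (PiLp.volume_preserving_toLp (Fin 2)).map_eq]

theorem memLp_comp_scaleMap (P : Params) (u : L2Plane) :
    MemLp (fun y => u (scaleMap P y)) 2 volume := by
  have h := (Lp.memLp u).smul_measure (c := ENNReal.ofReal |((2 * P.d) ^ 2)⁻¹|)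
    ENNReal.ofReal_ne_top
  rw [← map_scaleMap] at h
  exact (memLp_map_measure_iff h.1 (measurable_scaleMap P).aemeasurable).1 h

/-- The right endpoint is kept as `-(1 / 2) + 1` to match literally the form `(a, a + 1]` of the
fundamental domain of the torus. -/
theorem scaleMap_mem_Omega (P : Params) (y : Fin 2 → ℝ) :
    scaleMap P y ∈ Omega P ↔ ∀ i, y i ∈ Set.Ioo (-(1 / 2) : ℝ) (-(1 / 2) + 1) := by
  have hd := P.one_le_d
  refine forall_congr' fun i => ?_
  simp only [scaleMap, PiLp.smul_apply, smul_eq_mul, Set.mem_Ioo]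
  constructor <;> rintro ⟨h1, h2⟩ <;> constructor <;> nlinarith

theorem expo_scaleMap (P : Params) (n : Fin 2 → ℤ) (y : Fin 2 → ℝ) :
    expo P (n 0, n 1) (scaleMap P y) = UnitAddTorus.mFourier n fun i => (y i : UnitAddCircle) := by
  have hd : (P.d : ℂ) ≠ 0 := by have := P.one_le_d; exact_mod_cast (by positivity : P.d ≠ 0)
  rw [expo, inner_freq, UnitAddTorus.mFourier]
  simp only [ContinuousMap.coe_mk, Fin.prod_univ_two, fourier_coe_apply, ← Complex.exp_add]
  congr 1
  simp only [scaleMap, PiLp.smul_apply, smul_eq_mul]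
  push_cast
  field_simp

/-- The fundamental domain of the torus is half-open whereas Ω₀ is open; the faces in which they
differ are null. -/
theorem ioc_ae_eq_preimage_Omega (P : Params) :
    ({y : Fin 2 → ℝ | ∀ i, y i ∈ Set.Ioc (-(1 / 2) : ℝ) (-(1 / 2) + 1)} : Set (Fin 2 → ℝ)) =ᵐ[volume]
      scaleMap P ⁻¹' Omega P := by
  have e1 : ({y : Fin 2 → ℝ | ∀ i, y i ∈ Set.Ioc (-(1 / 2) : ℝ) (-(1 / 2) + 1)} : Set (Fin 2 → ℝ)) =
      Set.univ.pi fun _ => Set.Ioc (-(1 / 2) : ℝ) (-(1 / 2) + 1) := by ext; simp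
  have e2 : scaleMap P ⁻¹' Omega P =
      Set.univ.pi fun _ => Set.Ioo (-(1 / 2) : ℝ) (-(1 / 2) + 1) := by
    ext y; simp only [Set.mem_preimage, scaleMap_mem_Omega, Set.mem_univ_pi]
  rw [e1, e2]
  exact Measure.univ_pi_Ioc_ae_eq_Icc.trans Measure.univ_pi_Ioo_ae_eq_Icc.symm

/-- A function on the plane, restricted to `Ω₀` and seen as a function on the torus. -/
def torusLift (P : Params) (u : L2Plane) (t : UnitAddTorus (Fin 2)) : ℂ :=
  u (scaleMap P (UnitAddTorus.measurableEquivPiIoc (fun _ => -(1 / 2)) t).1)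

theorem torusLift_coe (P : Params) (u : L2Plane) (y : Fin 2 → ℝ)
    (hy : ∀ i, y i ∈ Set.Ioc (-(1 / 2) : ℝ) (-(1 / 2) + 1)) :
    torusLift P u (fun i => (y i : UnitAddCircle)) = u (scaleMap P y) := by
  have := (UnitAddTorus.measurableEquivPiIoc (ι := Fin 2)
    (fun _ => -(1 / 2))).apply_symm_apply ⟨y, hy⟩
  rw [UnitAddTorus.coe_symm_measurableEquivPiIoc_apply] at this
  rw [torusLift, this]

/-- Change of variables by the dilation: vanishing of the pairings with the exponentials on Ω₀
becomes vanishing of the Fourier coefficients on the torus. -/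
theorem mFourierCoeff_torusLift (P : Params) (u : L2Plane) (n : Fin 2 → ℤ) :
    UnitAddTorus.mFourierCoeff (torusLift P u) n =
      (|((2 * P.d) ^ 2)⁻¹| : ℝ) * inner ℂ (expoL2 P (n 0, n 1)) u := by
  rw [UnitAddTorus.mFourierCoeff_eq_integral _ n (fun _ => -(1 / 2)), inner_expoL2]
  have hm : MeasurableSet {y : Fin 2 → ℝ | ∀ i, y i ∈ Set.Ioc (-(1 / 2) : ℝ) (-(1 / 2) + 1)} :=
    MeasurableSet.univ_pi' fun _ => measurableSet_Ioc
  rw [setIntegral_congr_fun (g := fun y => (fun x => u x * expo P (-(n 0, n 1)) x)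
    (scaleMap P y)) hm
    fun y hy => by
      simp only
      rw [torusLift_coe P u y hy, show (-(n 0, n 1) : ℤ × ℤ) = ((-n) 0, (-n) 1) from rfl,
        expo_scaleMap, smul_eq_mul, mul_comm]]
  have hmap := setIntegral_map (μ := volume) (g := scaleMap P)
    (f := fun x => u x * expo P (-(n 0, n 1)) x) (measurableSet_Omega P)
    (by
      rw [map_scaleMap]
      exact ((Lp.aestronglyMeasurable u).mul
        (continuous_expo P _).aestronglyMeasurable).smul_measure _)
    (measurable_scaleMap P).aemeasurable
  rw [setIntegral_congr_set (ioc_ae_eq_preimage_Omega P), ← hmap, map_scaleMap,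
    Measure.restrict_smul, integral_smul_measure, ENNReal.toReal_ofReal (abs_nonneg _),
    Complex.real_smul]

/-- Completeness of the exponentials on Ω₀, imported from the torus: the Fourier series of the lift
converges to it in L², so zero coefficients force the lift to vanish. The first hypothesis takes
care of the complement of Ω₀. -/
theorem eq_zero_of_inner_expoL2 (P : Params) (u : L2Plane)
    (hu : ∀ᵐ x, x ∉ Omega P → u x = 0) (h : ∀ m, inner ℂ (expoL2 P m) u = 0) : u = 0 := by
  -- The Fourier series on the torus is taken for the normalised Haar measure, so this measure is
  -- made the volume.
  let _ : MeasureSpace UnitAddCircle := ⟨AddCircle.haarAddCircle⟩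
  have : IsProbabilityMeasure (volume : Measure UnitAddCircle) :=
    inferInstanceAs (IsProbabilityMeasure AddCircle.haarAddCircle)
  have hmp := UnitAddTorus.measurePreserving_equivPiIoc (d := Fin 2) fun _ => -(1 / 2)
  have hm : MeasurableSet {y : Fin 2 → ℝ | ∀ i, y i ∈ Set.Ioc (-(1 / 2) : ℝ) (-(1 / 2) + 1)} :=
    MeasurableSet.univ_pi' fun _ => measurableSet_Ioc
  have hsub : MeasurePreserving (Subtype.val :
      {y : Fin 2 → ℝ // ∀ i, y i ∈ Set.Ioc (-(1 / 2) : ℝ) (-(1 / 2) + 1)} → Fin 2 → ℝ)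
      (Measure.comap Subtype.val volume) (volume.restrict _) := measurePreserving_subtype_coe hm
  have hL : MemLp (torusLift P u) 2 volume :=
    (((memLp_comp_scaleMap P u).restrict _).comp_measurePreserving hsub).comp_measurePreserving hmp
  have h0 : hL.toLp = 0 := by
    have hs := UnitAddTorus.hasSum_mFourier_series_L2 hL.toLp
    have hc : ∀ n, UnitAddTorus.mFourierCoeff hL.toLp n = 0 := fun n => by
      have : UnitAddTorus.mFourierCoeff hL.toLp n =
          UnitAddTorus.mFourierCoeff (torusLift P u) n := by
        refine integral_congr_ae ?_
        filter_upwards [hL.coeFn_toLp] with t ht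
        rw [ht]
      rw [this, mFourierCoeff_torusLift, h, mul_zero]
    simp only [hc, zero_smul] at hs
    exact hs.unique hasSum_zero
  have h1 : torusLift P u =ᵐ[volume] 0 :=
    hL.coeFn_toLp.symm.trans (by rw [h0]; exact Lp.coeFn_zero _ _ _)
  -- From here the a.e. vanishing is carried back from the torus to the cube, then through the
  -- dilation to Ω₀.
  have h2 := (hmp.symm _).quasiMeasurePreserving.ae h1
  have h3 : ∀ᵐ y ∂(volume : Measure (Fin 2 → ℝ)).restrict
      {y : Fin 2 → ℝ | ∀ i, y i ∈ Set.Ioc (-(1 / 2) : ℝ) (-(1 / 2) + 1)}, u (scaleMap P y) = 0 := by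
    rw [ae_restrict_iff_subtype hm]
    filter_upwards [h2] with y hy
    rw [← torusLift_coe P u y.1 y.2]
    exact hy
  rw [Measure.restrict_congr_set (ioc_ae_eq_preimage_Omega P),
    ae_restrict_iff' ((measurable_scaleMap P) (measurableSet_Omega P))] at h3
  have hc : ENNReal.ofReal |((2 * P.d) ^ 2)⁻¹| ≠ 0 := by
    have := P.one_le_d
    rw [ne_eq, ENNReal.ofReal_eq_zero, not_le]; positivity
  have h4 : ∀ᵐ x ∂(Measure.map (scaleMap P) volume), x ∈ Omega P → u x = 0 := by
    rw [ae_map_iff (measurable_scaleMap P).aemeasurable]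
    · exact h3
    · have : MeasurableSet {x : Plane | u x = 0} :=
        (Lp.stronglyMeasurable u).measurable (measurableSet_singleton 0)
      exact (measurableSet_Omega P).imp this
  rw [map_scaleMap, Measure.ae_ennreal_smul_measure_eq hc] at h4
  refine Lp.ext ?_
  filter_upwards [h4, hu, Lp.coeFn_zero ℂ 2 (volume : Measure Plane)] with x h1 h2 h3
  rw [h3]
  by_cases hx : x ∈ Omega P
  · exact h1 hx
  · exact h2 hx

/-! ### The maps `γ` and `γ†` are inverse to each other on `Ω₀` -/

theorem exists_mem_orb (m : ℤ × ℤ) : ∃ n : Jred, m ∈ orb n := by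
  refine ⟨⟨(max |m.1| |m.2|, min |m.1| |m.2|), le_min (abs_nonneg _) (abs_nonneg _),
    min_le_max⟩, ?_⟩
  obtain ⟨a, b⟩ := m
  simp only [orb, Finset.mem_insert, Finset.mem_singleton, Prod.mk.injEq]
  grind

theorem eq_of_mem_orb {m : ℤ × ℤ} {n n' : Jred} (h : m ∈ orb n) (h' : m ∈ orb n') : n = n' := by
  have h1 := mem_orb_rep h
  have h2 := mem_orb_rep h'
  exact Subtype.ext (Prod.ext (h1.1.symm.trans h2.1) (h1.2.symm.trans h2.2))

theorem inner_expoL2_orbL2 (P : Params) (m : ℤ × ℤ) (n : Jred) :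
    inner ℂ (expoL2 P m) (orbL2 P n) = if m ∈ orb n then (area P : ℂ) else 0 := by
  simp only [orbL2, inner_sum, inner_expoL2_expoL2, Finset.sum_ite_eq]

/-- The orbits are pairwise disjoint, so testing the series against one exponential leaves a single
term. -/
theorem inner_expoL2_gamDag (P : Params) (U : Ell2) {m : ℤ × ℤ} {n : Jred} (h : m ∈ orb n) :
    inner ℂ (expoL2 P m) (gamDag P U : L2Plane) = area P * U n := by
  have hs := (hasSum_orbL2 P U).mapL (innerSL ℂ (expoL2 P m))
  rw [← (hasSum_orbL2 P U).tsum_eq, ← gamDag_coe] at hs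
  simp only [innerSL_apply_apply, inner_smul_right, inner_expoL2_orbL2] at hs
  refine hs.unique ?_
  convert hasSum_single n fun n' hn' => ?_ using 1
  · rw [if_pos h, mul_comm]
  · rw [if_neg fun h' => hn' (eq_of_mem_orb h' h), mul_zero]

theorem mem_orb_self (n : ℤ × ℤ) : n ∈ orb n := by simp [orb]

theorem inner_expoL2_idxGen (P : Params) (i : Fin 3) (m : ℤ × ℤ) {u : L2Plane} (hu : u ∈ L2D4) :
    inner ℂ (expoL2 P (idxGen i m)) u = inner ℂ (expoL2 P m) u := by
  rw [← compGen_expoL2, ← (compGen i).inner_map_map (expoL2 P m) u, (mem_L2D4_iff u).1 hu i]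

/-- The coefficients of a symmetric function are constant along orbits; this is why those indexed by
`Jred` determine all the others. -/
theorem inner_expoL2_of_mem_orb (P : Params) {n m : ℤ × ℤ} (h : m ∈ orb n) {u : L2Plane}
    (hu : u ∈ L2D4) : inner ℂ (expoL2 P m) u = inner ℂ (expoL2 P n) u := by
  have h0 : ∀ a b, inner ℂ (expoL2 P (-a, b)) u = inner ℂ (expoL2 P (a, b)) u :=
    fun a b => inner_expoL2_idxGen P 0 (a, b) hu
  have h1 : ∀ a b, inner ℂ (expoL2 P (a, -b)) u = inner ℂ (expoL2 P (a, b)) u :=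
    fun a b => inner_expoL2_idxGen P 1 (a, b) hu
  have h2 : inner ℂ (expoL2 P (n.2, n.1)) u = inner ℂ (expoL2 P n) u :=
    inner_expoL2_idxGen P 2 n hu
  simp only [orb, Finset.mem_insert, Finset.mem_singleton] at h
  rcases h with rfl | rfl | rfl | rfl | rfl | rfl | rfl | rfl <;> simp [h0, h1, h2]

theorem gam_gamDag (P : Params) (U : Ell2) : gam P (gamDag P U) = U := by
  refine Lp.ext (Filter.Eventually.of_forall fun n => ?_)
  have hp : (area P : ℂ) ≠ 0 := by exact_mod_cast (area_pos P).ne'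
  rw [gam_apply, coeff_eq_inner, inner_expoL2_gamDag P U (mem_orb_self n), inv_mul_cancel_left₀ hp]

theorem indD4_coe (S : Set Plane) (hS : MeasurableSet S) (hs : ∀ i x, d4Gen i x ∈ S ↔ x ∈ S)
    (u : L2D4) : ((indD4 S hS hs u : L2Plane) : Plane → ℂ) =ᵐ[volume]
      S.indicator (u : L2Plane) := by
  filter_upwards [mulOp_coe (S.indicator fun _ => (1 : ℂ))
    ((memLp_top_const (1 : ℂ)).indicator hS) (u : L2Plane)] with x hx
  refine hx.trans ?_
  by_cases h : x ∈ S <;> simp [h]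

theorem indIn_coe (P : Params) (u : L2D4) :
    ((indIn P u : L2Plane) : Plane → ℂ) =ᵐ[volume] (Omega P).indicator (u : L2Plane) :=
  indD4_coe _ _ _ u

theorem indOut_coe (P : Params) (u : L2D4) :
    ((indOut P u : L2Plane) : Plane → ℂ) =ᵐ[volume] (Omega P)ᶜ.indicator (u : L2Plane) :=
  indD4_coe _ _ _ u

theorem inner_expoL2_indIn (P : Params) (m : ℤ × ℤ) (u : L2D4) :
    inner ℂ (expoL2 P m) (indIn P u : L2Plane) = inner ℂ (expoL2 P m) (u : L2Plane) := by
  rw [inner_expoL2, inner_expoL2]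
  refine setIntegral_congr_ae (measurableSet_Omega P) ?_
  filter_upwards [indIn_coe P u] with x hx h
  rw [hx, Set.indicator_of_mem h]

theorem orbL2_eq_zero_outside (P : Params) (n : Jred) : ∀ᵐ x, x ∉ Omega P → orbL2 P n x = 0 := by
  have h : ∀ s : Finset (ℤ × ℤ), ∀ᵐ x, x ∉ Omega P → (∑ m ∈ s, expoL2 P m : L2Plane) x = 0 := by
    intro s
    induction s using Finset.induction_on with
    | empty =>
      filter_upwards [Lp.coeFn_zero ℂ 2 (volume : Measure Plane)] with x hx _
      rw [Finset.sum_empty, hx]; rfl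
    | insert a s ha ih =>
      rw [Finset.sum_insert ha]
      filter_upwards [ih, Lp.coeFn_add (expoL2 P a) (∑ m ∈ s, expoL2 P m),
        (memLp_expo P a 2).coeFn_toLp] with x h1 h2 h3 hx
      rw [h2, Pi.add_apply, h1 hx, expoL2, h3, Set.indicator_of_notMem hx, add_zero]
  exact h _

/-- Multiplication by `𝟙_{Ω₀}` on all of `L²(ℝ²)`. -/
def indInPlane (P : Params) : L2Plane →L[ℂ] L2Plane :=
  mulOp ((Omega P).indicator fun _ => 1)
    ((memLp_top_const (1 : ℂ)).indicator (measurableSet_Omega P))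

theorem indInPlane_coe (P : Params) (u : L2Plane) :
    (indInPlane P u : Plane → ℂ) =ᵐ[volume] (Omega P).indicator u := by
  filter_upwards [mulOp_coe ((Omega P).indicator fun _ => (1 : ℂ))
    ((memLp_top_const (1 : ℂ)).indicator (measurableSet_Omega P)) u] with x hx
  refine hx.trans ?_
  by_cases h : x ∈ Omega P <;> simp [h]

theorem coe_indIn (P : Params) (u : L2D4) : (indIn P u : L2Plane) = indInPlane P u := rfl

/-- The cutoff is continuous, so it passes through the L² series, each term of which already
vanishes outside Ω₀. -/
theorem indIn_gamDag (P : Params) (U : Ell2) : indIn P (gamDag P U) = gamDag P U := by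
  refine Subtype.ext ?_
  have hs := hasSum_orbL2 P U
  rw [← hs.tsum_eq, ← gamDag_coe] at hs
  rw [coe_indIn]
  refine (hs.mapL (indInPlane P)).unique ?_
  refine hs.congr_fun fun n => ?_
  rw [map_smul]
  congr 1
  refine Lp.ext ?_
  filter_upwards [indInPlane_coe P (orbL2 P n), orbL2_eq_zero_outside P n] with x h1 h2
  rw [h1]
  by_cases hx : x ∈ Omega P <;> simp [hx, h2]

/-- The difference is supported in Ω₀ and orthogonal to every exponential: along each orbit both
sides have the coefficient attached to its representative in `Jred`. Completeness then gives zero.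
-/
theorem gamDag_gam (P : Params) (u : L2D4) : gamDag P (gam P u) = indIn P u := by
  rw [← sub_eq_zero]
  refine Subtype.ext (eq_zero_of_inner_expoL2 P _ ?_ fun m => ?_)
  · have e : ((gamDag P (gam P u) - indIn P u : L2D4) : L2Plane) =
        indIn P (gamDag P (gam P u) - u) := by rw [map_sub, indIn_gamDag]
    rw [e]
    filter_upwards [indIn_coe P (gamDag P (gam P u) - u)] with x h1 hx
    rw [h1, Set.indicator_of_notMem hx]
  · obtain ⟨n, hn⟩ := exists_mem_orb m
    have hp : (area P : ℂ) ≠ 0 := by exact_mod_cast (area_pos P).ne'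
    rw [Submodule.coe_sub, inner_sub_right, inner_expoL2_indIn, inner_expoL2_gamDag P _ hn,
      gam_apply, coeff_eq_inner, mul_inv_cancel_left₀ hp, inner_expoL2_of_mem_orb P hn u.2,
        sub_self]

theorem norm_gamDag_sq (P : Params) (U : Ell2) : ‖gamDag P U‖ ^ 2 = area P * ‖U‖ ^ 2 := by
  rw [Submodule.coe_norm, gamDag_coe, (hasSum_orbL2 P U).tsum_eq, LinearIsometry.norm_map,
    norm_toUnweighted]

theorem norm_gamDag (P : Params) (U : Ell2) : ‖gamDag P U‖ = Real.sqrt (area P) * ‖U‖ := by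
  rw [← Real.sqrt_sq (norm_nonneg (gamDag P U)), norm_gamDag_sq, Real.sqrt_mul (area_pos P).le,
    Real.sqrt_sq (norm_nonneg U)]

theorem norm_indD4_le (S : Set Plane) (hS : MeasurableSet S) (hs : ∀ i x, d4Gen i x ∈ S ↔ x ∈ S)
    (u : L2D4) : ‖indD4 S hS hs u‖ ≤ ‖u‖ := by
  rw [Submodule.coe_norm, Submodule.coe_norm]
  refine Lp.norm_le_norm_of_ae_le ?_
  filter_upwards [indD4_coe S hS hs u] with x hx
  rw [hx]
  exact norm_indicator_le_norm_self _ _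

/-- Parseval: the weights α_n make γ† a multiple of an isometry, and composing with γ leaves the
cutoff. -/
theorem norm_gam (P : Params) (u : L2D4) : Real.sqrt (area P) * ‖gam P u‖ = ‖indIn P u‖ := by
  rw [← norm_gamDag, gamDag_gam]

/-- Polarization of the norm identity `norm_gamDag_sq`. -/
theorem inner_gamDag_gamDag (P : Params) (U V : Ell2) :
    inner ℂ (gamDag P U : L2Plane) (gamDag P V : L2Plane) = area P * inner ℂ U V := by
  have h : ∀ W : Ell2, (RCLike.ofReal ‖gamDag P W‖ : ℂ) ^ 2 =
      area P * (RCLike.ofReal ‖W‖ : ℂ) ^ 2 := fun W => by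
    have := congrArg (RCLike.ofReal : ℝ → ℂ) (norm_gamDag_sq P W)
    rwa [RCLike.ofReal_mul, RCLike.ofReal_pow, RCLike.ofReal_pow] at this
  rw [inner_eq_sum_norm_sq_div_four, inner_eq_sum_norm_sq_div_four]
  simp only [← Submodule.coe_smul, ← Submodule.coe_add, ← Submodule.coe_sub, ← map_smul, ← map_add,
    ← map_sub, ← Submodule.coe_norm]
  rw [h, h, h, h]
  ring

theorem indOut_eq (P : Params) : indOut P = 1 - indIn P := by
  ext u : 2
  refine Lp.ext ?_
  have e : (((1 - indIn P : L2D4 →L[ℂ] L2D4) u : L2D4) : L2Plane) =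
    (u : L2Plane) - (indIn P u : L2Plane) := rfl
  rw [e]
  filter_upwards [indIn_coe P u, indOut_coe P u, Lp.coeFn_sub (u : L2Plane) (indIn P u)]
    with x h1 h2 h3
  rw [h2, h3, Pi.sub_apply, h1]
  by_cases hx : x ∈ Omega P <;> simp [hx]

theorem indIn_indIn (P : Params) (u : L2D4) : indIn P (indIn P u) = indIn P u := by
  rw [← gamDag_gam P u, indIn_gamDag]

theorem indIn_add_indOut (P : Params) (u : L2D4) : indIn P u + indOut P u = u := by
  rw [indOut_eq]; simp

theorem norm_sq_indIn_add_indOut (P : Params) (u : L2D4) :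
    ‖indIn P u‖ ^ 2 + ‖indOut P u‖ ^ 2 = ‖u‖ ^ 2 := by
  have h : inner ℂ (indIn P u : L2Plane) (indOut P u : L2Plane) = 0 := by
    rw [L2.inner_def]
    refine integral_eq_zero_of_ae ?_
    filter_upwards [indIn_coe P u, indOut_coe P u] with x h1 h2
    rw [h1, h2]
    by_cases hx : x ∈ Omega P <;> simp [hx]
  have h2 := norm_add_sq_eq_norm_sq_add_norm_sq_of_inner_eq_zero _ _ h
  rw [sq, sq, sq, Submodule.coe_norm, Submodule.coe_norm, ← h2, ← Submodule.coe_add,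
    indIn_add_indOut,
    Submodule.coe_norm]

theorem gam_indIn (P : Params) (u : L2D4) : gam P (indIn P u) = gam P u := by
  rw [← gamDag_gam, gam_gamDag]

theorem gam_indOut (P : Params) (u : L2D4) : gam P (indOut P u) = 0 := by
  rw [indOut_eq, sub_apply, map_sub, gam_indIn]; simp

theorem indOut_gamDag (P : Params) (U : Ell2) : indOut P (gamDag P U) = 0 := by
  rw [indOut_eq, sub_apply, indIn_gamDag]; simp

theorem inner_indIn_indOut (P : Params) (u v : L2D4) :
    inner ℂ (indIn P u : L2Plane) (indOut P v : L2Plane) = 0 := by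
  rw [L2.inner_def]
  refine integral_eq_zero_of_ae ?_
  filter_upwards [indIn_coe P u, indOut_coe P v] with x h1 h2
  rw [h1, h2]
  by_cases hx : x ∈ Omega P <;> simp [hx]

/-- The part of `v` outside Ω₀ is orthogonal to the range of γ†, and the inside part is itself in
that range. Thus |Ω₀| γ is the adjoint of γ†. -/
theorem inner_gamDag_left (P : Params) (U : Ell2) (v : L2D4) :
    inner ℂ (gamDag P U : L2Plane) (v : L2Plane) = area P * inner ℂ U (gam P v) := by
  have e : (v : L2Plane) = (gamDag P (gam P v) : L2Plane) + (indOut P v : L2Plane) := by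
    rw [gamDag_gam, ← Submodule.coe_add, indIn_add_indOut]
  have h : inner ℂ (gamDag P U : L2Plane) (indOut P v : L2Plane) = 0 := by
    rw [← indIn_gamDag]; exact inner_indIn_indOut P _ v
  rw [e, inner_add_right, h, add_zero, inner_gamDag_gamDag]

theorem inner_gamDag_right (P : Params) (U : Ell2) (v : L2D4) :
    inner ℂ (v : L2Plane) (gamDag P U : L2Plane) = area P * inner ℂ (gam P v) U := by
  rw [← inner_conj_symm, inner_gamDag_left, map_mul, inner_conj_symm, Complex.conj_ofReal]

/-! ### Norms of block operators -/

section Blocks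

variable {X Y : Type*} [NormedAddCommGroup X] [InnerProductSpace ℂ X]
  [NormedAddCommGroup Y] [InnerProductSpace ℂ Y]

theorem norm_sq_pair {X : Type*} [NormedAddCommGroup X] (x : WithLp 2 (X × X)) :
    ‖x‖ ^ 2 = ‖x.fst‖ ^ 2 + ‖x.snd‖ ^ 2 :=
  WithLp.prod_norm_sq_eq_of_L2 x

theorem pair_ext {X : Type*} {x y : WithLp 2 (X × X)} (h1 : x.fst = y.fst) (h2 : x.snd = y.snd) :
    x = y :=
  WithLp.ofLp_injective 2 (Prod.ext h1 h2)

/-- Cauchy–Schwarz in the plane; the defect of the squares is (ay − bx)², so no sign conditions are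
needed. -/
theorem le_sqrt_mul_sqrt (a b x y : ℝ) :
    a * x + b * y ≤ Real.sqrt (a ^ 2 + b ^ 2) * Real.sqrt (x ^ 2 + y ^ 2) := by
  rw [← Real.sqrt_mul (by positivity)]
  exact Real.le_sqrt_of_sq_le (by nlinarith [sq_nonneg (a * y - b * x)])

theorem norm_pair {X : Type*} [NormedAddCommGroup X] (x : WithLp 2 (X × X)) :
    ‖x‖ = Real.sqrt (‖x.fst‖ ^ 2 + ‖x.snd‖ ^ 2) := by
  rw [← norm_sq_pair, Real.sqrt_sq (norm_nonneg x)]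

theorem norm_blockOp_row_le (A B : X →L[ℂ] Y) {a b : ℝ} (hA : ‖A‖ ≤ a) (hB : ‖B‖ ≤ b) :
    ‖blockOp A B 0 0‖ ≤ Real.sqrt (a ^ 2 + b ^ 2) := by
  refine ContinuousLinearMap.opNorm_le_bound _ (Real.sqrt_nonneg _) fun x => ?_
  rw [norm_pair (blockOp A B 0 0 x), blockOp_fst, blockOp_snd, norm_pair x]
  simp only [zero_apply, add_zero, norm_zero, ne_eq, OfNat.ofNat_ne_zero, not_false_eq_true,
    zero_pow, Real.sqrt_sq (norm_nonneg _)]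
  refine (norm_add_le _ _).trans (le_trans ?_ (le_sqrt_mul_sqrt a b _ _))
  exact add_le_add (A.le_of_opNorm_le hA _) (B.le_of_opNorm_le hB _)

theorem norm_blockOp_lower_le_sqrt (A C D : X →L[ℂ] Y) {a c b : ℝ} (hA : ‖A‖ ≤ a) (hC : ‖C‖ ≤ c)
    (hD : ‖D‖ ≤ b) : ‖blockOp A 0 C D‖ ≤ Real.sqrt (a ^ 2 + c ^ 2 + b ^ 2) := by
  refine ContinuousLinearMap.opNorm_le_bound _ (Real.sqrt_nonneg _) fun x => ?_
  rw [norm_pair (blockOp A 0 C D x), blockOp_fst, blockOp_snd]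
  refine Real.sqrt_le_iff.2 ⟨by positivity, ?_⟩
  rw [mul_pow, Real.sq_sqrt (by positivity), norm_sq_pair x]
  have h1 : ‖A x.fst + (0 : X →L[ℂ] Y) x.snd‖ ≤ a * ‖x.fst‖ := by
    simpa using A.le_of_opNorm_le hA _
  have h2 : ‖C x.fst + D x.snd‖ ≤ c * ‖x.fst‖ + b * ‖x.snd‖ :=
    (norm_add_le _ _).trans (add_le_add (C.le_of_opNorm_le hC _) (D.le_of_opNorm_le hD _))
  have h3 := pow_le_pow_left₀ (norm_nonneg _) h1 2
  have h4 := pow_le_pow_left₀ (norm_nonneg _) h2 2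
  -- With x, y the norms of the components, (a² + c² + b²)(x² + y²) − (ax)² − (cx + by)² = (cy −
  -- bx)² + (ay)².
  nlinarith [sq_nonneg (c * ‖x.snd‖ - b * ‖x.fst‖), sq_nonneg (a * ‖x.snd‖)]

theorem norm_blockOp_diag_le (A D : X →L[ℂ] Y) {a b : ℝ} (hA : ‖A‖ ≤ a) (hD : ‖D‖ ≤ b) :
    ‖blockOp A 0 0 D‖ ≤ max a b := by
  have h0 : 0 ≤ max a b := ((norm_nonneg A).trans hA).trans (le_max_left a b)
  refine ContinuousLinearMap.opNorm_le_bound _ h0 fun x => ?_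
  rw [norm_pair (blockOp A 0 0 D x), blockOp_fst, blockOp_snd]
  refine Real.sqrt_le_iff.2 ⟨by positivity, ?_⟩
  rw [mul_pow, norm_sq_pair x, mul_add, ← mul_pow, ← mul_pow]
  simp only [zero_apply, add_zero, zero_add]
  gcongr
  · exact A.le_of_opNorm_le (hA.trans (le_max_left a b)) _
  · exact D.le_of_opNorm_le (hD.trans (le_max_right a b)) _

theorem norm_blockOp_corner_le (C : X →L[ℂ] Y) {c : ℝ} (hC : ‖C‖ ≤ c) :
    ‖blockOp 0 0 C 0‖ ≤ c := by
  have h0 := (norm_nonneg C).trans hC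
  refine ContinuousLinearMap.opNorm_le_bound _ h0 fun x => ?_
  rw [norm_pair (blockOp 0 0 C 0 x), blockOp_fst, blockOp_snd]
  refine Real.sqrt_le_iff.2 ⟨by positivity, ?_⟩
  rw [mul_pow, norm_sq_pair x]
  simp only [zero_apply, add_zero, norm_zero]
  have h := pow_le_pow_left₀ (norm_nonneg _) (C.le_of_opNorm_le hC x.fst) 2
  nlinarith [mul_nonneg (sq_nonneg c) (sq_nonneg ‖x.snd‖)]

/-- The two entries of the minimum in φ are two independent estimates: diagonal part plus
off-diagonal part, and the Frobenius bound of the matrix of norms. -/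
theorem norm_blockOp_lower_le_phi (A C D : X →L[ℂ] Y) {a c b : ℝ} (hA : ‖A‖ ≤ a) (hC : ‖C‖ ≤ c)
    (hD : ‖D‖ ≤ b) : ‖blockOp A 0 C D‖ ≤ phi a 0 c b := by
  refine le_min ?_ ?_
  · have e : blockOp A 0 C D = blockOp A 0 0 D + blockOp 0 0 C 0 := by
      ext x
      refine pair_ext ?_ ?_ <;>
        simp only [add_apply, WithLp.add_fst, WithLp.add_snd, blockOp_fst,
          blockOp_snd, zero_apply, add_zero, zero_add]
      exact add_comm _ _
    rw [e]
    have h1 := norm_blockOp_diag_le A D hA hD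
    have h2 := (norm_blockOp_corner_le C hC).trans (le_max_right 0 c)
    exact (ContinuousLinearMap.opNorm_add_le _ _).trans (add_le_add h1 h2)
  · refine (norm_blockOp_lower_le_sqrt A C D hA hC hD).trans (le_of_eq ?_)
    congr 1
    ring

end Blocks

/-! ### Formal adjoints -/

section Adjoint

variable {α : Type*} [MeasurableSpace α] {μ : Measure α}

theorem memLp_conj {p : ℝ≥0∞} {φ : α → ℂ} (hφ : MemLp φ p μ) :
    MemLp (fun x => starRingEnd ℂ (φ x)) p μ :=
  hφ.star

theorem inner_mulOp (φ ψ : α → ℂ) (hφ : MemLp φ ∞ μ) (hψ : MemLp ψ ∞ μ)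
    (h : ψ =ᵐ[μ] fun x => starRingEnd ℂ (φ x)) (f g : Lp ℂ 2 μ) :
    inner ℂ (mulOp φ hφ f) g = inner ℂ f (mulOp ψ hψ g) := by
  rw [L2.inner_def, L2.inner_def]
  refine integral_congr_ae ?_
  filter_upwards [mulOp_coe φ hφ f, mulOp_coe ψ hψ g, h] with x h1 h2 h3
  rw [h1, h2, h3]
  simp only [RCLike.inner_apply, map_mul]
  ring

theorem norm_mulOp_apply_eq (φ ψ : α → ℂ) (hφ : MemLp φ ∞ μ) (hψ : MemLp ψ ∞ μ)
    (h : ∀ᵐ x ∂μ, ‖φ x‖ = ‖ψ x‖) (f : Lp ℂ 2 μ) : ‖mulOp φ hφ f‖ = ‖mulOp ψ hψ f‖ := by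
  rw [Lp.norm_def, Lp.norm_def]
  congr 1
  refine eLpNorm_congr_norm_ae ?_
  filter_upwards [mulOp_coe φ hφ f, mulOp_coe ψ hψ f, h] with x h1 h2 h3
  rw [h1, h2, norm_mul, norm_mul, h3]

theorem norm_mulOp_apply_le (φ : α → ℂ) (hφ : MemLp φ ∞ μ) {C : ℝ} (h : ∀ᵐ x ∂μ, ‖φ x‖ ≤ C)
    (f : Lp ℂ 2 μ) : ‖mulOp φ hφ f‖ ≤ C * ‖f‖ := by
  refine Lp.norm_le_mul_norm_of_ae_le_mul ?_
  filter_upwards [mulOp_coe φ hφ f, h] with x h1 h2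
  rw [h1, norm_mul]
  gcongr

/-- `S` is a formal adjoint of `T`. -/
def AdjointPair (T S : L2D4 →L[ℂ] L2D4) : Prop :=
  ∀ u v : L2D4, inner ℂ (T u : L2Plane) (v : L2Plane) = inner ℂ (u : L2Plane) (S v : L2Plane)

theorem AdjointPair.comp {T S T' S' : L2D4 →L[ℂ] L2D4} (h : AdjointPair T S)
    (h' : AdjointPair T' S') : AdjointPair (T ∘L T') (S' ∘L S) := fun u v =>
  (h (T' u) v).trans (h' u (S v))

theorem AdjointPair.sub {T S T' S' : L2D4 →L[ℂ] L2D4} (h : AdjointPair T S)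
    (h' : AdjointPair T' S') : AdjointPair (T - T') (S - S') := fun u v => by
  have e1 : (((T - T') u : L2D4) : L2Plane) = (T u : L2Plane) - (T' u : L2Plane) := rfl
  have e2 : (((S - S') v : L2D4) : L2Plane) = (S v : L2Plane) - (S' v : L2Plane) := rfl
  rw [e1, e2, inner_sub_left, inner_sub_right, h, h']

/-- ‖Tu‖² = ⟨u, STu⟩ ≤ ‖u‖ ‖S‖ ‖Tu‖, and one factor ‖Tu‖ cancels. -/
theorem AdjointPair.norm_le {T S : L2D4 →L[ℂ] L2D4} (h : AdjointPair T S) : ‖T‖ ≤ ‖S‖ := by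
  refine T.opNorm_le_bound (ContinuousLinearMap.opNorm_nonneg _) fun u => ?_
  have key : ∀ t x y s : ℝ, 0 ≤ t → 0 ≤ x → 0 ≤ s → t * t ≤ x * y → y ≤ s * t → t ≤ s * x := by
    intro t x y s ht hx hs h1 h2
    rcases ht.eq_or_lt with h0 | h0
    · rw [← h0]; positivity
    · refine le_of_mul_le_mul_right ?_ h0
      nlinarith [mul_le_mul_of_nonneg_left h2 hx]
  have h1 : ‖(T u : L2Plane)‖ * ‖(T u : L2Plane)‖ ≤ ‖(u : L2Plane)‖ * ‖(S (T u) : L2Plane)‖ := by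
    have h2 : ‖(T u : L2Plane)‖ * ‖(T u : L2Plane)‖ =
        ‖inner ℂ (T u : L2Plane) (T u : L2Plane)‖ := by
      rw [inner_self_eq_norm_sq_to_K, norm_pow, RCLike.norm_ofReal, abs_norm, sq]
    rw [h2, h u (T u)]
    exact norm_inner_le_norm _ _
  exact key _ _ _ _ (norm_nonneg _) (norm_nonneg _) S.opNorm_nonneg h1 (S.le_opNorm (T u))

theorem adjointPair_mulD4 (φ ψ : Plane → ℂ) (hφ : MemLp φ ∞ volume) (hφs) (hψ : MemLp ψ ∞ volume)
    (hψs) (h : ψ =ᵐ[volume] fun x => starRingEnd ℂ (φ x)) :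
    AdjointPair (mulD4 φ hφ hφs) (mulD4 ψ hψ hψs) := fun u v => inner_mulOp φ ψ hφ hψ h u v

theorem adjointPair_indD4 (S : Set Plane) (hS : MeasurableSet S)
    (hs : ∀ i x, d4Gen i x ∈ S ↔ x ∈ S) : AdjointPair (indD4 S hS hs) (indD4 S hS hs) := by
  refine adjointPair_mulD4 _ _ _ _ _ _ (Filter.Eventually.of_forall fun x => ?_)
  by_cases h : x ∈ S <;> simp [h]

/-- By Plancherel the operator is unitarily equivalent to multiplication by its symbol, here real.
-/
theorem adjointPair_fourierMultD4 (m : Plane → ℂ) (hm : MemLp m ∞ volume) (hs)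
    (h : ∀ ξ, starRingEnd ℂ (m ξ) = m ξ) :
    AdjointPair (fourierMultD4 m hm hs) (fourierMultD4 m hm hs) := fun u v => by
  have e : ∀ w : L2D4, Lp.fourierTransformₗᵢ Plane ℂ (fourierMultD4 m hm hs w : L2Plane) =
      mulOp m hm (Lp.fourierTransformₗᵢ Plane ℂ (w : L2Plane)) := fun w =>
    (Lp.fourierTransformₗᵢ Plane ℂ).apply_symm_apply _
  rw [← (Lp.fourierTransformₗᵢ Plane ℂ).inner_map_map, e,
    ← (Lp.fourierTransformₗᵢ Plane ℂ).inner_map_map (u : L2Plane), e]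
  exact inner_mulOp m m hm hm (Filter.Eventually.of_forall fun ξ => (h ξ).symm) _ _

/-- Moving γ† across the inner product produces the factor |Ω₀|, and moving γ back absorbs it. -/
theorem adjointPair_GamDag (P : Params) (K K' : Ell2 →L[ℂ] Ell2)
    (h : ∀ U V, inner ℂ (K U) V = inner ℂ U (K' V)) : AdjointPair (GamDag P K) (GamDag P K') :=
  fun u v => by
    refine (inner_gamDag_left P (K (gam P u)) v).trans ?_
    rw [h]
    exact (inner_gamDag_right P (K' (gam P v)) u).symm

theorem symb11_conj (P : Params) (ξ : Plane) : starRingEnd ℂ (symb11 P ξ) = symb11 P ξ := by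
  simp [symb11]

theorem symb22_conj (P : Params) (ξ : Plane) : starRingEnd ℂ (symb22 P ξ) = symb22 P ξ := by
  simp [symb22]

theorem adjointPair_L11inv (P : Params) : AdjointPair (L11inv P) (L11inv P) :=
  adjointPair_fourierMultD4 _ _ _ (symb11_conj P)

theorem adjointPair_L22inv (P : Params) : AdjointPair (L22inv P) (L22inv P) :=
  adjointPair_fourierMultD4 _ _ _ (symb22_conj P)

theorem adjointPair_L21 (P : Params) : AdjointPair (L21 P) (L21 P) := fun u v => by
  have e : ∀ w : L2D4, (L21 P w : L2Plane) = ((P.lam2 * P.lam1 - 1 : ℝ) : ℂ) • (w : L2Plane) :=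
    fun _ => rfl
  rw [e, e, inner_smul_left, inner_smul_right, Complex.conj_ofReal]

theorem fourier_injD4 {u v : L2D4} (h : ((𝓕 (u : L2Plane) : L2Plane) : Plane → ℂ) =ᵐ[volume]
    (𝓕 (v : L2Plane) : L2Plane)) : u = v :=
  Subtype.ext ((Lp.fourierTransformₗᵢ Plane ℂ).injective (Lp.ext h))

theorem L11inv_L22inv_comm (P : Params) (u : L2D4) :
    L11inv P (L22inv P u) = L22inv P (L11inv P u) := by
  refine fourier_injD4 ?_
  filter_upwards [fourier_L11inv P u, fourier_L22inv P u, fourier_L11inv P (L22inv P u),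
    fourier_L22inv P (L11inv P u)] with ξ h1 h2 h3 h4
  rw [h3, h4, h1, h2]
  ring

/-- The adjoint of a product comes with the factors reversed; since Fourier multipliers commute, it
is the original product again. -/
theorem L3_symm (P : Params) : L11inv P ∘L L21 P ∘L L22inv P = L3 P := by
  ext1 u
  have e : ∀ w : L2D4, L21 P w = ((P.lam2 * P.lam1 - 1 : ℝ) : ℂ) • w := fun _ => rfl
  simp only [L3, ContinuousLinearMap.comp_apply, e, map_smul, L11inv_L22inv_comm]

theorem adjointPair_L3 (P : Params) : AdjointPair (L3 P) (L3 P) := by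
  have h := (adjointPair_L22inv P).comp ((adjointPair_L21 P).comp (adjointPair_L11inv P))
  have e : (L11inv P ∘L L21 P) ∘L L22inv P = L3 P := L3_symm P
  rwa [e] at h

theorem inner_diagSeq (m : Jred → ℂ) (hm) (h : ∀ n, starRingEnd ℂ (m n) = m n) (U V : Ell2) :
    inner ℂ (diagSeq m hm U) V = inner ℂ U (diagSeq m hm V) :=
  inner_mulOp m m _ _ (Filter.Eventually.of_forall fun n => (h n).symm) U V

theorem diagSeq_apply (m : Jred → ℂ) (hm) (U : Ell2) (n : Jred) :
    diagSeq m hm U n = m n * U n := weight_ext (mulOp_coe m _ U) n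

theorem diagSeq_comm (m m' : Jred → ℂ) (hm hm') (U : Ell2) :
    diagSeq m hm (diagSeq m' hm' U) = diagSeq m' hm' (diagSeq m hm U) :=
  Lp.ext (Filter.Eventually.of_forall fun n => by
    rw [diagSeq_apply, diagSeq_apply, diagSeq_apply, diagSeq_apply, mul_left_comm])

theorem inner_seqL3 (P : Params) (U V : Ell2) :
    inner ℂ (seqL3 P U) V = inner ℂ U (seqL3 P V) := by
  -- The order is reversed in advance, since the factors are moved across the inner product one at a
  -- time.
  have h : seqL22inv P (seqL21 P (seqL11inv P V)) = seqL11inv P (seqL21 P (seqL22inv P V)) := by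
    unfold seqL22inv seqL21 seqL11inv
    rw [diagSeq_comm (fun n => (l21 P (freq P n) : ℂ)), diagSeq_comm (fun n => symb22 P (freq P n)),
      diagSeq_comm (fun n => symb22 P (freq P n))]
  simp only [seqL3, ContinuousLinearMap.comp_apply]
  rw [h]
  refine (inner_diagSeq _ _ (fun n => symb22_conj P _) _ _).trans ?_
  refine (inner_diagSeq _ _ (fun n => Complex.conj_ofReal _) _ _).trans ?_
  exact inner_diagSeq _ _ (fun n => symb11_conj P _) _ _

theorem adjointPair_GamDag_seqL11inv (P : Params) :
    AdjointPair (GamDag P (seqL11inv P)) (GamDag P (seqL11inv P)) :=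
  adjointPair_GamDag P _ _ (inner_diagSeq _ _ fun _ => symb11_conj P _)

theorem adjointPair_GamDag_seqL22inv (P : Params) :
    AdjointPair (GamDag P (seqL22inv P)) (GamDag P (seqL22inv P)) :=
  adjointPair_GamDag P _ _ (inner_diagSeq _ _ fun _ => symb22_conj P _)

theorem adjointPair_GamDag_seqL3 (P : Params) :
    AdjointPair (GamDag P (seqL3 P)) (GamDag P (seqL3 P)) :=
  adjointPair_GamDag P _ _ (inner_seqL3 P)

/-- If `T` and `χ` are formally self-adjoint, multiplication by `φ` can be moved from one side of
`T χ` to the other, at no cost in the operator norm. -/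
theorem norm_mulD4_comp_le (φ : Plane → ℂ) (hφ : MemLp φ ∞ volume) (hφs)
    {T χ : L2D4 →L[ℂ] L2D4} (hT : AdjointPair T T) (hχ : AdjointPair χ χ) :
    ‖mulD4 φ hφ hφs ∘L T ∘L χ‖ ≤ ‖χ ∘L T ∘L mulD4 φ hφ hφs‖ := by
  have hψs : ∀ i, (fun x => (fun x => starRingEnd ℂ (φ x)) (d4Gen i x)) =ᵐ[volume]
      fun x => starRingEnd ℂ (φ x) := fun i => by
    filter_upwards [hφs i] with x hx
    exact congrArg _ hx
  -- As the outermost factor, φ may be replaced by its conjugate: the output keeps its modulus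
  -- pointwise. The new operator has the desired right-hand one as its formal adjoint.
  have h1 : ‖mulD4 φ hφ hφs ∘L T ∘L χ‖ ≤ ‖mulD4 _ (memLp_conj hφ) hψs ∘L T ∘L χ‖ := by
    refine ContinuousLinearMap.opNorm_le_bound _ (ContinuousLinearMap.opNorm_nonneg _) fun u => ?_
    refine le_trans (le_of_eq ?_) (ContinuousLinearMap.le_opNorm _ u)
    exact norm_mulOp_apply_eq φ _ hφ (memLp_conj hφ)
      (Filter.Eventually.of_forall fun x => (RCLike.norm_conj _).symm) _
  refine h1.trans ?_
  have h2 : AdjointPair (mulD4 _ (memLp_conj hφ) hψs) (mulD4 φ hφ hφs) :=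
    adjointPair_mulD4 _ _ _ _ _ _ (Filter.Eventually.of_forall fun x =>
      (Complex.conj_conj (φ x)).symm)
  exact (h2.comp (hT.comp hχ)).norm_le

end Adjoint

/-! ### The operators `D𝔾^N(u₀) 𝕃⁻¹` inside and outside `Ω₀` -/

theorem gamDag_eq_zero_outside (P : Params) (U : Ell2) :
    ∀ᵐ x, x ∉ Omega P → (gamDag P U : L2Plane) x = 0 := by
  have h := indIn_coe P (gamDag P U)
  rw [indIn_gamDag] at h
  filter_upwards [h] with x h hx
  rw [h, Set.indicator_of_notMem hx]

theorem mulD4_coe (φ : Plane → ℂ) (hφ : MemLp φ ∞ volume) (hφs) (u : L2D4) :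
    ((mulD4 φ hφ hφs u : L2Plane) : Plane → ℂ) =ᵐ[volume] fun x => φ x * (u : L2Plane) x :=
  mulOp_coe φ hφ u

theorem indIn_mulD4 (P : Params) (φ : Plane → ℂ) (hφ : MemLp φ ∞ volume) (hφs)
    (h : ∀ᵐ x, x ∉ Omega P → φ x = 0) (u : L2D4) :
    indIn P (mulD4 φ hφ hφs u) = mulD4 φ hφ hφs u := by
  refine Subtype.ext (Lp.ext ?_)
  filter_upwards [h, mulD4_coe φ hφ hφs u, indIn_coe P (mulD4 φ hφ hφs u)] with x h1 h2 h3
  rw [h3]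
  by_cases hx : x ∈ Omega P
  · rw [Set.indicator_of_mem hx]
  · rw [Set.indicator_of_notMem hx, h2, h1 hx, zero_mul]

theorem mulD4_indIn (P : Params) (φ : Plane → ℂ) (hφ : MemLp φ ∞ volume) (hφs)
    (h : ∀ᵐ x, x ∉ Omega P → φ x = 0) (u : L2D4) :
    mulD4 φ hφ hφs (indIn P u) = mulD4 φ hφ hφs u := by
  refine Subtype.ext (Lp.ext ?_)
  filter_upwards [h, mulD4_coe φ hφ hφs u, mulD4_coe φ hφ hφs (indIn P u), indIn_coe P u]
    with x h1 h2 h3 h4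
  rw [h2, h3, h4]
  by_cases hx : x ∈ Omega P
  · rw [Set.indicator_of_mem hx]
  · rw [h1 hx, zero_mul, zero_mul]

theorem indIn_mulTrunc (P : Params) (M : ℕ) (U : Jred → ℂ) (u : L2D4) :
    indIn P (mulTrunc P M U u) = mulTrunc P M U u :=
  indIn_mulD4 P _ _ _ (gamDag_eq_zero_outside P (truncEll2 M U)) u

theorem mulTrunc_indIn (P : Params) (M : ℕ) (U : Jred → ℂ) (u : L2D4) :
    mulTrunc P M U (indIn P u) = mulTrunc P M U u :=
  mulD4_indIn P _ _ _ (gamDag_eq_zero_outside P (truncEll2 M U)) u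

theorem norm_mulTrunc_comp_le (P : Params) (M : ℕ) (U : Jred → ℂ) {T χ : L2D4 →L[ℂ] L2D4}
    (hT : AdjointPair T T) (hχ : AdjointPair χ χ) :
    ‖mulTrunc P M U ∘L T ∘L χ‖ ≤ ‖χ ∘L T ∘L mulTrunc P M U‖ :=
  norm_mulD4_comp_le _ _ _ hT hχ

/-- Conjugation by γ and γ† only adds a cutoff to Ω₀ on each side, and a multiplier supported in Ω₀
absorbs both. -/
theorem GamDag_convTrunc (P : Params) (M : ℕ) (U : Jred → ℂ) :
    GamDag P (convTrunc P M U) = mulTrunc P M U := by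
  ext1 u
  have h : GamDag P (convTrunc P M U) u =
    gamDag P (gam P (mulTrunc P M U (gamDag P (gam P u)))) := rfl
  rw [h, gamDag_gam, gamDag_gam, mulTrunc_indIn, indIn_mulTrunc]

/-! ### Algebra of block operators and norms of a row times a lower triangular block. -/

section

variable {X Y Z : Type*} [NormedAddCommGroup X] [InnerProductSpace ℂ X]
  [NormedAddCommGroup Y] [InnerProductSpace ℂ Y] [NormedAddCommGroup Z] [InnerProductSpace ℂ Z]

theorem diagOp_comp_blockOp_comp_diagOp (G : Y →L[ℂ] Z) (A B C D : Y →L[ℂ] Y) (F : X →L[ℂ] Y) :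
    diagOp G ∘L blockOp A B C D ∘L diagOp F =
      blockOp (G ∘L A ∘L F) (G ∘L B ∘L F) (G ∘L C ∘L F) (G ∘L D ∘L F) := by
  ext1 x
  refine pair_ext ?_ ?_ <;> simp [diagOp, blockOp_fst, blockOp_snd]

theorem comp_zero_comp (G : Y →L[ℂ] Z) (F : X →L[ℂ] Y) : G ∘L (0 : Y →L[ℂ] Y) ∘L F = 0 := by
  simp

theorem comp_neg_comp (G : Y →L[ℂ] Z) (K : Y →L[ℂ] Y) (F : X →L[ℂ] Y) :
    G ∘L (-K) ∘L F = -(G ∘L K ∘L F) := by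
  simp

theorem blockOp_congr {A B C D A' B' C' D' : X →L[ℂ] Y} (hA : A = A') (hB : B = B') (hC : C = C')
    (hD : D = D') : blockOp A B C D = blockOp A' B' C' D' := by
  rw [hA, hB, hC, hD]

theorem norm_comp_comp_le_of_eq {R R' S S' T : X →L[ℂ] X} (hR : R = R') (hS : S = S') {c : ℝ}
    (h : ‖R' ∘L S' ∘L T‖ ≤ c) : ‖R ∘L S ∘L T‖ ≤ c := by
  rwa [hR, hS]

theorem sub_congr_right {R S S' : X →L[ℂ] X} (h : S = S') : S - R = S' - R := by
  rw [h]

theorem row_comp_lower_comp_diag (A B A' C' D' E : X →L[ℂ] X) :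
    blockOp A B 0 0 ∘L blockOp A' 0 C' D' ∘L diagOp E =
      blockOp (A ∘L A' ∘L E + B ∘L C' ∘L E) (B ∘L D' ∘L E) 0 0 := by
  ext1 x
  refine pair_ext ?_ ?_ <;> simp [diagOp, blockOp_fst, blockOp_snd, add_assoc]

/-- The sign is pulled out so that the entries become 𝕃 minus Γ†(L), the order used in the
hypotheses; norms do not see it. -/
theorem lower_sub_lower (A C D A' C' D' : X →L[ℂ] X) :
    blockOp A 0 (-C) D - blockOp A' 0 (-C') D' =
      -blockOp (A' - A) 0 (-(C' - C)) (D' - D) := by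
  ext1 x
  refine pair_ext (by simp [blockOp_fst]) ?_
  simp only [sub_apply, neg_apply, WithLp.sub_snd, WithLp.neg_snd, blockOp_snd]
  abel

/-- In the product row the first entry is M₁T₁χ − M₂T₃χ, whose bounds add up to a + c, and the
second is M₂T₂χ. Cauchy–Schwarz over the two columns gives the root. -/
theorem norm_row_comp_lower_le {M1 M2 T1 T2 T3 χ : X →L[ℂ] X} {a b c : ℝ}
    (ha : ‖M1 ∘L T1 ∘L χ‖ ≤ a) (hb : ‖M2 ∘L T2 ∘L χ‖ ≤ b) (hc : ‖M2 ∘L T3 ∘L χ‖ ≤ c) :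
    ‖blockOp M1 M2 0 0 ∘L blockOp T1 0 (-T3) T2 ∘L diagOp χ‖ ≤ Real.sqrt ((a + c) ^ 2 + b ^ 2) := by
  rw [row_comp_lower_comp_diag]
  refine norm_blockOp_row_le _ _ ?_ hb
  rw [comp_neg_comp, ← sub_eq_add_neg]
  exact (norm_sub_le _ _).trans (add_le_add ha hc)

theorem norm_row_comp_lower_sub_lower_le {M1 M2 T1 T2 T3 S1 S2 S3 χ : X →L[ℂ] X} {a b c : ℝ}
    (ha : ‖M1 ∘L (T1 - S1) ∘L χ‖ ≤ a) (hb : ‖M2 ∘L (T2 - S2) ∘L χ‖ ≤ b)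
    (hc : ‖M2 ∘L (T3 - S3) ∘L χ‖ ≤ c) :
    ‖blockOp M1 M2 0 0 ∘L (blockOp S1 0 (-S3) S2 - blockOp T1 0 (-T3) T2) ∘L diagOp χ‖ ≤
      Real.sqrt ((a + c) ^ 2 + b ^ 2) := by
  rw [lower_sub_lower, comp_neg_comp, ContinuousLinearMap.opNorm_neg]
  exact norm_row_comp_lower_le ha hb hc

end

theorem GamDagPair_blockOp (P : Params) (A B C D : Ell2 →L[ℂ] Ell2) :
    GamDagPair P (blockOp A B C D) =
      blockOp (GamDag P A) (GamDag P B) (GamDag P C) (GamDag P D) :=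
  diagOp_comp_blockOp_comp_diagOp (gamDag P) A B C D (gam P)

theorem GamDag_zero (P : Params) : GamDag P 0 = 0 := comp_zero_comp (gamDag P) (gam P)

theorem GamDag_neg (P : Params) (K : Ell2 →L[ℂ] Ell2) : GamDag P (-K) = -GamDag P K :=
  comp_neg_comp (gamDag P) K (gam P)

theorem DGNfull_eq (P : Params) (N : ℕ) (U₀ : Ell2Pair) :
    DGNfull P N U₀ = blockOp (mulV1N P N U₀) (mulV2N P N U₀) 0 0 :=
  (GamDagPair_blockOp P _ _ _ _).trans (blockOp_congr (GamDag_convTrunc P _ _)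
    (GamDag_convTrunc P _ _) (GamDag_zero P) (GamDag_zero P))

theorem GamDagPair_seqLinv (P : Params) : GamDagPair P (seqLinv P) =
    blockOp (GamDag P (seqL11inv P)) 0 (-GamDag P (seqL3 P)) (GamDag P (seqL22inv P)) :=
  (GamDagPair_blockOp P _ _ _ _).trans
    (blockOp_congr rfl (GamDag_zero P) (GamDag_neg P _) rfl)

theorem norm_DGNfull_outside_le (P : Params) (N : ℕ) (U₀ : Ell2Pair) {a b c : ℝ}
    (ha : ‖indOut P ∘L L11inv P ∘L mulV1N P N U₀‖ ≤ a)
    (hb : ‖indOut P ∘L L22inv P ∘L mulV2N P N U₀‖ ≤ b)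
    (hc : ‖indOut P ∘L L3 P ∘L mulV2N P N U₀‖ ≤ c) :
    ‖DGNfull P N U₀ ∘L LinvL2 P ∘L diagOp (indOut P)‖ ≤ Real.sqrt ((a + c) ^ 2 + b ^ 2) := by
  have hχ : AdjointPair (indOut P) (indOut P) := adjointPair_indD4 _ _ _
  refine norm_comp_comp_le_of_eq (DGNfull_eq P N U₀) (rfl : LinvL2 P = _) (norm_row_comp_lower_le
    ((norm_mulTrunc_comp_le P _ _ (adjointPair_L11inv P) hχ).trans ha)
    ((norm_mulTrunc_comp_le P _ _ (adjointPair_L22inv P) hχ).trans hb)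
    ((norm_mulTrunc_comp_le P _ _ (adjointPair_L3 P) hχ).trans hc))

theorem norm_DGNfull_inside_le (P : Params) (N : ℕ) (U₀ : Ell2Pair) {a b c : ℝ}
    (ha : ‖indIn P ∘L (L11inv P - GamDag P (seqL11inv P)) ∘L mulV1N P N U₀‖ ≤ a)
    (hb : ‖indIn P ∘L (L22inv P - GamDag P (seqL22inv P)) ∘L mulV2N P N U₀‖ ≤ b)
    (hc : ‖indIn P ∘L (L3 P - GamDag P (seqL3 P)) ∘L mulV2N P N U₀‖ ≤ c) :
    ‖DGNfull P N U₀ ∘L (GamDagPair P (seqLinv P) - LinvL2 P) ∘L diagOp (indIn P)‖ ≤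
      Real.sqrt ((a + c) ^ 2 + b ^ 2) := by
  have hχ : AdjointPair (indIn P) (indIn P) := adjointPair_indD4 _ _ _
  refine norm_comp_comp_le_of_eq (DGNfull_eq P N U₀)
    (sub_congr_right (GamDagPair_seqLinv P)) (norm_row_comp_lower_sub_lower_le
    ((norm_mulTrunc_comp_le P _ _
      ((adjointPair_L11inv P).sub (adjointPair_GamDag_seqL11inv P)) hχ).trans ha)
    ((norm_mulTrunc_comp_le P _ _
      ((adjointPair_L22inv P).sub (adjointPair_GamDag_seqL22inv P)) hχ).trans hb)
    ((norm_mulTrunc_comp_le P _ _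
      ((adjointPair_L3 P).sub (adjointPair_GamDag_seqL3 P)) hχ).trans hc))

/-! ### The embedding of `ℋ_{D₄}` in the bounded functions -/

/-- Completeness is required by the closed graph argument below. -/
instance : CompleteSpace L2D4 := isClosed_L2D4.completeSpace_coe

theorem ae_norm_le_norm_top {α : Type*} [MeasurableSpace α] {μ : Measure α} (f : Lp ℂ ∞ μ) :
    ∀ᵐ x ∂μ, ‖f x‖ ≤ ‖f‖ := by
  have h : eLpNorm f ∞ μ ≠ ∞ := Lp.eLpNorm_ne_top f
  rw [eLpNorm_exponent_top] at h
  filter_upwards [ae_le_eLpNormEssSup (f := f) (μ := μ)] with x hx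
  rw [Lp.norm_def, eLpNorm_exponent_top, ← toReal_enorm]
  exact ENNReal.toReal_mono h hx

/-- A bounded operator into `L²` whose values are all bounded functions is bounded into `L^∞`. -/
theorem exists_ae_norm_le_of_memLp_top {α E : Type*} [MeasurableSpace α] {μ : Measure α}
    [NormedAddCommGroup E] [NormedSpace ℂ E] [CompleteSpace E] (S : E →L[ℂ] Lp ℂ 2 μ)
    (hS : ∀ f, MemLp (S f) ∞ μ) : ∃ C, 0 ≤ C ∧ ∀ f, ∀ᵐ x ∂μ, ‖S f x‖ ≤ C * ‖f‖ := by
  let T : E →ₗ[ℂ] Lp ℂ ∞ μ :=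
    { toFun := fun f => (hS f).toLp
      map_add' := fun f g => by
        rw [← MemLp.toLp_add]
        refine MemLp.toLp_congr _ _ ?_
        rw [map_add]
        exact Lp.coeFn_add _ _
      map_smul' := fun c f => by
        rw [RingHom.id_apply, ← MemLp.toLp_const_smul]
        refine MemLp.toLp_congr _ _ ?_
        rw [map_smul]
        exact Lp.coeFn_smul _ _ }
  -- Closed graph theorem: convergence in L² and in L^∞ both imply convergence in measure, whose
  -- limits are unique almost everywhere.
  have hT : Continuous T := by
    refine LinearMap.continuous_of_seq_closed_graph T fun u x y hu hy => Lp.ext ?_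
    have h1 : TendstoInMeasure μ (fun n => (S (u n) : α → ℂ)) Filter.atTop (S x) :=
      tendstoInMeasure_of_tendsto_Lp ((S.continuous.tendsto x).comp hu)
    have h2 : TendstoInMeasure μ (fun n => (T (u n) : α → ℂ)) Filter.atTop y :=
      tendstoInMeasure_of_tendsto_Lp hy
    have h3 : TendstoInMeasure μ (fun n => (S (u n) : α → ℂ)) Filter.atTop y :=
      h2.congr_left fun n => (hS (u n)).coeFn_toLp
    exact (tendstoInMeasure_ae_unique h3 h1).trans (hS x).coeFn_toLp.symm
  let T' : E →L[ℂ] Lp ℂ ∞ μ := ⟨T, hT⟩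
  refine ⟨‖T'‖, norm_nonneg _, fun f => ?_⟩
  have h1 : ‖T' f‖ ≤ ‖T'‖ * ‖f‖ := T'.le_opNorm f
  filter_upwards [(hS f).coeFn_toLp, ae_norm_le_norm_top (T' f)] with x h2 h3
  rw [← h2]
  exact h3.trans h1

/-- The inclusion of `ℋ_{D₄}` in `L²_{D₄}` is bounded. -/
def inclL (P : Params) : HSpace P →L[ℂ] L2Pair :=
  LinvL2 P ∘L (Liso P).toContinuousLinearEquiv.toContinuousLinearMap

theorem inclL_apply (P : Params) (u : HSpace P) : inclL P u = HSpace.incl P u := by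
  have h := incl_Liso_symm P (Liso P u)
  rw [LinearIsometryEquiv.symm_apply_apply] at h
  exact h.symm

/-- The closed graph argument is applied to the components of 𝕃⁻¹ on the complete space L²_{D₄}, and
‖𝕃u‖ = ‖u‖ brings the bound back to ℋ. -/
theorem exists_ae_norm_le (P : Params) : ∃ C, 0 ≤ C ∧ ∀ u : HSpace P,
    (∀ᵐ x, ‖((HSpace.incl P u).fst : L2Plane) x‖ ≤ C * ‖u‖) ∧
    ∀ᵐ x, ‖((HSpace.incl P u).snd : L2Plane) x‖ ≤ C * ‖u‖ := by
  let π₁ : L2Pair →L[ℂ] L2D4 := WithLp.fstL 2 ℂ L2D4 L2D4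
  let π₂ : L2Pair →L[ℂ] L2D4 := WithLp.sndL 2 ℂ L2D4 L2D4
  obtain ⟨C₁, h₁, H₁⟩ := exists_ae_norm_le_of_memLp_top (L2D4.subtypeL ∘L π₁ ∘L LinvL2 P)
    fun f => memLp_top_fst P (LinvL2 P f) (LinvL2_mem P f)
  obtain ⟨C₂, h₂, H₂⟩ := exists_ae_norm_le_of_memLp_top (L2D4.subtypeL ∘L π₂ ∘L LinvL2 P)
    fun f => memLp_top_snd P (LinvL2 P f) (LinvL2_mem P f)
  refine ⟨max C₁ C₂, h₁.trans (le_max_left _ _), fun u => ?_⟩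
  have hn : ‖Liso P u‖ = ‖u‖ := (Liso P).norm_map u
  rw [← inclL_apply]
  constructor
  · filter_upwards [H₁ (Liso P u)] with x hx
    rw [hn] at hx
    exact hx.trans (mul_le_mul_of_nonneg_right (le_max_left _ _) (norm_nonneg u))
  · filter_upwards [H₂ (Liso P u)] with x hx
    rw [hn] at hx
    exact hx.trans (mul_le_mul_of_nonneg_right (le_max_right _ _) (norm_nonneg u))

/-! ### The Fréchet derivative of the nonlinearity -/

theorem memLp_top_v1 (P : Params) (u : L2Pair) (hu : u ∈ HD4 P) : MemLp (v1 P u) ∞ volume := by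
  have h1 := memLp_top_fst P u hu
  have h2 := memLp_top_snd P u hu
  have h3 := (MemLp.mul (p := ∞) (q := ∞) (r := ∞) h1 h2).const_mul 2
  have h4 := (MemLp.mul (p := ∞) (q := ∞) (r := ∞) h1 h1).const_mul (3 * P.lam1 : ℂ)
  refine (memLp_congr_ae (Filter.Eventually.of_forall fun x => ?_)).1
    ((h3.add (h1.const_mul 2)).sub h4)
  simp only [v1, Pi.mul_apply, Pi.add_apply, Pi.sub_apply]
  ring

theorem memLp_top_v2 (P : Params) (u : L2Pair) (hu : u ∈ HD4 P) : MemLp (v2 u) ∞ volume := by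
  have h1 := memLp_top_fst P u hu
  refine (memLp_congr_ae (Filter.Eventually.of_forall fun x => ?_)).1
    (MemLp.mul (p := ∞) (q := ∞) (r := ∞) h1 h1)
  simp only [v2, Pi.mul_apply]
  ring

theorem v1_d4 (P : Params) (u : L2Pair) (i : Fin 3) :
    (fun x => v1 P u (d4Gen i x)) =ᵐ[volume] v1 P u := by
  filter_upwards [u.fst.2 i, u.snd.2 i] with x h1 h2
  simp only [v1, h1, h2]

theorem v2_d4 (u : L2Pair) (i : Fin 3) : (fun x => v2 u (d4Gen i x)) =ᵐ[volume] v2 u := by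
  filter_upwards [u.fst.2 i] with x h1
  simp only [v2, h1]

/-- The multiplication operator by `v₁`. -/
def mulV1 (P : Params) (u : L2Pair) (hu : u ∈ HD4 P) : L2D4 →L[ℂ] L2D4 :=
  mulD4 (v1 P u) (memLp_top_v1 P u hu) (v1_d4 P u)

/-- The multiplication operator by `v₂`. -/
def mulV2 (P : Params) (u : L2Pair) (hu : u ∈ HD4 P) : L2D4 →L[ℂ] L2D4 :=
  mulD4 (v2 u) (memLp_top_v2 P u hu) (v2_d4 u)

/-- The derivative of `𝔾` at `u`, as an operator on `L²_{D₄}`. -/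
def DGfull (P : Params) (u : L2Pair) (hu : u ∈ HD4 P) : L2Pair →L[ℂ] L2Pair :=
  blockOp (mulV1 P u hu) (mulV2 P u hu) 0 0

/-- The Taylor remainder is divisible by `h1`. That factor is kept aside, to be measured in L²,
while its cofactor is of order k and bounded pointwise. -/
theorem norm_cubic_remainder_le (lam U1 U2 h1 h2 : ℂ) (m k l : ℝ) (hm : 0 ≤ m) (hk : 0 ≤ k)
    (hl : ‖lam‖ ≤ l)
    (hU1 : ‖U1‖ ≤ m) (hU2 : ‖U2‖ ≤ m) (hh1 : ‖h1‖ ≤ k) (hh2 : ‖h2‖ ≤ k) :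
    ‖(U2 + h2 + 1 - lam * (U1 + h1)) * (U1 + h1) ^ 2 - (U2 + 1 - lam * U1) * U1 ^ 2 -
      ((2 * U2 * U1 + 2 * U1 - 3 * lam * U1 ^ 2) * h1 + U1 ^ 2 * h2)‖ ≤
    ((m + 1 + l * m) * k + (k + l * k) * (2 * m + k)) * ‖h1‖ := by
  have e : (U2 + h2 + 1 - lam * (U1 + h1)) * (U1 + h1) ^ 2 - (U2 + 1 - lam * U1) * U1 ^ 2 -
      ((2 * U2 * U1 + 2 * U1 - 3 * lam * U1 ^ 2) * h1 + U1 ^ 2 * h2) =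
      ((U2 + 1 - lam * U1) * h1 + (h2 - lam * h1) * (2 * U1 + h1)) * h1 := by ring
  have hl0 : 0 ≤ l := (norm_nonneg _).trans hl
  have a1 : ‖U2 + 1 - lam * U1‖ ≤ m + 1 + l * m := by
    refine (norm_sub_le _ _).trans (add_le_add ((norm_add_le _ _).trans ?_) ?_)
    · simpa using hU2
    · rw [norm_mul]; gcongr
  have a2 : ‖h2 - lam * h1‖ ≤ k + l * k := by
    refine (norm_sub_le _ _).trans (add_le_add hh2 ?_)
    rw [norm_mul]; gcongr
  have a3 : ‖2 * U1 + h1‖ ≤ 2 * m + k := by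
    refine (norm_add_le _ _).trans (add_le_add ?_ hh1)
    rw [norm_mul]
    simpa using hU1
  rw [e, norm_mul]
  refine mul_le_mul_of_nonneg_right ((norm_add_le _ _).trans ?_) (norm_nonneg _)
  rw [norm_mul, norm_mul]
  gcongr

theorem GMap_fst_coe (P : Params) (u : HSpace P) :
    (((GMap P u).fst : L2Plane) : Plane → ℂ) =ᵐ[volume] gFun P (HSpace.incl P u) :=
  (memLp_gFun P (HSpace.incl P u) (HSpace.incl_mem P u)).coeFn_toLp

theorem DGfull_fst_coe (P : Params) (u : L2Pair) (hu : u ∈ HD4 P) (h : L2Pair) :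
    (((DGfull P u hu h).fst : L2Plane) : Plane → ℂ) =ᵐ[volume]
      fun x => v1 P u x * (h.fst : L2Plane) x + v2 u x * (h.snd : L2Plane) x := by
  have e : ((DGfull P u hu h).fst : L2Plane) =
    (mulV1 P u hu h.fst : L2Plane) + (mulV2 P u hu h.snd : L2Plane) := rfl
  rw [e]
  filter_upwards [Lp.coeFn_add (mulV1 P u hu h.fst : L2Plane) (mulV2 P u hu h.snd : L2Plane),
    mulD4_coe (v1 P u) (memLp_top_v1 P u hu) (v1_d4 P u) h.fst,
    mulD4_coe (v2 u) (memLp_top_v2 P u hu) (v2_d4 u) h.snd] with x h1 h2 h3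
  rw [h1, Pi.add_apply]
  exact congrArg₂ (· + ·) h2 h3

theorem sub_sub_coe {a b e : L2Plane} {f g k : Plane → ℂ} (ha : a =ᵐ[volume] f)
    (hb : b =ᵐ[volume] g) (he : e =ᵐ[volume] k) :
    (a - b - e : L2Plane) =ᵐ[volume] fun x => f x - g x - k x := by
  filter_upwards [Lp.coeFn_sub (a - b) e, Lp.coeFn_sub a b, ha, hb, he] with x a1 a2 a3 a4 a5
  rw [a1, Pi.sub_apply, a2, Pi.sub_apply, a3, a4, a5]

theorem GMap_remainder_coe (P : Params) (u h : HSpace P) :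
    (((GMap P (u + h) - GMap P u -
      (DGfull P (HSpace.incl P u) (HSpace.incl_mem P u) ∘L inclL P) h).fst : L2Plane) : Plane → ℂ)
      =ᵐ[volume] fun x => gFun P (HSpace.incl P (u + h)) x - gFun P (HSpace.incl P u) x -
        (v1 P (HSpace.incl P u) x * ((inclL P h).fst : L2Plane) x +
          v2 (HSpace.incl P u) x * ((inclL P h).snd : L2Plane) x) :=
  sub_sub_coe (GMap_fst_coe P (u + h)) (GMap_fst_coe P u)
    (DGfull_fst_coe P (HSpace.incl P u) (HSpace.incl_mem P u) (inclL P h))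

theorem norm_le_of_coe_eq_remainder (P : Params) {u k w : L2Pair} (hw : w = u + k) {R : L2Plane}
    {m κ : ℝ} (hm : 0 ≤ m) (hκ : 0 ≤ κ) (hu1 : ∀ᵐ x, ‖(u.fst : L2Plane) x‖ ≤ m)
    (hu2 : ∀ᵐ x, ‖(u.snd : L2Plane) x‖ ≤ m) (hk1 : ∀ᵐ x, ‖(k.fst : L2Plane) x‖ ≤ κ)
    (hk2 : ∀ᵐ x, ‖(k.snd : L2Plane) x‖ ≤ κ)
    (hR : R =ᵐ[volume] fun x => gFun P w x - gFun P u x -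
        (v1 P u x * (k.fst : L2Plane) x + v2 u x * (k.snd : L2Plane) x)) :
    ‖R‖ ≤ ((m + 1 + P.lam1 * m) * κ + (κ + P.lam1 * κ) * (2 * m + κ)) *
      ‖(k.fst : L2Plane)‖ := by
  have hl1 : ‖(P.lam1 : ℂ)‖ ≤ P.lam1 := by
    rw [Complex.norm_real, Real.norm_eq_abs, abs_of_nonneg P.lam1_pos.le]
  have e1 : (w.fst : L2Plane) = (u.fst : L2Plane) + (k.fst : L2Plane) := by rw [hw]; rfl
  have e2 : (w.snd : L2Plane) = (u.snd : L2Plane) + (k.snd : L2Plane) := by rw [hw]; rfl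
  have d1 := Lp.coeFn_add (u.fst : L2Plane) (k.fst : L2Plane)
  have d2 := Lp.coeFn_add (u.snd : L2Plane) (k.snd : L2Plane)
  rw [← e1] at d1
  rw [← e2] at d2
  refine Lp.norm_le_mul_norm_of_ae_le_mul ?_
  filter_upwards [hu1, hu2, hk1, hk2, hR, d1, d2] with x a1 a2 a3 a4 b d1 d2
  rw [Pi.add_apply] at d1 d2
  rw [b]
  simp only [gFun, v1, v2, d1, d2]
  exact norm_cubic_remainder_le _ _ _ _ _ m κ P.lam1 hm hκ hl1 a1 a2 a3 a4

theorem GMap_remainder_snd (P : Params) (u h : HSpace P) :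
    (GMap P (u + h) - GMap P u -
      (DGfull P (HSpace.incl P u) (HSpace.incl_mem P u) ∘L inclL P) h).snd = 0 := by
  have : (GMap P (u + h) - GMap P u -
      (DGfull P (HSpace.incl P u) (HSpace.incl_mem P u) ∘L inclL P) h).snd =
      (0 : L2D4) - 0 - ((0 : L2D4 →L[ℂ] L2D4) (inclL P h).fst +
      (0 : L2D4 →L[ℂ] L2D4) (inclL P h).snd) := rfl
  rw [this, zero_apply, zero_apply, add_zero, sub_zero, sub_zero]

theorem norm_eq_norm_fst {x : L2Pair} (h : x.snd = 0) : ‖x‖ = ‖(x.fst : L2Plane)‖ := by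
  rw [norm_pair, h, norm_zero]
  simp only [ne_eq, OfNat.ofNat_ne_zero, not_false_eq_true, zero_pow, add_zero]
  exact Real.sqrt_sq (norm_nonneg _)

theorem norm_fst_le (x : L2Pair) : ‖(x.fst : L2Plane)‖ ≤ ‖x‖ := by
  rw [norm_pair]
  exact Real.le_sqrt_of_sq_le (le_add_of_nonneg_right (sq_nonneg _))

theorem exists_norm_inclL_fst_le (P : Params) :
    ∃ I, 0 ≤ I ∧ ∀ h : HSpace P, ‖((inclL P h).fst : L2Plane)‖ ≤ I * ‖h‖ :=
  ⟨‖inclL P‖, (inclL P).opNorm_nonneg, fun h =>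
    (norm_fst_le (inclL P h)).trans ((inclL P).le_opNorm h)⟩

/-- One power of ‖h‖ comes from the uniform bound on the increment, the other from the L² bound on
its first component. -/
theorem norm_GMap_remainder_le (P : Params) (u : HSpace P) : ∃ K, ∀ h : HSpace P, ‖h‖ ≤ 1 →
    ‖GMap P (u + h) - GMap P u -
      (DGfull P (HSpace.incl P u) (HSpace.incl_mem P u) ∘L inclL P) h‖ ≤ K * ‖h‖ ^ 2 := by
  obtain ⟨C, hC, H⟩ := exists_ae_norm_le P
  obtain ⟨I, hI, HI⟩ := exists_norm_inclL_fst_le P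
  have hl0 : 0 ≤ P.lam1 := P.lam1_pos.le
  have hm0 : 0 ≤ C * ‖u‖ := by positivity
  refine ⟨((C * ‖u‖ + 1 + P.lam1 * (C * ‖u‖)) * C + (C + P.lam1 * C) * (2 * (C * ‖u‖) + C)) * I,
    fun h hh => ?_⟩
  have hk0 : 0 ≤ C * ‖h‖ := by positivity
  have Hh := H h
  have hadd : HSpace.incl P (u + h) = HSpace.incl P u + inclL P h := by
    rw [inclL_apply, map_add]
  rw [← inclL_apply] at Hh
  have hle := norm_le_of_coe_eq_remainder P hadd hm0 hk0 (H u).1 (H u).2 Hh.1 Hh.2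
    (GMap_remainder_coe P u h)
  have hin := HI h
  rw [← norm_eq_norm_fst (GMap_remainder_snd P u h)] at hle
  generalize ‖((inclL P h).fst : L2Plane)‖ = t at hle hin
  refine hle.trans ?_
  have hCh : C * ‖h‖ ≤ C := mul_le_of_le_one_right hC hh
  have hn := norm_nonneg h
  -- What remains is a real inequality. After s² is factored out, one leftover C * s is bounded by
  -- C, since s ≤ 1.
  generalize C * ‖u‖ = m at hm0 ⊢
  generalize ‖h‖ = s at hk0 hin hCh hn ⊢
  calc _ ≤ ((m + 1 + P.lam1 * m) * (C * s) + (C * s + P.lam1 * (C * s)) * (2 * m + C * s)) *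
        (I * s) := by gcongr
    _ = (((m + 1 + P.lam1 * m) * C + (C + P.lam1 * C) * (2 * m + C * s)) * I) * s ^ 2 := by ring
    _ ≤ _ := by gcongr

theorem hasFDerivAt_GMap (P : Params) (u : HSpace P) : HasFDerivAt (GMap P)
    (DGfull P (HSpace.incl P u) (HSpace.incl_mem P u) ∘L inclL P) u := by
  obtain ⟨K, hK⟩ := norm_GMap_remainder_le P u
  rw [hasFDerivAt_iff_isLittleO_nhds_zero]
  refine (Asymptotics.IsBigO.of_bound K ?_).trans_isLittleO
    (Asymptotics.isLittleO_norm_pow_id one_lt_two)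
  filter_upwards [Metric.closedBall_mem_nhds (0 : HSpace P) one_pos] with h hh
  rw [Real.norm_of_nonneg (sq_nonneg ‖h‖)]
  exact hK h (by simpa using hh)

theorem fderiv_FMap (P : Params) (u : HSpace P) : fderiv ℂ (FMap P) u =
    (Liso P).toContinuousLinearEquiv.toContinuousLinearMap +
      DGfull P (HSpace.incl P u) (HSpace.incl_mem P u) ∘L inclL P :=
  ((Liso P).toContinuousLinearEquiv.toContinuousLinearMap.hasFDerivAt.add
    (hasFDerivAt_GMap P u)).fderiv

/-! ### Trigonometric polynomials on `Ω₀` -/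

/-- `f` agrees almost everywhere with a trigonometric polynomial restricted to `Ω₀`. -/
def IsTrig (P : Params) (f : Plane → ℂ) : Prop :=
  ∃ g ∈ Submodule.span ℂ (Set.range (expo P)), f =ᵐ[volume] (Omega P).indicator g

theorem indicator_smul_fun {α : Type*} (s : Set α) (c : ℂ) (g : α → ℂ) :
    s.indicator (c • g) = c • s.indicator g := by
  ext x
  by_cases hx : x ∈ s <;> simp [hx]

namespace IsTrig

variable {P : Params} {f g : Plane → ℂ}

theorem congr (hf : IsTrig P f) (h : g =ᵐ[volume] f) : IsTrig P g := by
  obtain ⟨p, hp, e⟩ := hf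
  exact ⟨p, hp, h.trans e⟩

theorem zero : IsTrig P fun _ => 0 :=
  ⟨0, Submodule.zero_mem _, Filter.Eventually.of_forall fun x => by simp⟩

theorem add (hf : IsTrig P f) (hg : IsTrig P g) : IsTrig P fun x => f x + g x := by
  obtain ⟨p, hp, e⟩ := hf
  obtain ⟨q, hq, e'⟩ := hg
  refine ⟨p + q, Submodule.add_mem _ hp hq, ?_⟩
  filter_upwards [e, e'] with x h h'
  rw [Set.indicator_add', Pi.add_apply, h, h']

theorem const_mul (c : ℂ) (hf : IsTrig P f) : IsTrig P fun x => c * f x := by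
  obtain ⟨p, hp, e⟩ := hf
  refine ⟨c • p, Submodule.smul_mem _ c hp, ?_⟩
  filter_upwards [e] with x h
  rw [h]
  by_cases hx : x ∈ Omega P <;> simp [hx]

theorem expo_mul_expo (m n : ℤ × ℤ) : expo P m * expo P n = expo P (m + n) := by
  ext x
  simp only [Pi.mul_apply, expo, ← Complex.exp_add, inner_freq]
  congr 1
  push_cast [Prod.fst_add, Prod.snd_add]
  ring

/-- Products of exponentials are exponentials, so their span is closed under products, and the
indicator is idempotent. This is what makes v₁ and v₂ trigonometric polynomials. -/
theorem mul (hf : IsTrig P f) (hg : IsTrig P g) : IsTrig P fun x => f x * g x := by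
  obtain ⟨p, hp, e⟩ := hf
  obtain ⟨q, hq, e'⟩ := hg
  refine ⟨p * q, ?_, ?_⟩
  · have h := Submodule.mul_mem_mul hp hq
    rw [Submodule.span_mul_span] at h
    refine Submodule.span_mono ?_ h
    rintro _ ⟨_, ⟨m, rfl⟩, _, ⟨n, rfl⟩, rfl⟩
    exact ⟨m + n, (expo_mul_expo m n).symm⟩
  · filter_upwards [e, e'] with x h h'
    rw [h, h']
    by_cases hx : x ∈ Omega P <;> simp [hx]

theorem expoL2 (m : ℤ × ℤ) : IsTrig P (GrayScott.expoL2 P m) :=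
  ⟨expo P m, Submodule.subset_span ⟨m, rfl⟩, (memLp_expo P m 2).coeFn_toLp⟩

theorem coe_add {u v : L2Plane} (hu : IsTrig P u) (hv : IsTrig P v) :
    IsTrig P (u + v : L2Plane) :=
  (hu.add hv).congr (Lp.coeFn_add u v)

theorem coe_smul (c : ℂ) {u : L2Plane} (hu : IsTrig P u) : IsTrig P (c • u : L2Plane) :=
  (hu.const_mul c).congr (Lp.coeFn_smul c u)

theorem coe_sum {ι : Type*} (s : Finset ι) (u : ι → L2Plane) (h : ∀ i, IsTrig P (u i)) :
    IsTrig P (∑ i ∈ s, u i : L2Plane) :=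
  Finset.sum_induction u (fun v : L2Plane => IsTrig P v) (fun _ _ => coe_add)
    (zero.congr (Lp.coeFn_zero ℂ 2 volume)) fun i _ => h i

theorem orbL2 (n : Jred) : IsTrig P (GrayScott.orbL2 P n) := coe_sum _ _ fun m => expoL2 m

theorem memLp_span (p : ℝ≥0∞) {g : Plane → ℂ} (hg : g ∈ Submodule.span ℂ (Set.range (expo P))) :
    MemLp ((Omega P).indicator g) p volume := by
  induction hg using Submodule.span_induction with
  | mem g hg => obtain ⟨m, rfl⟩ := hg; exact memLp_expo P m p
  | zero => rw [Set.indicator_zero']; exact MemLp.zero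
  | add g k _ _ hg hk => rw [Set.indicator_add']; exact hg.add hk
  | smul c g _ hg => rw [indicator_smul_fun]; exact hg.const_smul c

theorem memLp (hf : IsTrig P f) (p : ℝ≥0∞) : MemLp f p volume := by
  obtain ⟨q, hq, e⟩ := hf
  exact (memLp_congr_ae e).2 (memLp_span p hq)

theorem eq_zero_outside (hf : IsTrig P f) : ∀ᵐ x, x ∉ Omega P → f x = 0 := by
  obtain ⟨q, -, e⟩ := hf
  filter_upwards [e] with x h hx
  rw [h, Set.indicator_of_notMem hx]

end IsTrig

theorem coeff_congr (P : Params) {f g : Plane → ℂ} (h : f =ᵐ[volume] g) :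
    coeff P f = coeff P g := by
  ext n
  rw [coeff, coeff]
  congr 1
  refine integral_congr_ae ?_
  filter_upwards [ae_restrict_of_ae h] with x hx
  rw [hx]

theorem coeff_toLp (P : Params) {f : Plane → ℂ} (hf : MemLp f 2 volume) (n : Jred) :
    coeff P f n = (area P : ℂ)⁻¹ * inner ℂ (expoL2 P n) (hf.toLp f) := by
  rw [← coeff_congr P hf.coeFn_toLp, coeff_eq_inner]

/-- By orthogonality a single exponential has at most one nonzero coefficient, and finiteness
survives linear combinations. -/
theorem finite_support_coeff_of_mem_span (P : Params) {g : Plane → ℂ}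
    (hg : g ∈ Submodule.span ℂ (Set.range (expo P))) :
    (Function.support (coeff P ((Omega P).indicator g))).Finite := by
  induction hg using Submodule.span_induction with
  | mem g hg =>
    obtain ⟨m, rfl⟩ := hg
    refine Set.Finite.subset (Set.Finite.preimage Subtype.val_injective.injOn
      (Set.finite_singleton m)) fun n hn => ?_
    by_contra hne
    refine hn ?_
    rw [coeff_toLp P (memLp_expo P m 2)]
    exact mul_eq_zero_of_right _ ((inner_expoL2_expoL2 P n m).trans (if_neg hne))
  | zero =>
    refine Set.finite_empty.subset fun n hn => hn ?_
    simp [coeff]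
  | add g k hg' hk' hg hk =>
    refine (hg.union hk).subset (Function.support_subset_iff'.2 fun n hn => ?_)
    simp only [Set.mem_union, Function.mem_support, ne_eq, not_or, not_not] at hn
    rw [Set.indicator_add', coeff_toLp P ((IsTrig.memLp_span 2 hg').add (IsTrig.memLp_span 2 hk')),
      MemLp.toLp_add (IsTrig.memLp_span 2 hg') (IsTrig.memLp_span 2 hk'), inner_add_right, mul_add, ← coeff_toLp,
      ← coeff_toLp, hn.1, hn.2, add_zero]
  | smul c g hg' hg =>
    refine hg.subset (Function.support_subset_iff'.2 fun n hn => ?_)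
    rw [Function.mem_support, not_not] at hn
    rw [indicator_smul_fun, coeff_toLp P ((IsTrig.memLp_span 2 hg').const_smul c),
      MemLp.toLp_const_smul c (IsTrig.memLp_span 2 hg'), inner_smul_right, mul_left_comm,
      ← coeff_toLp, hn, mul_zero]

/-- Guarantees that `ell1Norm` is a finite sum below: for a divergent series `tsum` would be 0 and
bound nothing. -/
theorem IsTrig.finite_support {P : Params} {f : Plane → ℂ} (hf : IsTrig P f) :
    (Function.support (coeff P f)).Finite := by
  obtain ⟨q, hq, e⟩ := hf
  rw [coeff_congr P e]
  exact finite_support_coeff_of_mem_span P hq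

/-! ### Uniform bounds by the `ℓ¹` norm -/

/-- A sum of α_n functions of modulus at most one; this is the origin of the weights in the ℓ¹ norm.
-/
theorem ae_norm_orbL2_le (P : Params) (n : Jred) : ∀ᵐ x, ‖orbL2 P n x‖ ≤ alpha n := by
  have h : ∀ s : Finset (ℤ × ℤ), ∀ᵐ x, ‖(∑ m ∈ s, expoL2 P m : L2Plane) x‖ ≤ s.card := by
    intro s
    induction s using Finset.induction_on with
    | empty =>
      filter_upwards [Lp.coeFn_zero ℂ 2 (volume : Measure Plane)] with x hx
      rw [Finset.sum_empty, hx]; simp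
    | insert a s ha ih =>
      rw [Finset.sum_insert ha, Finset.card_insert_of_notMem ha]
      filter_upwards [ih, Lp.coeFn_add (expoL2 P a) (∑ m ∈ s, expoL2 P m),
        (memLp_expo P a 2).coeFn_toLp] with x h1 h2 h3
      rw [h2, Pi.add_apply, expoL2, h3, add_comm, Nat.cast_add, Nat.cast_one]
      refine (norm_add_le _ _).trans (add_le_add h1 ?_)
      exact (norm_indicator_le_norm_self _ _).trans (norm_expo P a x).le
  exact h _

theorem ae_norm_gamDag_le (P : Params) (U : Ell2) (hU : (Function.support (U : Jred → ℂ)).Finite) :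
    ∀ᵐ x, ‖(gamDag P U : L2Plane) x‖ ≤ ell1Norm U := by
  have h0 : ∀ n ∉ hU.toFinset, U n = 0 := fun n hn => by simpa using hn
  have e1 : ell1Norm U = ∑ n ∈ hU.toFinset, (alpha n : ℝ) * ‖U n‖ :=
    tsum_eq_sum fun n hn => by rw [h0 n hn, norm_zero, mul_zero]
  have e2 : (gamDag P U : L2Plane) = ∑ n ∈ hU.toFinset, U n • orbL2 P n := by
    rw [gamDag_coe]
    exact tsum_eq_sum fun n hn => by rw [h0 n hn, zero_smul]
  rw [e1, e2]
  have h : ∀ s : Finset Jred, ∀ᵐ x, ‖(∑ n ∈ s, U n • orbL2 P n : L2Plane) x‖ ≤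
      ∑ n ∈ s, (alpha n : ℝ) * ‖U n‖ := by
    intro s
    induction s using Finset.induction_on with
    | empty =>
      filter_upwards [Lp.coeFn_zero ℂ 2 (volume : Measure Plane)] with x hx
      rw [Finset.sum_empty, hx]; simp
    | insert a s ha ih =>
      rw [Finset.sum_insert ha, Finset.sum_insert ha]
      filter_upwards [ih, Lp.coeFn_add (U a • orbL2 P a) (∑ n ∈ s, U n • orbL2 P n),
        Lp.coeFn_smul (U a) (orbL2 P a), ae_norm_orbL2_le P a] with x h1 h2 h3 h4
      rw [h2, Pi.add_apply, h3, Pi.smul_apply, smul_eq_mul]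
      refine (norm_add_le _ _).trans (add_le_add ?_ h1)
      rw [norm_mul, mul_comm]
      gcongr
  exact h _

/-- Since f is symmetric and supported in Ω₀, it equals γ†γ(f), so the difference is γ† of the
discarded coefficients, which are finitely many. -/
theorem ae_norm_sub_trunc_le (P : Params) (M : ℕ) {f : Plane → ℂ} (hf : IsTrig P f)
    (hs : ∀ i, (fun x => f (d4Gen i x)) =ᵐ[volume] f) :
    ∀ᵐ x, ‖f x - (gamDag P (truncEll2 M (coeff P f)) : L2Plane) x‖ ≤
      ell1Norm (truncSeq M (coeff P f) - coeff P f) := by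
  have hm := hf.memLp 2
  set w : L2D4 := ⟨hm.toLp f, toLp_mem_L2D4 hm hs⟩ with hw
  have hwf : ((w : L2Plane) : Plane → ℂ) =ᵐ[volume] f := hm.coeFn_toLp
  have hin : indIn P w = w := by
    refine Subtype.ext (Lp.ext ?_)
    filter_upwards [indIn_coe P w, hwf, hf.eq_zero_outside] with x h1 h2 h3
    rw [h1]
    by_cases hx : x ∈ Omega P
    · rw [Set.indicator_of_mem hx]
    · rw [Set.indicator_of_notMem hx, h2, h3 hx]
  have hg : ∀ n, gam P w n = coeff P f n := fun n => by
    rw [gam_apply, coeff_congr P hwf]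
  set D : Ell2 := truncEll2 M (coeff P f) - gam P w with hD
  have hDn : (D : Jred → ℂ) = truncSeq M (coeff P f) - coeff P f := by
    ext n
    rw [hD, weight_ext (Lp.coeFn_sub _ _) n, Pi.sub_apply, truncEll2_apply, hg, Pi.sub_apply]
  have hsupp : (Function.support (D : Jred → ℂ)).Finite := by
    refine hf.finite_support.subset (Function.support_subset_iff'.2 fun n hn => ?_)
    rw [Function.mem_support, not_not] at hn
    rw [hDn, Pi.sub_apply, truncSeq, hn, ite_self, sub_zero]
  have key := ae_norm_gamDag_le P D hsupp
  rw [hDn] at key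
  have e : (gamDag P D : L2Plane) =
      (gamDag P (truncEll2 M (coeff P f)) : L2Plane) - (w : L2Plane) := by
    rw [hD, map_sub, gamDag_gam, hin]; rfl
  rw [e] at key
  filter_upwards [key, hwf,
    Lp.coeFn_sub (gamDag P (truncEll2 M (coeff P f)) : L2Plane) (w : L2Plane)]
    with x h1 h2 h3
  rw [h3, Pi.sub_apply, h2, norm_sub_rev] at h1
  exact h1

theorem norm_mulD4_sub_mulTrunc_le (P : Params) (M : ℕ) {f : Plane → ℂ} (hf : IsTrig P f)
    (h : MemLp f ∞ volume) (hs : ∀ i, (fun x => f (d4Gen i x)) =ᵐ[volume] f) :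
    ‖mulD4 f h hs - mulTrunc P M (coeff P f)‖ ≤ ell1Norm (truncSeq M (coeff P f) - coeff P f) := by
  refine ContinuousLinearMap.opNorm_le_bound _ (tsum_nonneg fun n => by positivity) fun u => ?_
  have e : (((mulD4 f h hs - mulTrunc P M (coeff P f)) u : L2D4) : L2Plane) =
    (mulD4 f h hs u : L2Plane) - (mulTrunc P M (coeff P f) u : L2Plane) := rfl
  rw [Submodule.coe_norm, Submodule.coe_norm, e]
  refine Lp.norm_le_mul_norm_of_ae_le_mul ?_
  have h2 : ((mulTrunc P M (coeff P f) u : L2Plane) : Plane → ℂ) =ᵐ[volume] fun x =>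
    (gamDag P (truncEll2 M (coeff P f)) : L2Plane) x * (u : L2Plane) x := mulD4_coe _ _ _ u
  filter_upwards [ae_norm_sub_trunc_le P M hf hs, mulD4_coe f h hs u, h2,
    Lp.coeFn_sub (mulD4 f h hs u : L2Plane) (mulTrunc P M (coeff P f) u : L2Plane)]
    with x h1 h2 h3 h4
  rw [h4, Pi.sub_apply, h2, h3, ← sub_mul, norm_mul]
  gcongr

/-! ### The functions `v₁` and `v₂` are trigonometric polynomials -/

theorem piUp_apply (M : ℕ) (U : Ell2) (n : Jred) : piUp M U n = truncSeq M 1 n * U n :=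
  diagSeq_apply _ _ U n

theorem isTrig_gamDag (P : Params) (M : ℕ) {U : Ell2} (hU : piUp M U = U) :
    IsTrig P (gamDag P U : L2Plane) := by
  rw [gamDag_coe, tsum_eq_sum (s := (finite_index M).toFinset) fun n hn => by
    have h : ¬ n.1.1 ≤ M := by simpa using hn
    rw [← hU, piUp_apply, truncSeq, if_neg h, zero_mul, zero_smul]]
  exact IsTrig.coe_sum _ _ fun n => IsTrig.coe_smul _ (IsTrig.orbL2 n)

theorem isTrig_v2 (P : Params) {u : L2Pair} (h1 : IsTrig P (u.fst : L2Plane)) :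
    IsTrig P (v2 u) :=
  (h1.mul h1).congr (Filter.Eventually.of_forall fun x => by simp only [v2]; ring)

theorem isTrig_v1 (P : Params) {u : L2Pair} (h1 : IsTrig P (u.fst : L2Plane))
    (h2 : IsTrig P (u.snd : L2Plane)) : IsTrig P (v1 P u) :=
  ((((h2.mul h1).const_mul 2).add (h1.const_mul 2)).add ((h1.mul h1).const_mul (-3 * P.lam1))).congr
    (Filter.Eventually.of_forall fun x => by simp only [v1]; ring)

theorem isTrig_gamDagPair (P : Params) (M : ℕ) {U : Ell2Pair} (hU : diagOp (piUp M) U = U) :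
    IsTrig P ((gamDagPair P U).fst : L2Plane) ∧ IsTrig P ((gamDagPair P U).snd : L2Plane) := by
  have e1 : (gamDagPair P U).fst = gamDag P U.fst := by
    rw [gamDagPair, diagOp, blockOp_fst, zero_apply, add_zero]
  have e2 : (gamDagPair P U).snd = gamDag P U.snd := by
    rw [gamDagPair, diagOp, blockOp_snd, zero_apply, zero_add]
  have h1 : piUp M U.fst = U.fst := by
    conv_rhs => rw [← hU, diagOp, blockOp_fst, zero_apply, add_zero]
  have h2 : piUp M U.snd = U.snd := by
    conv_rhs => rw [← hU, diagOp, blockOp_snd, zero_apply, zero_add]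
  rw [e1, e2]
  exact ⟨isTrig_gamDag P M h1, isTrig_gamDag P M h2⟩

/-! ### Abstract estimates -/

section Abstract

variable {X E : Type*} [NormedAddCommGroup X] [InnerProductSpace ℂ X]
  [NormedAddCommGroup E] [InnerProductSpace ℂ E]

/-- Here G, G' play γ, γ† and χ, χ' the inside and outside cutoffs. From GG' = 1, G'G = χ and χ'G' =
0 the conjugated products collapse: what is added and subtracted is D replaced by G'DG G and L by
G'KG. -/
theorem one_sub_parametrix_eq {G : X →L[ℂ] E} {G' : E →L[ℂ] X} {χ χ' : X →L[ℂ] X}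
    (h1 : ∀ u, G' (G u) = χ u) (h2 : ∀ U, G (G' U) = U) (h3 : ∀ u, χ u + χ' u = u)
    (h4 : ∀ U, χ' (G' U) = 0) (B DG K : E →L[ℂ] E) (D L : X →L[ℂ] X) (x : X) :
    (1 - (χ' + G' ∘L B ∘L G) ∘L (1 + D ∘L L) : X →L[ℂ] X) x =
      (G' ∘L (1 - B ∘L (1 + DG ∘L K)) ∘L G) x -
      (χ' + G' ∘L B ∘L G) ((G' ∘L DG ∘L G) (L x - (G' ∘L K ∘L G) x)) -
      (χ' + G' ∘L B ∘L G) ((D - G' ∘L DG ∘L G) (L x)) := by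
  have h5 : x - χ' x = χ x := by rw [sub_eq_iff_eq_add, h3]
  simp only [sub_apply, add_apply, ContinuousLinearMap.comp_apply, one_apply_eq_self, map_add,
    map_sub, h1, h2, h4, ← h5]
  abel

/-- G' multiplies norms by s and G divides them by at least s, so the scale cancels. -/
theorem norm_conj_le {G : X →L[ℂ] E} {G' : E →L[ℂ] X} {s : ℝ} (hs : 0 ≤ s)
    (h1 : ∀ U, ‖G' U‖ = s * ‖U‖) (h2 : ∀ u, s * ‖G u‖ ≤ ‖u‖) (K : E →L[ℂ] E) (x : X) :
    ‖(G' ∘L K ∘L G) x‖ ≤ ‖K‖ * ‖x‖ := by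
  rw [ContinuousLinearMap.comp_apply, ContinuousLinearMap.comp_apply, h1]
  calc _ ≤ s * (‖K‖ * ‖G x‖) := by gcongr; exact K.le_opNorm _
    _ = ‖K‖ * (s * ‖G x‖) := by ring
    _ ≤ _ := by gcongr; exact h2 x

theorem diagOp_fst (A : X →L[ℂ] E) (x : WithLp 2 (X × X)) : (diagOp A x).fst = A x.fst := by
  rw [diagOp, blockOp_fst, zero_apply, add_zero]

theorem diagOp_snd (A : X →L[ℂ] E) (x : WithLp 2 (X × X)) : (diagOp A x).snd = A x.snd := by
  rw [diagOp, blockOp_snd, zero_apply, zero_add]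

theorem norm_diagOp_of_norm_eq {G : X →L[ℂ] E} {s : ℝ} (hs : 0 ≤ s) (h : ∀ u, ‖G u‖ = s * ‖u‖)
    (x : WithLp 2 (X × X)) : ‖diagOp G x‖ = s * ‖x‖ := by
  rw [norm_pair (diagOp G x), diagOp_fst, diagOp_snd, h, h, norm_pair x, mul_pow, mul_pow,
    ← mul_add, Real.sqrt_mul (sq_nonneg s), Real.sqrt_sq hs]

theorem norm_diagOp_le_of_norm_le {G : X →L[ℂ] E} {s : ℝ} (hs : 0 ≤ s)
    (h : ∀ u, s * ‖G u‖ ≤ ‖u‖) (x : WithLp 2 (X × X)) : s * ‖diagOp G x‖ ≤ ‖x‖ := by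
  rw [norm_pair (diagOp G x), diagOp_fst, diagOp_snd, norm_pair x]
  refine Real.le_sqrt_of_sq_le ?_
  rw [mul_pow, Real.sq_sqrt (by positivity), mul_add, ← mul_pow, ← mul_pow]
  have := h x.fst
  have := h x.snd
  gcongr

theorem norm_of_snd_eq_zero {X : Type*} [NormedAddCommGroup X] {x : WithLp 2 (X × X)} (h : x.snd = 0) :
    ‖x‖ = ‖x.fst‖ := by
  rw [norm_pair, h, norm_zero]
  simp only [ne_eq, OfNat.ofNat_ne_zero, not_false_eq_true, zero_pow, add_zero]
  exact Real.sqrt_sq (norm_nonneg _)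

/-- S annihilates the outside part, so T − S acts there as T alone. The bounds for the two parts
combine by Cauchy–Schwarz against the Pythagorean splitting of x. -/
theorem norm_apply_le_sqrt {T S χ χ' : X →L[ℂ] X} (h1 : ∀ u, χ u + χ' u = u)
    (h2 : ∀ u, ‖χ u‖ ^ 2 + ‖χ' u‖ ^ 2 = ‖u‖ ^ 2) (h3 : ∀ u, χ (χ u) = χ u)
    (h4 : ∀ u, χ' (χ' u) = χ' u) (h5 : ∀ u, S (χ' u) = 0) {M : X →L[ℂ] X} {a b : ℝ}
    (ha : ‖M ∘L T ∘L χ'‖ ≤ a) (hb : ‖M ∘L (S - T) ∘L χ‖ ≤ b) (x : X) :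
    ‖M (T x - S x)‖ ≤ Real.sqrt (a ^ 2 + b ^ 2) * ‖x‖ := by
  -- Idempotence lets each cutoff appear twice, once inside the operator and once on its argument.
  -- Norms of χx and χ'x, rather than two copies of ‖x‖, then enter, giving a root instead of a sum.
  have e : M (T x - S x) = (M ∘L T ∘L χ') (χ' x) - (M ∘L (S - T) ∘L χ) (χ x) := by
    simp only [ContinuousLinearMap.comp_apply, sub_apply, h3, h4]
    conv_lhs => rw [← h1 x]
    simp only [map_add, map_sub, h5]
    simp only [map_zero]
    abel
  rw [e, ← Real.sqrt_sq (norm_nonneg x), ← h2, add_comm (‖χ x‖ ^ 2)]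
  refine (norm_sub_le _ _).trans (le_trans (add_le_add ?_ ?_) (le_sqrt_mul_sqrt a b _ _))
  · exact ContinuousLinearMap.le_of_opNorm_le _ ha _
  · exact ContinuousLinearMap.le_of_opNorm_le _ hb _

/-- K depends only on πx and takes values in the range of π, so the two terms have orthogonal inputs
and orthogonal outputs. Pythagoras gives a maximum where the triangle inequality would give a sum.
-/
theorem norm_projection_add_le {π : E →L[ℂ] E} (h1 : ∀ u, π (π u) = π u)
    (h2 : ∀ u, ‖π u‖ ^ 2 + ‖(1 - π) u‖ ^ 2 = ‖u‖ ^ 2) {K : E →L[ℂ] E} (hK : π ∘L K ∘L π = K)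
    (x : E) : ‖(1 - π) x + K x‖ ≤ max 1 ‖K‖ * ‖x‖ := by
  have hK1 : ∀ u, π (K u) = K u := fun u => by
    conv_rhs => rw [← hK]
    conv_lhs => rw [← hK]
    simp only [ContinuousLinearMap.comp_apply, h1]
  have hK2 : K x = K (π x) := by
    conv_rhs => rw [← hK]
    conv_lhs => rw [← hK]
    simp only [ContinuousLinearMap.comp_apply, h1]
  have e1 : π ((1 - π) x + K x) = K x := by
    simp only [sub_apply, one_apply_eq_self, map_add, map_sub, h1, hK1, sub_self, zero_add]
  have e2 : (1 - π) ((1 - π) x + K x) = (1 - π) x := by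
    rw [sub_apply, e1]
    simp
  have hm0 : 0 ≤ max 1 ‖K‖ := zero_le_one.trans (le_max_left _ _)
  refine le_of_sq_le_sq ?_ (by positivity)
  rw [← h2 ((1 - π) x + K x), e1, e2, mul_pow, ← h2 x, mul_add, ← mul_pow, ← mul_pow, hK2]
  have a1 : ‖K (π x)‖ ≤ max 1 ‖K‖ * ‖π x‖ := K.le_of_opNorm_le (le_max_right _ _) _
  have a2 : ‖(1 - π) x‖ ≤ max 1 ‖K‖ * ‖(1 - π) x‖ :=
    le_mul_of_one_le_left (norm_nonneg _) (le_max_left _ _)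
  gcongr

/-- On a pair (f, 0) with f inside, the outside cutoff vanishes and the second column of the block,
hence B', meets zero. Only G'((1 − π) + B)G remains, and the scale s cancels. -/
theorem norm_parametrix_apply_le {G : X →L[ℂ] E} {G' : E →L[ℂ] X} {χ' : X →L[ℂ] X} {s : ℝ}
    (hs : 0 ≤ s) (hG' : ∀ U, ‖G' U‖ = s * ‖U‖) (hG : ∀ u, s * ‖G u‖ ≤ ‖u‖) {π : E →L[ℂ] E}
    (hπ : ∀ u, π (π u) = π u) (hπ' : ∀ u, ‖π u‖ ^ 2 + ‖(1 - π) u‖ ^ 2 = ‖u‖ ^ 2)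
    {B : E →L[ℂ] E} (hB : π ∘L B ∘L π = B) (B' : E →L[ℂ] E) {x : WithLp 2 (X × X)}
    (h1 : χ' x.fst = 0) (h2 : x.snd = 0) :
    ‖(diagOp χ' + diagOp G' ∘L (diagOp (1 - π) + blockOp B B' 0 π) ∘L diagOp G) x‖ ≤
      max 1 ‖B‖ * ‖x‖ := by
  have e1 : ((diagOp χ' + diagOp G' ∘L (diagOp (1 - π) + blockOp B B' 0 π) ∘L diagOp G) x).fst =
      G' ((1 - π) (G x.fst) + B (G x.fst)) := by
    simp only [add_apply, ContinuousLinearMap.comp_apply, WithLp.add_fst, diagOp_fst, diagOp_snd,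
      blockOp_fst, h1, h2, map_zero, add_zero, zero_add]
  have e2 : ((diagOp χ' + diagOp G' ∘L (diagOp (1 - π) + blockOp B B' 0 π) ∘L diagOp G) x).snd =
      0 := by
    simp only [add_apply, ContinuousLinearMap.comp_apply, WithLp.add_snd, diagOp_fst, diagOp_snd,
      blockOp_snd, h2, map_zero, add_zero, zero_apply]
  rw [norm_of_snd_eq_zero e2, norm_of_snd_eq_zero h2, e1, hG']
  have h0 : 0 ≤ max 1 ‖B‖ := zero_le_one.trans (le_max_left _ _)
  calc _ ≤ s * (max 1 ‖B‖ * ‖G x.fst‖) := by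
        gcongr; exact norm_projection_add_le hπ hπ' hB _
    _ = max 1 ‖B‖ * (s * ‖G x.fst‖) := by ring
    _ ≤ _ := by gcongr; exact hG _

theorem norm_comp_le_mul_of_le {T L : X →L[ℂ] X} {a b : ℝ} (hT : ‖T‖ ≤ a) (hL : ‖L‖ ≤ b) (x : X) :
    ‖T (L x)‖ ≤ b * a * ‖x‖ := by
  have ha := (norm_nonneg T).trans hT
  refine (T.le_of_opNorm_le hT _).trans ?_
  calc _ ≤ a * (b * ‖x‖) := by gcongr; exact L.le_of_opNorm_le hL x
    _ = _ := by ring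

end Abstract

/-! ### The approximate inverse -/

theorem norm_piUp_add_piDown (M : ℕ) (U : Ell2) :
    ‖piUp M U‖ ^ 2 + ‖(1 - piUp M) U‖ ^ 2 = ‖U‖ ^ 2 := by
  have hp : ∀ n, alpha n * ‖piUp M U n‖ ^ 2 + alpha n * ‖(1 - piUp M) U n‖ ^ 2 =
      alpha n * ‖U n‖ ^ 2 := fun n => by
    have e : (1 - piUp M) U n = U n - piUp M U n := weight_ext (Lp.coeFn_sub U (piUp M U)) n
    rw [e, piUp_apply, truncSeq]
    split_ifs <;> simp
  rw [Ell2.norm_sq, Ell2.norm_sq, Ell2.norm_sq, ← Summable.tsum_add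
    ((memLp_weight_iff _).1 (Lp.memLp _)) ((memLp_weight_iff _).1 (Lp.memLp _))]
  exact tsum_congr hp

theorem piUp_piUp (M : ℕ) (U : Ell2) : piUp M (piUp M U) = piUp M U := by
  refine Lp.ext (Filter.Eventually.of_forall fun n => ?_)
  rw [piUp_apply, piUp_apply, truncSeq]
  split_ifs <;> simp

theorem indOut_indOut (P : Params) (u : L2D4) : indOut P (indOut P u) = indOut P u := by
  have h : ∀ v, indOut P v = v - indIn P v := fun v => by rw [indOut_eq]; rfl
  rw [h (indOut P u), h u, map_sub, indIn_indIn, sub_self, sub_zero]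

theorem norm_indIn_le (P : Params) (u : L2D4) : ‖indIn P u‖ ≤ ‖u‖ := norm_indD4_le _ _ _ u

theorem norm_BFull_apply_le (P : Params) (N : ℕ) (B11 B12 : Ell2 →L[ℂ] Ell2)
    (hB11 : piUp N ∘L B11 ∘L piUp N = B11) {x : L2Pair}
    (h1 : indIn P x.fst = x.fst) (h2 : x.snd = 0) :
    ‖BFull P N B11 B12 x‖ ≤ max 1 ‖B11‖ * ‖x‖ := by
  -- A function fixed by the inside cutoff lies in the range of γ†, which the outside cutoff
  -- annihilates.
  have hout : indOut P x.fst = 0 := by rw [← h1, ← gamDag_gam, indOut_gamDag]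
  exact norm_parametrix_apply_le (Real.sqrt_nonneg (area P)) (norm_gamDag P)
    (fun u => (norm_gam P u).trans_le (norm_indIn_le P u)) (piUp_piUp N) (norm_piUp_add_piDown N)
    hB11 B12 hout h2

/-! ### Norms of the inverse operators -/

theorem norm_fourierMultD4_le (m : Plane → ℂ) (hm : MemLp m ∞ volume) (hs) {C : ℝ} (hC : 0 ≤ C)
    (h : ∀ ξ, ‖m ξ‖ ≤ C) : ‖fourierMultD4 m hm hs‖ ≤ C := by
  refine ContinuousLinearMap.opNorm_le_bound _ hC fun u => ?_
  have e : ‖fourierMultD4 m hm hs u‖ =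
      ‖mulOp m hm (Lp.fourierTransformₗᵢ Plane ℂ (u : L2Plane))‖ :=
    (Lp.fourierTransformₗᵢ Plane ℂ).symm.norm_map _
  have e' : ‖Lp.fourierTransformₗᵢ Plane ℂ (u : L2Plane)‖ = ‖u‖ :=
    (Lp.fourierTransformₗᵢ Plane ℂ).norm_map _
  rw [e, ← e']
  exact norm_mulOp_apply_le m hm (Filter.Eventually.of_forall h) _

theorem norm_L11inv_le (P : Params) : ‖L11inv P‖ ≤ 1 :=
  norm_fourierMultD4_le _ _ _ zero_le_one (norm_symb11_le P)

theorem norm_L22inv_le (P : Params) : ‖L22inv P‖ ≤ 1 / P.lam2 :=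
  norm_fourierMultD4_le _ _ _ (one_div_nonneg.2 P.lam2_pos.le) (norm_symb22_le P)

theorem norm_L3_le (P : Params) : ‖L3 P‖ ≤ |P.lam1 * P.lam2 - 1| / P.lam2 := by
  have h2 := P.lam2_pos
  refine ContinuousLinearMap.opNorm_le_bound _ (by positivity) fun u => ?_
  have e : L3 P u = L22inv P (((P.lam2 * P.lam1 - 1 : ℝ) : ℂ) • L11inv P u) := rfl
  have h11 := (L11inv P).le_of_opNorm_le (norm_L11inv_le P) u
  have h22 := (L22inv P).le_of_opNorm_le (norm_L22inv_le P)
    (((P.lam2 * P.lam1 - 1 : ℝ) : ℂ) • L11inv P u)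
  rw [← e, norm_smul, Complex.norm_real, Real.norm_eq_abs, mul_comm P.lam2] at h22
  refine h22.trans ?_
  calc _ ≤ 1 / P.lam2 * (|P.lam1 * P.lam2 - 1| * (1 * ‖u‖)) := by gcongr
    _ = _ := by ring

/-- The arguments of φ are suprema of the symbols, bounded using |l₁₁| ≥ 1 and |l₂₂| ≥ λ₂; the 0 is
the empty upper right block. -/
theorem norm_LinvL2_le (P : Params) :
    ‖LinvL2 P‖ ≤ phi 1 0 (|P.lam1 * P.lam2 - 1| / P.lam2) (1 / P.lam2) := by
  have h : ‖-L3 P‖ ≤ |P.lam1 * P.lam2 - 1| / P.lam2 := by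
    rw [ContinuousLinearMap.opNorm_neg]
    exact norm_L3_le P
  exact norm_blockOp_lower_le_phi _ _ _ (norm_L11inv_le P) h (norm_L22inv_le P)

/-! ### Rows of multiplication operators -/

section

variable {X : Type*} [NormedAddCommGroup X] [InnerProductSpace ℂ X]

theorem row_apply_fst_fixed {χ M1 M2 : X →L[ℂ] X} (h1 : ∀ u, χ (M1 u) = M1 u)
    (h2 : ∀ u, χ (M2 u) = M2 u) (x : WithLp 2 (X × X)) :
    χ (blockOp M1 M2 0 0 x).fst = (blockOp M1 M2 0 0 x).fst := by
  rw [blockOp_fst, map_add, h1, h2]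

theorem row_apply_snd (M1 M2 : X →L[ℂ] X) (x : WithLp 2 (X × X)) :
    (blockOp M1 M2 0 0 x).snd = 0 := by
  rw [blockOp_snd, zero_apply, zero_apply, add_zero]

theorem row_sub_row (A B A' B' : X →L[ℂ] X) :
    blockOp A B 0 0 - blockOp A' B' 0 0 = blockOp (A - A') (B - B') 0 0 := by
  ext1 x
  refine pair_ext ?_ ?_ <;>
    simp only [sub_apply, WithLp.sub_fst, WithLp.sub_snd, blockOp_fst, blockOp_snd, zero_apply,
      add_zero, sub_zero]
  abel

theorem comp_sub_fixed {χ A B : X →L[ℂ] X} (h1 : ∀ u, χ (A u) = A u)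
    (h2 : ∀ u, χ (B u) = B u) (u : X) : χ ((A - B) u) = (A - B) u := by
  rw [sub_apply, map_sub, h1, h2]

theorem norm_sq_diagOp_add_diagOp {χ χ' : X →L[ℂ] X}
    (h : ∀ u, ‖χ u‖ ^ 2 + ‖χ' u‖ ^ 2 = ‖u‖ ^ 2) (x : WithLp 2 (X × X)) :
    ‖diagOp χ x‖ ^ 2 + ‖diagOp χ' x‖ ^ 2 = ‖x‖ ^ 2 := by
  rw [norm_sq_pair x, norm_sq_pair (diagOp χ x), norm_sq_pair (diagOp χ' x),
    diagOp_fst, diagOp_snd, diagOp_fst, diagOp_snd, ← h x.fst, ← h x.snd]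
  ring

variable {H : Type*} [NormedAddCommGroup H] [NormedSpace ℂ H]

/-- The operator on H is L⁻¹(1 − B(1 + DK))L, and conjugation by an isometry preserves bounds. In
the application KL is the inclusion of ℋ in L². -/
theorem norm_id_sub_comp_le (L : H ≃ₗᵢ[ℂ] X) (B D K : X →L[ℂ] X) {c : ℝ} (hc : 0 ≤ c)
    (h : ∀ x, ‖(1 - B ∘L (1 + D ∘L K) : X →L[ℂ] X) x‖ ≤ c * ‖x‖) :
    ‖ContinuousLinearMap.id ℂ H -
      (L.symm.toContinuousLinearEquiv.toContinuousLinearMap ∘L B) ∘L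
        (L.toContinuousLinearEquiv.toContinuousLinearMap +
          D ∘L K ∘L L.toContinuousLinearEquiv.toContinuousLinearMap)‖ ≤ c := by
  refine ContinuousLinearMap.opNorm_le_bound _ hc fun u => ?_
  rw [← L.norm_map u, ← L.norm_map]
  refine le_of_eq_of_le (congrArg norm ?_) (h (L u))
  simp

end

/-! ### The defect `I - 𝔸 D𝔽(u₀)` -/

theorem gamDagPair_gamPair (P : Params) (u : L2Pair) :
    gamDagPair P (gamPair P u) = diagOp (indIn P) u :=
  pair_ext (by simp only [gamDagPair, gamPair, diagOp_fst, gamDag_gam])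
    (by simp only [gamDagPair, gamPair, diagOp_snd, gamDag_gam])

theorem gamPair_gamDagPair (P : Params) (U : Ell2Pair) : gamPair P (gamDagPair P U) = U :=
  pair_ext (by simp only [gamDagPair, gamPair, diagOp_fst, gam_gamDag])
    (by simp only [gamDagPair, gamPair, diagOp_snd, gam_gamDag])

theorem diagOp_indIn_add_indOut (P : Params) (u : L2Pair) :
    diagOp (indIn P) u + diagOp (indOut P) u = u :=
  pair_ext (by simp only [WithLp.add_fst, diagOp_fst, indIn_add_indOut])
    (by simp only [WithLp.add_snd, diagOp_snd, indIn_add_indOut])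

theorem norm_sq_diagOp_indIn_add_indOut (P : Params) (u : L2Pair) :
    ‖diagOp (indIn P) u‖ ^ 2 + ‖diagOp (indOut P) u‖ ^ 2 = ‖u‖ ^ 2 :=
  norm_sq_diagOp_add_diagOp (norm_sq_indIn_add_indOut P) u

theorem diagOp_indIn_indIn (P : Params) (u : L2Pair) :
    diagOp (indIn P) (diagOp (indIn P) u) = diagOp (indIn P) u :=
  pair_ext (by simp only [diagOp_fst, indIn_indIn]) (by simp only [diagOp_snd, indIn_indIn])

theorem diagOp_indOut_indOut (P : Params) (u : L2Pair) :
    diagOp (indOut P) (diagOp (indOut P) u) = diagOp (indOut P) u :=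
  pair_ext (by simp only [diagOp_fst, indOut_indOut]) (by simp only [diagOp_snd, indOut_indOut])

theorem diagOp_indOut_gamDagPair (P : Params) (U : Ell2Pair) :
    diagOp (indOut P) (gamDagPair P U) = 0 :=
  pair_ext (by simp only [gamDagPair, diagOp_fst, indOut_gamDag, WithLp.zero_fst])
    (by simp only [gamDagPair, diagOp_snd, indOut_gamDag, WithLp.zero_snd])

theorem gamPair_indOut (P : Params) (u : L2Pair) : gamPair P (diagOp (indOut P) u) = 0 :=
  pair_ext (by simp only [gamPair, diagOp_fst, gam_indOut, WithLp.zero_fst])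
    (by simp only [gamPair, diagOp_snd, gam_indOut, WithLp.zero_snd])

theorem GamDagPair_indOut (P : Params) (K : Ell2Pair →L[ℂ] Ell2Pair) (u : L2Pair) :
    GamDagPair P K (diagOp (indOut P) u) = 0 := by
  have e : GamDagPair P K (diagOp (indOut P) u) =
    gamDagPair P (K (gamPair P (diagOp (indOut P) u))) := rfl
  rw [e, gamPair_indOut, map_zero, map_zero]

theorem norm_GamDagPair_apply_le (P : Params) (K : Ell2Pair →L[ℂ] Ell2Pair) (x : L2Pair) :
    ‖GamDagPair P K x‖ ≤ ‖K‖ * ‖x‖ :=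
  norm_conj_le (Real.sqrt_nonneg (area P))
    (norm_diagOp_of_norm_eq (Real.sqrt_nonneg (area P)) (norm_gamDag P))
    (norm_diagOp_le_of_norm_le (Real.sqrt_nonneg (area P))
      fun u => (norm_gam P u).trans_le (norm_indIn_le P u)) K x

theorem norm_BFull_row_le (P : Params) (N : ℕ) (B11 B12 : Ell2 →L[ℂ] Ell2)
    (hB11 : piUp N ∘L B11 ∘L piUp N = B11) {M1 M2 : L2D4 →L[ℂ] L2D4}
    (h1 : ∀ u, indIn P (M1 u) = M1 u) (h2 : ∀ u, indIn P (M2 u) = M2 u) (x : L2Pair) :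
    ‖BFull P N B11 B12 (blockOp M1 M2 0 0 x)‖ ≤ max 1 ‖B11‖ * ‖blockOp M1 M2 0 0 x‖ :=
  norm_BFull_apply_le P N B11 B12 hB11 (row_apply_fst_fixed h1 h2 x) (row_apply_snd M1 M2 x)

theorem norm_BFull_DGNfull_le (P : Params) (N : ℕ) (U₀ : Ell2Pair) (B11 B12 : Ell2 →L[ℂ] Ell2)
    (hB11 : piUp N ∘L B11 ∘L piUp N = B11) (y : L2Pair) :
    ‖BFull P N B11 B12 (DGNfull P N U₀ y)‖ ≤ max 1 ‖B11‖ * ‖DGNfull P N U₀ y‖ := by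
  have e : DGNfull P N U₀ y = blockOp (mulV1N P N U₀) (mulV2N P N U₀) 0 0 y :=
    congrArg (fun T : L2Pair →L[ℂ] L2Pair => T y) (DGNfull_eq P N U₀)
  rw [e]
  exact norm_BFull_row_le P N B11 B12 hB11 (indIn_mulTrunc P _ _) (indIn_mulTrunc P _ _) y

theorem DGfull_sub_DGNfull (P : Params) (N : ℕ) (U₀ : Ell2Pair) (hu₀ : gamDagPair P U₀ ∈ HD4 P) :
    DGfull P (gamDagPair P U₀) hu₀ - DGNfull P N U₀ =
      blockOp (mulV1 P (gamDagPair P U₀) hu₀ - mulV1N P N U₀)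
        (mulV2 P (gamDagPair P U₀) hu₀ - mulV2N P N U₀) 0 0 :=
  (congrArg (fun T : L2Pair →L[ℂ] L2Pair => DGfull P (gamDagPair P U₀) hu₀ - T)
    (DGNfull_eq P N U₀)).trans (row_sub_row _ _ _ _)

/-- The truncation error of the derivative, in the operator norm. -/
theorem norm_DGfull_sub_DGNfull_le (P : Params) (N N₀ : ℕ) (U₀ : Ell2Pair)
    (hU₀ : diagOp (piUp N₀) U₀ = U₀) (hu₀ : gamDagPair P U₀ ∈ HD4 P) :
    ‖DGfull P (gamDagPair P U₀) hu₀ - DGNfull P N U₀‖ ≤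
      Real.sqrt (ell1Norm (truncSeq (2 * N) (V1 P U₀) - V1 P U₀) ^ 2 +
        ell1Norm (truncSeq (2 * N) (V2 P U₀) - V2 P U₀) ^ 2) := by
  obtain ⟨t1, t2⟩ := isTrig_gamDagPair P N₀ hU₀
  have h1 : ‖mulV1 P (gamDagPair P U₀) hu₀ - mulV1N P N U₀‖ ≤
      ell1Norm (truncSeq (2 * N) (V1 P U₀) - V1 P U₀) :=
    norm_mulD4_sub_mulTrunc_le P (2 * N) (isTrig_v1 P t1 t2) _ _
  have h2 : ‖mulV2 P (gamDagPair P U₀) hu₀ - mulV2N P N U₀‖ ≤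
      ell1Norm (truncSeq (2 * N) (V2 P U₀) - V2 P U₀) :=
    norm_mulD4_sub_mulTrunc_le P (2 * N) (isTrig_v2 P t1) _ _
  exact (congrArg _ (DGfull_sub_DGNfull P N U₀ hu₀)).trans_le (norm_blockOp_row_le _ _ h1 h2)

theorem norm_BFull_DGfull_sub_DGNfull_le (P : Params) (N N₀ : ℕ) (U₀ : Ell2Pair)
    (hU₀ : diagOp (piUp N₀) U₀ = U₀) (hu₀ : gamDagPair P U₀ ∈ HD4 P)
    (B11 B12 : Ell2 →L[ℂ] Ell2) (hB11 : piUp N ∘L B11 ∘L piUp N = B11) (y : L2Pair) :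
    ‖BFull P N B11 B12 ((DGfull P (gamDagPair P U₀) hu₀ - DGNfull P N U₀) y)‖ ≤
      max 1 ‖B11‖ * ‖(DGfull P (gamDagPair P U₀) hu₀ - DGNfull P N U₀) y‖ := by
  obtain ⟨t1, t2⟩ := isTrig_gamDagPair P N₀ hU₀
  have e := congrArg (fun T : L2Pair →L[ℂ] L2Pair => T y) (DGfull_sub_DGNfull P N U₀ hu₀)
  have h1 : ∀ u, indIn P (mulV1 P (gamDagPair P U₀) hu₀ u) = mulV1 P (gamDagPair P U₀) hu₀ u :=
    indIn_mulD4 P _ _ _ (isTrig_v1 P t1 t2).eq_zero_outside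
  have h2 : ∀ u, indIn P (mulV2 P (gamDagPair P U₀) hu₀ u) = mulV2 P (gamDagPair P U₀) hu₀ u :=
    indIn_mulD4 P _ _ _ (isTrig_v2 P t1).eq_zero_outside
  refine le_of_eq_of_le (congrArg (fun z : L2Pair => ‖BFull P N B11 B12 z‖) e) ?_
  refine le_of_le_of_eq (norm_BFull_row_le P N B11 B12 hB11
    (comp_sub_fixed h1 (indIn_mulTrunc P (2 * N) (V1 P U₀)))
    (comp_sub_fixed h2 (indIn_mulTrunc P (2 * N) (V2 P U₀))) y) ?_
  exact congrArg (fun z : L2Pair => max 1 ‖B11‖ * ‖z‖) e.symm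

theorem norm_defect_apply_le (P : Params) (N N₀ : ℕ) (U₀ : Ell2Pair)
    (hU₀ : diagOp (piUp N₀) U₀ = U₀) (hu₀ : gamDagPair P U₀ ∈ HD4 P)
    (B11 B12 : Ell2 →L[ℂ] Ell2) (hB11 : piUp N ∘L B11 ∘L piUp N = B11) {Zu1 Zu2 Z1 : ℝ}
    (h1 : ‖DGNfull P N U₀ ∘L LinvL2 P ∘L diagOp (indOut P)‖ ≤ Zu1)
    (h2 : ‖DGNfull P N U₀ ∘L (GamDagPair P (seqLinv P) - LinvL2 P) ∘L diagOp (indIn P)‖ ≤ Zu2)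
    (hZ1 : ‖1 - BSeq N B11 B12 ∘L (1 + DGN P N U₀ ∘L seqLinv P)‖ ≤ Z1) (x : L2Pair) :
    ‖(1 - BFull P N B11 B12 ∘L (1 + DGfull P (gamDagPair P U₀) hu₀ ∘L LinvL2 P) :
      L2Pair →L[ℂ] L2Pair) x‖ ≤ Zfull1 P N U₀ B11 Z1 Zu1 Zu2 * ‖x‖ := by
  have e := one_sub_parametrix_eq (gamDagPair_gamPair P) (gamPair_gamDagPair P)
    (diagOp_indIn_add_indOut P) (diagOp_indOut_gamDagPair P) (BSeq N B11 B12) (DGN P N U₀)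
    (seqLinv P) (DGfull P (gamDagPair P U₀) hu₀) (LinvL2 P) x
  -- The three terms of the identity are bounded in turn: the finite-dimensional style defect by Z₁,
  -- the difference between 𝕃⁻¹ and Γ†(L⁻¹) by `Zu`, the truncation of v₁ and v₂ by φ times the ℓ¹
  -- tails.
  have t1 : ‖GamDagPair P (1 - BSeq N B11 B12 ∘L (1 + DGN P N U₀ ∘L seqLinv P)) x‖ ≤ Z1 * ‖x‖ :=
    (norm_GamDagPair_apply_le P _ x).trans (mul_le_mul_of_nonneg_right hZ1 (norm_nonneg x))
  have t2 := norm_BFull_DGNfull_le P N U₀ B11 B12 hB11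
    (LinvL2 P x - GamDagPair P (seqLinv P) x)
  have t2' := norm_apply_le_sqrt (diagOp_indIn_add_indOut P) (norm_sq_diagOp_indIn_add_indOut P)
    (diagOp_indIn_indIn P) (diagOp_indOut_indOut P) (GamDagPair_indOut P (seqLinv P)) h1 h2 x
  have t3 := norm_BFull_DGfull_sub_DGNfull_le P N N₀ U₀ hU₀ hu₀ B11 B12 hB11 (LinvL2 P x)
  have t3' := norm_comp_le_mul_of_le (norm_DGfull_sub_DGNfull_le P N N₀ U₀ hU₀ hu₀)
    (norm_LinvL2_le P) x
  have hm : 0 ≤ max 1 ‖B11‖ := zero_le_one.trans (le_max_left _ _)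
  have s2 := t2.trans (mul_le_mul_of_nonneg_left t2' hm)
  have s3 := t3.trans (mul_le_mul_of_nonneg_left t3' hm)
  refine le_of_eq_of_le (congrArg norm e) ?_
  refine (norm_sub_le _ _).trans ((add_le_add ((norm_sub_le _ _).trans (add_le_add t1 s2)) s3).trans
    (le_of_eq ?_))
  rw [Zfull1, Zu]
  ring

theorem Zfull1_nonneg (P : Params) (N : ℕ) (U₀ : Ell2Pair) (B11 : Ell2 →L[ℂ] Ell2)
    {Z1 : ℝ} (hZ1 : 0 ≤ Z1) (Zu1 Zu2 : ℝ) : 0 ≤ Zfull1 P N U₀ B11 Z1 Zu1 Zu2 := by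
  -- This value of φ dominates an operator norm.
  have h : 0 ≤ phi 1 0 (|P.lam1 * P.lam2 - 1| / P.lam2) (1 / P.lam2) :=
    (LinvL2 P).opNorm_nonneg.trans (norm_LinvL2_le P)
  exact add_nonneg hZ1 (mul_nonneg (zero_le_one.trans (le_max_left _ _))
    (add_nonneg (Real.sqrt_nonneg _) (mul_nonneg h (Real.sqrt_nonneg _))))

theorem norm_id_sub_AFull_comp_fderiv_le (P : Params) (N N₀ : ℕ) (U₀ : Ell2Pair)
    (hU₀ : diagOp (piUp N₀) U₀ = U₀) (hu₀ : gamDagPair P U₀ ∈ HD4 P)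
    (B11 B12 : Ell2 →L[ℂ] Ell2) (hB11 : piUp N ∘L B11 ∘L piUp N = B11) {Zu1 Zu2 Z1 : ℝ}
    (h1 : ‖DGNfull P N U₀ ∘L LinvL2 P ∘L diagOp (indOut P)‖ ≤ Zu1)
    (h2 : ‖DGNfull P N U₀ ∘L (GamDagPair P (seqLinv P) - LinvL2 P) ∘L diagOp (indIn P)‖ ≤ Zu2)
    (hZ1 : 0 ≤ Z1) (hZ1' : ‖1 - BSeq N B11 B12 ∘L (1 + DGN P N U₀ ∘L seqLinv P)‖ ≤ Z1) :
    ‖ContinuousLinearMap.id ℂ (HSpace P) -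
      AFull P N B11 B12 ∘L fderiv ℂ (FMap P) (HSpace.mk P (gamDagPair P U₀) hu₀)‖ ≤
      Zfull1 P N U₀ B11 Z1 Zu1 Zu2 :=
  le_of_eq_of_le (congrArg (fun T => ‖ContinuousLinearMap.id ℂ (HSpace P) -
      AFull P N B11 B12 ∘L T‖) (fderiv_FMap P (HSpace.mk P (gamDagPair P U₀) hu₀)))
    (norm_id_sub_comp_le (Liso P) (BFull P N B11 B12) (DGfull P (gamDagPair P U₀) hu₀) (LinvL2 P)
      (Zfull1_nonneg P N U₀ B11 hZ1 Zu1 Zu2)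
      (norm_defect_apply_le P N N₀ U₀ hU₀ hu₀ B11 B12 hB11 h1 h2 hZ1'))

end GrayScott

end

/-! ### The theorem: the two duality bounds feed the bound on the defect. -/

theorem mainTheorem12 (P : GrayScott.Params) (N N₀ : ℕ) (U₀ : GrayScott.Ell2Pair)
    (hreal : ∀ n, (U₀.fst n).im = 0 ∧ (U₀.snd n).im = 0)
    (hU₀ : GrayScott.diagOp (GrayScott.piUp N₀) U₀ = U₀)
    (hu₀ : GrayScott.gamDagPair P U₀ ∈ GrayScott.HD4 P)
    (B11 B12 : GrayScott.Ell2 →L[ℂ] GrayScott.Ell2)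
    (hB11 : GrayScott.piUp N ∘L B11 ∘L GrayScott.piUp N = B11)
    (hB12 : GrayScott.piUp N ∘L B12 ∘L GrayScott.piUp N = B12)
    (Zu11 Zu12 Zu13 Zu21 Zu22 Zu23 Zu1 Zu2 Z1 : ℝ)
    (h11 : ‖GrayScott.indOut P ∘L GrayScott.L11inv P ∘L GrayScott.mulV1N P N U₀‖ ≤ Zu11)
    (h12 : ‖GrayScott.indOut P ∘L GrayScott.L22inv P ∘L GrayScott.mulV2N P N U₀‖ ≤ Zu12)
    (h13 : ‖GrayScott.indOut P ∘L (GrayScott.L22inv P ∘L GrayScott.L21 P ∘L GrayScott.L11inv P) ∘L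
      GrayScott.mulV2N P N U₀‖ ≤ Zu13)
    (h21 : ‖GrayScott.indIn P ∘L
      (GrayScott.L11inv P - GrayScott.GamDag P (GrayScott.seqL11inv P)) ∘L
      GrayScott.mulV1N P N U₀‖ ≤ Zu21)
    (h22 : ‖GrayScott.indIn P ∘L
      (GrayScott.L22inv P - GrayScott.GamDag P (GrayScott.seqL22inv P)) ∘L
      GrayScott.mulV2N P N U₀‖ ≤ Zu22)
    (h23 : ‖GrayScott.indIn P ∘L
      (GrayScott.L22inv P ∘L GrayScott.L21 P ∘L GrayScott.L11inv P - GrayScott.GamDag P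
        (GrayScott.seqL22inv P ∘L GrayScott.seqL21 P ∘L GrayScott.seqL11inv P)) ∘L
      GrayScott.mulV2N P N U₀‖ ≤ Zu23)
    (hZu1 : Zu1 = Real.sqrt ((Zu11 + Zu13) ^ 2 + Zu12 ^ 2))
    (hZu2 : Zu2 = Real.sqrt ((Zu21 + Zu23) ^ 2 + Zu22 ^ 2))
    (hZ1 : 0 ≤ Z1)
    (hZ1' : ‖1 - GrayScott.BSeq N B11 B12 ∘L
      (1 + GrayScott.DGN P N U₀ ∘L GrayScott.seqLinv P)‖ ≤ Z1) :
    ‖GrayScott.DGNfull P N U₀ ∘L GrayScott.LinvL2 P ∘L GrayScott.diagOp (GrayScott.indOut P)‖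
        ≤ Zu1 ∧
    ‖GrayScott.DGNfull P N U₀ ∘L
        (GrayScott.GamDagPair P (GrayScott.seqLinv P) - GrayScott.LinvL2 P) ∘L
        GrayScott.diagOp (GrayScott.indIn P)‖ ≤ Zu2 ∧
    ‖ContinuousLinearMap.id ℂ (GrayScott.HSpace P) - GrayScott.AFull P N B11 B12 ∘L
        fderiv ℂ (GrayScott.FMap P)
          (GrayScott.HSpace.mk P (GrayScott.gamDagPair P U₀) hu₀)‖ ≤
      GrayScott.Zfull1 P N U₀ B11 Z1 Zu1 Zu2 := by
  subst hZu1 hZu2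
  have c1 := GrayScott.norm_DGNfull_outside_le P N U₀ h11 h12 h13
  have c2 := GrayScott.norm_DGNfull_inside_le P N U₀ h21 h22 h23
  exact ⟨c1, c2, GrayScott.norm_id_sub_AFull_comp_fderiv_le P N N₀ U₀ hU₀ hu₀ B11 B12 hB11
    c1 c2 hZ1 hZ1'⟩
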